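/- Let $k$ be a field. **Triples.** Let $\mathcal A$ be the following category. An object is a triple $(N,\Sigma,\Gamma)$, where $N$ is a lattice (a free abelian group of finite rank) with dual lattice $M=\mathrm{Hom}(N,\mathbf Z)$; $\Sigma$ is a fan in $N_{\mathbf R}=N\otimes_{\mathbf Z}\mathbf R$, that is, a finite non-empty set of strictly convex polyhedral cones, rational for $N$, which contains every face of each of its cones and in which the intersection of any two cones is a face of both; and $\Gamma=\{\Gamma_\sigma\}_{\sigma\in\Sigma}$ is a family of finitely generated subsemigroups (containing $0$) of $M$ such that, with $\check\sigma\subset M_{\mathbf R}$ the dual cone of $\sigma$, i. $\mathbf Z\Gamma_\sigma=M$ and $\mathbf R_{\ge 0}\Gamma_\sigma=\check\sigma$ for every $\sigma\in\Sigma$; ii. $\Gamma_\tau=\Gamma_\sigma+M(\tau,\Gamma_\sigma)$ for every $\sigma\in\Sigma$ and every face $\tau$ of $\sigma$, where $M(\tau,\Gamma_\sigma)$ is the sublattice of $M$ spanned by $\Gamma_\sigma\cap\tau^\perp$. A morphism $(N',\Sigma',\Gamma')\to(N,\Sigma,\Gamma)$ (a map of fans with attached semigroups) is a homomorphism $\phi_*:N'\to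 N$, with dual $\phi^*:M\to M'$, such that for every $\sigma'\in\Sigma'$ there is $\sigma\in\Sigma$ with $\phi^*(\Gamma_\sigma)\subset\Gamma'_{\sigma'}$. **Toric varieties.** Let $\mathcal B$ be the following category. An object is a toric variety over $k$: an integral separated scheme $X$ of finite type over $k$, equipped with an action of an algebraic torus $T$ (a $k$-group scheme isomorphic to $\mathbf G_m^d$ for some $d\ge 0$) which is embedded in $X$ as a Zariski open set, such that the action $T\times X\to X$ is a morphism extending the multiplication of $T$, and such that $X$ has a finite covering by affine $T$-invariant Zariski open sets. A morphism $(T',X')\to(T,X)$ is a homomorphism of algebraic groups $\phi:T'\to T$ together with a morphism of $k$-schemes $f:X'\to X$ which extends $\phi$ and is equivariant with respect to $\phi$. **Corollary.** The categories $\mathcal A$ and $\mathcal B$ are equivalent. More precisely, there is an equivalence $\mathcal A\to\mathcal B$ which sends $(N,\Sigma,\Gamma)$ to the toric variety $T^\Gamma_\Sigma$ with torus $T^M=\mathrm{Spec}\,k[t^M]$, the union of the affine varieties $T^{\Gamma_\sigma}=\mathrm{Spec}\,k[t^{\Gamma_\sigma}]$, $\sigma\in\Sigma$, where $T^{\Gamma_\sigma}$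 and $T^{\Gamma_{\sigma'}}$ are glued along their common open subvariety $T^{\Gamma_{\sigma\cap\sigma'}}$, and which sends $\phi_*$ to the equivariant morphism extending the homomorphism of tori $T^{M'}\to T^M$, $t^m\mapsto t^{\phi^*(m)}$. -/

import Mathlib

open CategoryTheory AlgebraicGeometry MonoidalCategory CartesianMonoidalCategory MonObj
open scoped TensorProduct MonoidalLeftAction

universe u

noncomputable section

namespace ToricGeometry

/-! ### Fans with attached semigroups -/

/-- The real vector space `N_ℝ = ℝ ⊗ N`. -/
abbrev RealSpace (N : Type u) [AddCommGroup N] : Type u := ℝ ⊗[ℤ] N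

/-- The dual lattice `M = Hom(N, ℤ)`. -/
abbrev DualLattice (N : Type u) [AddCommGroup N] : Type u := Module.Dual ℤ N

section Cones

variable {N : Type u} [AddCommGroup N]

/-- The inclusion `M → M_ℝ`, where `M_ℝ` is identified with the dual space of `N_ℝ`. -/
def realChar (m : DualLattice N) : Module.Dual ℝ (RealSpace N) := m.baseChange ℝ

/-- The dual cone `σ^∨ ⊆ M_ℝ`. -/
def dualCone (σ : PointedCone ℝ (RealSpace N)) :
    PointedCone ℝ (Module.Dual ℝ (RealSpace N)) :=
  PointedCone.dual (Module.Dual.eval ℝ (RealSpace N)) (σ : Set (RealSpace N))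

/-- A polyhedral cone that is rational for `N`: it is generated by finitely many vectors of `N`. -/
def IsRationalPolyhedral (σ : PointedCone ℝ (RealSpace N)) : Prop :=
  ∃ S : Set N, S.Finite ∧ σ = PointedCone.hull ℝ ((fun v : N => (1 : ℝ) ⊗ₜ[ℤ] v) '' S)

/-- For a subsemigroup `G` of `M`, the sublattice `M(τ, G)` of `M` spanned by `G ∩ τ^⊥`. -/
def faceLattice (τ : PointedCone ℝ (RealSpace N)) (G : AddSubmonoid (DualLattice N)) :
    AddSubgroup (DualLattice N) :=
  AddSubgroup.closure {m | m ∈ G ∧ ∀ v ∈ τ, realChar m v = 0}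

end Cones

/-- A (nonempty, finite) fan in `N_ℝ`. -/
structure Fan (N : Type u) [AddCommGroup N] where
  /-- the cones of the fan -/
  cones : Set (PointedCone ℝ (RealSpace N))
  finite : cones.Finite
  nonempty : cones.Nonempty
  rational : ∀ σ ∈ cones, IsRationalPolyhedral σ
  strictlyConvex : ∀ σ ∈ cones, (σ : ConvexCone ℝ (RealSpace N)).Salient
  face_mem : ∀ σ ∈ cones, ∀ τ : PointedCone ℝ (RealSpace N), τ.IsFaceOf σ → τ ∈ cones
  inter_isFace : ∀ σ ∈ cones, ∀ σ' ∈ cones, (σ ⊓ σ').IsFaceOf σ ∧ (σ ⊓ σ').IsFaceOf σ'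

/-- A triple `(N, Σ, Γ)`: a lattice, a fan and a compatible family of semigroups. -/
structure ToricTriple where
  /-- the lattice -/
  N : Type u
  [addCommGroup : AddCommGroup N]
  [free : Module.Free ℤ N]
  [finite : Module.Finite ℤ N]
  /-- the fan -/
  fan : Fan N
  /-- the attached semigroups -/
  Γ : fan.cones → AddSubmonoid (DualLattice N)
  fg : ∀ σ, (Γ σ).FG
  closure_eq_top : ∀ σ, AddSubgroup.closure (Γ σ : Set (DualLattice N)) = ⊤
  hull_eq_dualCone : ∀ σ, PointedCone.hull ℝ (realChar '' (Γ σ : Set (DualLattice N))) =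
    dualCone σ.1
  face_eq : ∀ σ τ : fan.cones, τ.1.IsFaceOf σ.1 →
    Γ τ = Γ σ ⊔ (faceLattice τ.1 (Γ σ)).toAddSubmonoid

attribute [instance] ToricTriple.addCommGroup ToricTriple.free ToricTriple.finite

/-- The map `φ^* : M → M'` dual to `φ_* : N' → N`. -/
def dualMap {N' N : Type u} [AddCommGroup N'] [AddCommGroup N] (φ : N' →ₗ[ℤ] N) :
    DualLattice N →+ DualLattice N' :=
  (Module.Dual.transpose (R := ℤ) φ).toAddMonoidHom

/-- A map of fans with attached semigroups from `(N', Σ', Γ')` to `(N, Σ, Γ)`. -/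
@[ext]
structure ToricTriple.Hom (t' t : ToricTriple.{u}) where
  /-- the homomorphism `φ_* : N' → N` -/
  toLinearMap : t'.N →ₗ[ℤ] t.N
  exists_cone : ∀ σ' : t'.fan.cones, ∃ σ : t.fan.cones,
    (t.Γ σ).map (dualMap toLinearMap) ≤ t'.Γ σ'

instance : Category ToricTriple.{u} where
  Hom := ToricTriple.Hom
  id t := ⟨LinearMap.id, fun σ => ⟨σ, by rintro _ ⟨m, hm, rfl⟩; exact hm⟩⟩
  comp {t₁ t₂ t₃} f g := ⟨g.toLinearMap ∘ₗ f.toLinearMap, fun σ₁ => by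
    obtain ⟨σ₂, h₂⟩ := f.exists_cone σ₁
    obtain ⟨σ₃, h₃⟩ := g.exists_cone σ₂
    refine ⟨σ₃, ?_⟩
    rintro _ ⟨m, hm, rfl⟩
    exact h₂ ⟨_, h₃ ⟨m, hm, rfl⟩, rfl⟩⟩

/-! ### Toric varieties -/

variable (k : Type u) [Field k]

/-- Schemes over the field `k`. -/
abbrev KScheme : Type (u + 1) := Over (Spec (CommRingCat.of k))

/-- The affine `k`-scheme `T^G = Spec k[t^G]` of an additive commutative monoid `G`. -/
abbrev affineToric (G : Type u) [AddCommMonoid G] : KScheme k :=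
  (algSpec (CommRingCat.of k)).obj (.op (CommAlgCat.of k (AddMonoidAlgebra k G)))

/-- The morphism `T^H → T^G` given by `t^g ↦ t^(f g)`. -/
abbrev affineToricMap {G H : Type u} [AddCommMonoid G] [AddCommMonoid H] (f : G →+ H) :
    affineToric k H ⟶ affineToric k G :=
  (algSpec (CommRingCat.of k)).map
    (CommAlgCat.ofHom (AddMonoidAlgebra.mapDomainAlgHom k k f)).op

/-- The `k`-group scheme `T^A = Spec k[t^A]` of an additive commutative group `A`. -/
abbrev diagGroup (A : Type u) [AddCommGroup A] : Grp (KScheme k) :=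
  (hopfSpec (CommRingCat.of k)).obj (.op (CommHopfAlgCat.of k (AddMonoidAlgebra k A)))

/-- The homomorphism of group schemes `T^B → T^A` given by `t^a ↦ t^(f a)`. -/
abbrev diagGroupMap {A B : Type u} [AddCommGroup A] [AddCommGroup B] (f : A →+ B) :
    diagGroup k B ⟶ diagGroup k A :=
  (hopfSpec (CommRingCat.of k)).map
    (CommHopfAlgCat.ofHom (AddMonoidAlgebra.mapDomainBialgHom k f)).op

/-- An algebraic torus: a group scheme isomorphic to `𝔾_m^d = Spec k[t₁^±1, …, t_d^±1]`
for some `d`. -/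
def IsTorus (T : Grp (KScheme k)) : Prop :=
  ∃ d : ℕ, Nonempty (T ≅ diagGroup k (ULift.{u} (Fin d) → ℤ))

/-- The action morphism `T × X → X`. -/
abbrev actionMap {k : Type u} [Field k] (T : Grp (KScheme k)) (X : KScheme k) [ModObj T.X X] :
    T.X ⊗ X ⟶ X :=
  γ[T.X, X]

/-- An open subscheme `U` of `X` is invariant under the action of `T` when the action
`T × X → X` maps `T × U` into `U`. -/
def IsInvariantOpen {k : Type u} [Field k] (T : Grp (KScheme k)) (X : KScheme k) [ModObj T.X X]
    (U : X.left.Opens) : Prop :=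
  (snd T.X X).left ⁻¹ᵁ U ≤ (actionMap T X).left ⁻¹ᵁ U

/-- A toric variety over `k`: an integral separated scheme of finite type over `k` with an action
of a torus `T` that is embedded as an open subscheme, such that the action extends the
multiplication of `T`, and which has a finite covering by affine `T`-invariant open subschemes. -/
structure ToricVariety where
  /-- the underlying `k`-scheme -/
  X : KScheme k
  /-- the torus -/
  T : Grp (KScheme k)
  isTorus : IsTorus k T
  [isIntegral : IsIntegral X.left]
  [isSeparated : IsSeparated X.hom]
  [locallyOfFiniteType : LocallyOfFiniteType X.hom]
  [quasiCompact : QuasiCompact X.hom]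
  /-- the action of the torus -/
  [action : ModObj T.X X]
  /-- the embedding of the torus -/
  emb : T.X ⟶ X
  [isOpenImmersion : IsOpenImmersion emb.left]
  mul_emb : (μ : T.X ⊗ T.X ⟶ T.X) ≫ emb = (T.X ◁ emb) ≫ actionMap T X
  exists_cover : ∃ 𝒰 : Set X.left.Opens, 𝒰.Finite ∧
    (∀ U ∈ 𝒰, IsAffineOpen U ∧ IsInvariantOpen T X U) ∧ sSup 𝒰 = ⊤

attribute [instance] ToricVariety.isIntegral ToricVariety.isSeparated
  ToricVariety.locallyOfFiniteType ToricVariety.quasiCompact ToricVariety.action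
  ToricVariety.isOpenImmersion

variable {k}

/-- A morphism of toric varieties: a morphism of schemes that extends a homomorphism of the tori
and is equivariant with respect to it. -/
@[ext]
structure ToricVariety.Hom (Y Z : ToricVariety k) where
  /-- the homomorphism of tori -/
  torusHom : Y.T ⟶ Z.T
  /-- the morphism of schemes over `k` -/
  hom : Y.X ⟶ Z.X
  emb_hom : Y.emb ≫ hom = torusHom.hom.hom ≫ Z.emb
  smul_hom : actionMap Y.T Y.X ≫ hom =
    (torusHom.hom.hom ⊗ₘ hom) ≫ actionMap Z.T Z.X

instance : Category (ToricVariety k) where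
  Hom := ToricVariety.Hom
  id Y := ⟨𝟙 _, 𝟙 _, by simp, by simp⟩
  comp f g := ⟨f.torusHom ≫ g.torusHom, f.hom ≫ g.hom,
    by rw [← Category.assoc, f.emb_hom, Category.assoc, g.emb_hom]; simp,
    by
      rw [← Category.assoc, f.smul_hom, Category.assoc, g.smul_hom, ← Category.assoc,
        tensorHom_comp_tensorHom]
      simp⟩

/-! ### The toric variety of a triple -/

/-- The data exhibiting a toric variety `Y` as the toric variety `T_Σ^Γ` of the triple
`t = (N, Σ, Γ)`: an identification of its torus with `T^M`, and open immersions of the affine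
toric varieties `T^{Γ_σ}`, `σ ∈ Σ`, compatible with the embeddings of the torus, which cover `Y`
and are glued along the open subvarieties `T^{Γ_{σ ∩ σ'}}`. -/
structure GluingData (t : ToricTriple.{u}) (Y : ToricVariety k) where
  /-- the identification of the torus with `T^M` -/
  torusIso : Y.T ≅ diagGroup k (DualLattice t.N)
  /-- the affine charts -/
  chart : ∀ σ : t.fan.cones, affineToric k (t.Γ σ) ⟶ Y.X
  [isOpenImmersion : ∀ σ, IsOpenImmersion (chart σ).left]
  emb_eq : ∀ σ, torusIso.hom.hom.hom ≫ affineToricMap k (t.Γ σ).subtype ≫ chart σ = Y.emb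
  chart_face : ∀ (σ τ : t.fan.cones) (h : t.Γ σ ≤ t.Γ τ), τ.1.IsFaceOf σ.1 →
    affineToricMap k (AddSubmonoid.inclusion h) ≫ chart σ = chart τ
  cover : ⨆ σ, (chart σ).left.opensRange = ⊤
  inter : ∀ σ σ' τ : t.fan.cones, τ.1 = σ.1 ⊓ σ'.1 →
    (chart σ).left.opensRange ⊓ (chart σ').left.opensRange = (chart τ).left.opensRange

end ToricGeometry

end

noncomputable section

namespace ToricGeometry

/-! ### Fourier–Motzkin elimination and rational polyhedral duality -/

section FourierMotzkin

variable {L L' : Type*} [AddCommGroup L'] (p : L → L' →+ ℤ)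

/-! The torus is dense in a toric variety and toric varieties are separated, so a morphism is
determined by its restriction to the torus, and a chart `T^S → Y` compatible with the torus is
determined by the semigroup `S`. The theorem thus becomes a statement about which semigroups of
characters occur, in three parts.

Triples give varieties. Fourier–Motzkin elimination describes finitely generated cones by finitely
many integral inequalities, valid over every ordered field. Hence `σ` is recovered from `Γ_σ`, a
character nonnegative on `σ` has a positive multiple in `Γ_σ`, and the faces of `σ` are exposed by
elements of `Γ_σ`. It follows that passing to a face inverts a single character, which gives open
immersions of charts, and that `Γ_{σ∩σ'} = Γ_σ + Γ_{σ'}` (`ToricTriple.Γ_inter`). The charts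
therefore glue, and the surjectivity of `k[Γ_σ] ⊗ k[Γ_σ'] → k[Γ_{σ∩σ'}]` makes the result separated.
The action is extended from the multiplication of the torus chart by chart.

Full faithfulness. Homomorphisms of the tori are maps of the character lattices, hence maps of the
lattices `N`. The noninvertible characters of `S` span a prime of `k[S]`, the generic point of the
closed orbit. Every point of `T^S` has a torus translate specializing to it
(`exists_specializes_orbitPoint`). So an invariant open set that contains the image of this point
contains the image of all of `T^S`: an equivariant morphism sends each chart into a single chart,
which is the condition on semigroups in a morphism of triples.

Essential surjectivity. The coordinate ring of a nonempty invariant affine open set embeds in `k[M]`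
as a subalgebra stable under the coaction, hence is spanned by characters
(`exists_isChart_of_isAffineOpen`). An inclusion of charts is a localization at a face, by looking
at the stalk of the orbit point (`exists_denominator`), and separatedness makes the intersection of
the charts of `S` and `S'` the chart of `S + S'`. So the cones of the chart semigroups form a fan.
It is finite because every chart lies in a member of the given finite cover, and each chart
semigroup is determined by its cone (`coneOf_injOn_chartMonoids`). -/

open Classical in
/-- One step of Fourier–Motzkin elimination: the inequalities defining the sum of the cone defined
by `A` and of the ray of `g`. -/
def fourierMotzkinStep (g : L) (A : Finset L') : Finset L' :=
  {a ∈ A | 0 ≤ p g a} ∪ Finset.image₂ (fun a b => (-(p g b)) • a + (p g a) • b)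
    {a ∈ A | 0 < p g a} {b ∈ A | p g b < 0}

open Classical in
/-- Inequalities defining the cone generated by a list, where `B` separates points. -/
def fourierMotzkin (B : Finset L') : List L → Finset L'
  | [] => B ∪ B.image Neg.neg
  | g :: G => fourierMotzkinStep p g (fourierMotzkin B G)

variable {K : Type*} [Field K] [LinearOrder K] [IsStrictOrderedRing K]
  {E : Type*} [AddCommGroup E] [Module K E] (i : L → E) (ψ : L' →+ Module.Dual K E)

variable {p i ψ}

/-- Each inequality bounds `r` above or below according to the sign of `p g a`. A suitable `r`
exists when every lower bound is at most every upper bound, and the combined inequalities, in which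
`g` cancels, say this. -/
theorem exists_sub_smul_nonneg_iff (hp : ∀ l a, ψ a (i l) = p l a) (g : L) (A : Finset L') (x : E) :
    (∃ r : K, 0 ≤ r ∧ ∀ a ∈ A, 0 ≤ ψ a (x - r • i g)) ↔
      ∀ a ∈ fourierMotzkinStep p g A, 0 ≤ ψ a x := by
  classical
  simp only [map_sub, map_smul, hp, smul_eq_mul, sub_nonneg]
  constructor
  · rintro ⟨r, hr, h⟩ a ha
    simp only [fourierMotzkinStep, Finset.mem_union, Finset.mem_filter, Finset.mem_image₂] at ha
    rcases ha with ⟨ha, ha'⟩ | ⟨a, ⟨ha, ha'⟩, b, ⟨hb, hb'⟩, rfl⟩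
    · exact le_trans (mul_nonneg hr (by exact_mod_cast ha')) (h a ha)
    · have h1 : (0 : K) < p g a := by exact_mod_cast ha'
      have h2 : ((p g b : ℤ) : K) < 0 := by exact_mod_cast hb'
      have h3 := h a ha
      have h4 := h b hb
      simp only [map_add, map_zsmul, LinearMap.add_apply, LinearMap.smul_apply, zsmul_eq_mul,
        Int.cast_neg]
      nlinarith
  · intro h
    obtain ⟨r, hr0, hlo, hup⟩ : ∃ r : K, 0 ≤ r ∧ (∀ b ∈ A, p g b < 0 → ψ b x / ((p g b : ℤ) : K) ≤ r) ∧
        ∀ a ∈ A, 0 < p g a → r ≤ ψ a x / ((p g a : ℤ) : K) := by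
      -- The lower bound `0` encodes `0 ≤ r`; it is compatible with the upper bounds because the
      -- inequalities with `0 < p g a` are kept in the step. The largest lower bound serves as `r`.
      let lo : Finset K := insert 0 ((A.filter fun b => p g b < 0).image
        fun b => ψ b x / ((p g b : ℤ) : K))
      have hlo : lo.Nonempty := Finset.insert_nonempty _ _
      refine ⟨lo.max' hlo, Finset.le_max' _ _ (Finset.mem_insert_self _ _), fun b hb hb' => ?_,
        fun a ha h0 => ?_⟩
      · exact Finset.le_max' _ _ (Finset.mem_insert_of_mem
          (Finset.mem_image_of_mem (fun b => ψ b x / ((p g b : ℤ) : K))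
            (Finset.mem_filter.2 ⟨hb, hb'⟩)))
      refine Finset.max'_le _ _ _ fun y hy => ?_
      have h1 : (0 : K) < ((p g a : ℤ) : K) := Int.cast_pos.2 h0
      rcases Finset.mem_insert.1 hy with rfl | hy
      · exact div_nonneg (h a (Finset.mem_union_left _ (Finset.mem_filter.2 ⟨ha, h0.le⟩))) h1.le
      · obtain ⟨b, hb, rfl⟩ := Finset.mem_image.1 hy
        obtain ⟨hb, hb'⟩ := Finset.mem_filter.1 hb
        have h2 : ((p g b : ℤ) : K) < 0 := Int.cast_lt_zero.2 hb'
        have h3 := h _ (Finset.mem_union_right _ (Finset.mem_image₂_of_mem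
          (Finset.mem_filter.2 ⟨ha, h0⟩) (Finset.mem_filter.2 ⟨hb, hb'⟩)))
        simp only [map_add, map_zsmul, LinearMap.add_apply, LinearMap.smul_apply, zsmul_eq_mul,
          Int.cast_neg] at h3
        rw [div_le_iff_of_neg h2, div_mul_eq_mul_div, div_le_iff₀ h1]
        linarith
    refine ⟨r, hr0, fun a ha => ?_⟩
    rcases lt_trichotomy (p g a) 0 with h0 | h0 | h0
    · exact (div_le_iff_of_neg (Int.cast_lt_zero.2 h0)).1 (hlo a ha h0)
    · rw [h0, Int.cast_zero, mul_zero]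
      exact h a (Finset.mem_union_left _ (Finset.mem_filter.2 ⟨ha, h0.ge⟩))
    · exact (le_div_iff₀ (Int.cast_pos.2 h0)).1 (hup a ha h0)

/-- Induction on the generators: `x` lies in the larger cone when some `x - r • g` with `r ≥ 0` lies
in the smaller one. Since the pairing `p` is integral, the same list of inequalities serves every
ordered field `K`. -/
theorem mem_hull_iff_fourierMotzkin (hp : ∀ l a, ψ a (i l) = p l a) {B : Finset L'}
    (hB : ∀ x, (∀ a ∈ B, ψ a x = 0) → x = 0) (G : List L) (x : E) :
    x ∈ PointedCone.hull K (i '' {g | g ∈ G}) ↔ ∀ a ∈ fourierMotzkin p B G, 0 ≤ ψ a x := by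
  induction G generalizing x with
  | nil =>
    simp only [List.not_mem_nil, Set.ofPred_false, Set.image_empty, fourierMotzkin,
      Finset.mem_union, Finset.mem_image]
    rw [PointedCone.hull, Submodule.span_empty, Submodule.mem_bot]
    refine ⟨by rintro rfl; simp, fun h => hB x fun a ha => le_antisymm ?_ (h a (.inl ha))⟩
    simpa using h (-a) (.inr ⟨a, ha, rfl⟩)
  | cons g G ih =>
    rw [fourierMotzkin, ← exists_sub_smul_nonneg_iff hp]
    simp only [← ih]
    have : {g' | g' ∈ g :: G} = insert g {g' | g' ∈ G} := by ext; simp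
    rw [this, Set.image_insert_eq, PointedCone.hull, Submodule.mem_span_insert]
    constructor
    · rintro ⟨c, z, hz, rfl⟩
      exact ⟨c, c.2, by simpa [← Nonneg.coe_smul] using hz⟩
    · rintro ⟨r, hr, h⟩
      exact ⟨⟨r, hr⟩, _, h, by simp [Nonneg.mk_smul]⟩

end FourierMotzkin

/-! ### Duality, saturation and faces for rational cones. -/

section Duality

variable {N : Type u} [AddCommGroup N]

@[simp]
theorem realChar_tmul (m : DualLattice N) (r : ℝ) (n : N) : realChar m (r ⊗ₜ n) = r * m n := by
  simp [realChar, Module.Dual.baseChange, mul_comm]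

theorem realChar_add (m m' : DualLattice N) : realChar (m + m') = realChar m + realChar m' := by
  ext; simp [realChar]

/-- `realChar` as a homomorphism. -/
def realCharHom : DualLattice N →+ Module.Dual ℝ (RealSpace N) :=
  AddMonoidHom.mk' realChar realChar_add

section Realization

variable (K : Type) [Field K]

theorem baseChange_one_tmul (m : DualLattice N) (n : N) :
    m.baseChange K (1 ⊗ₜ n) = (m n : K) := by
  simp [Module.Dual.baseChange]

/-- Evaluation of functionals on `K ⊗ N` at lattice vectors. -/
def evalLattice : N →+ Module.Dual K (Module.Dual K (K ⊗[ℤ] N)) :=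
  AddMonoidHom.mk' (fun n => Module.Dual.eval K _ (1 ⊗ₜ n)) fun a b => by
    rw [TensorProduct.tmul_add, map_add]

theorem baseChange_add (m m' : DualLattice N) :
    (m + m').baseChange K = m.baseChange K + m'.baseChange K := by
  ext
  simp only [baseChange_one_tmul, LinearMap.add_apply, TensorProduct.AlgebraTensorModule.curry_apply,
    TensorProduct.curry_apply, Int.cast_add,
    LinearMap.coe_restrictScalars]

end Realization

variable [Module.Free ℤ N]

theorem dual_ext_of_basis (K : Type) [Field K] {φ : Module.Dual K (K ⊗[ℤ] N)}
    (h : ∀ j, φ (1 ⊗ₜ Module.Free.chooseBasis ℤ N j) = 0) : φ = 0 := by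
  apply ((Module.Free.chooseBasis ℤ N).baseChange K).ext
  intro j
  simpa using h j

theorem realSpace_ext_of_basis {x : RealSpace N}
    (h : ∀ j, realChar ((Module.Free.chooseBasis ℤ N).coord j) x = 0) : x = 0 := by
  let b := (Module.Free.chooseBasis ℤ N).baseChange ℝ
  apply b.ext_elem
  intro j
  rw [map_zero, Finsupp.zero_apply, ← h j]
  have : b.coord j = realChar ((Module.Free.chooseBasis ℤ N).coord j) := by
    apply b.ext
    intro l
    simp [b, Finsupp.single_apply]
  exact congr($this x)

theorem realSpace_ext {x : RealSpace N} (h : ∀ m : DualLattice N, realChar m x = 0) : x = 0 :=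
  realSpace_ext_of_basis fun _ => h _

variable [Module.Finite ℤ N]

/-- A rational polyhedral cone is defined by finitely many integral inequalities. -/
theorem exists_inequalities_of_hull {S : Set N} (hS : S.Finite) :
    ∃ A : Finset (DualLattice N), ∀ v : RealSpace N,
      v ∈ PointedCone.hull ℝ ((fun v : N => (1 : ℝ) ⊗ₜ[ℤ] v) '' S) ↔ ∀ a ∈ A, 0 ≤ realChar a v := by
  classical
  obtain ⟨G, hG⟩ : ∃ G : List N, {g | g ∈ G} = S :=
    ⟨hS.toFinset.toList, by ext; simp⟩
  refine ⟨fourierMotzkin (fun (l : N) => (Module.Dual.eval ℤ N l).toAddMonoidHom)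
    (Finset.univ.image (Module.Free.chooseBasis ℤ N).coord) G, fun v => ?_⟩
  rw [← hG]
  exact mem_hull_iff_fourierMotzkin (ψ := realCharHom) (K := ℝ)
    (p := fun (l : N) => (Module.Dual.eval ℤ N l).toAddMonoidHom)
    (fun l a => by simp [realCharHom])
    (fun x hx => realSpace_ext_of_basis fun j => hx _ (by simp)) G v

/-- The cone generated by finitely many characters is defined by finitely many integral
inequalities, over any ordered field. -/
theorem exists_inequalities_of_hull_dual {G : Set (DualLattice N)} (hG : G.Finite) :
    ∃ A : Finset N, ∀ (K : Type) [Field K] [LinearOrder K] [IsStrictOrderedRing K]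
      (φ : Module.Dual K (K ⊗[ℤ] N)),
      φ ∈ PointedCone.hull K ((fun m : DualLattice N => m.baseChange K) '' G) ↔
        ∀ a ∈ A, 0 ≤ φ (1 ⊗ₜ a) := by
  classical
  obtain ⟨G, rfl⟩ : ∃ G' : List (DualLattice N), {g | g ∈ G'} = G :=
    ⟨hG.toFinset.toList, by ext; simp⟩
  refine ⟨fourierMotzkin (fun (m : DualLattice N) => m.toAddMonoidHom)
    (Finset.univ.image (Module.Free.chooseBasis ℤ N)) G, fun K _ _ _ φ => ?_⟩
  exact mem_hull_iff_fourierMotzkin (ψ := evalLattice K) (K := K)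
    (p := fun (m : DualLattice N) => m.toAddMonoidHom)
    (fun l a => by simp [evalLattice])
    (fun x hx => dual_ext_of_basis K fun j => hx _ (by simp)) G φ

/-- The cone in `N_ℝ` defined by a set of characters. -/
def coneOf (G : Set (DualLattice N)) : PointedCone ℝ (RealSpace N) :=
  PointedCone.dual LinearMap.id (realChar '' G)

omit [Module.Free ℤ N] [Module.Finite ℤ N] in
theorem mem_coneOf {G : Set (DualLattice N)} {v : RealSpace N} :
    v ∈ coneOf G ↔ ∀ m ∈ G, 0 ≤ realChar m v := by
  simp [coneOf]

omit [Module.Free ℤ N] [Module.Finite ℤ N] in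
theorem mem_dualCone {σ : PointedCone ℝ (RealSpace N)} {φ : Module.Dual ℝ (RealSpace N)} :
    φ ∈ dualCone σ ↔ ∀ v ∈ σ, 0 ≤ φ v := by
  simp [dualCone]

omit [Module.Free ℤ N] [Module.Finite ℤ N] in
theorem nonneg_of_mem_hull {K E I : Type*} [Field K] [LinearOrder K] [IsStrictOrderedRing K]
    [AddCommGroup E] [Module K E] {f : I → E} {S : Set I} {φ : Module.Dual K E} {x : E}
    (hx : x ∈ PointedCone.hull K (f '' S)) (h : ∀ s ∈ S, 0 ≤ φ (f s)) : 0 ≤ φ x := by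
  induction hx using Submodule.span_induction with
  | mem x hx => obtain ⟨s, hs, rfl⟩ := hx; exact h s hs
  | zero => simp
  | add x y _ _ hx hy => rw [map_add]; exact add_nonneg hx hy
  | smul c x _ hx => rw [← Nonneg.coe_smul, map_smul]; exact mul_nonneg c.2 hx

omit [Module.Free ℤ N] [Module.Finite ℤ N] in
theorem coneOf_closure (G : Set (DualLattice N)) :
    coneOf (AddSubmonoid.closure G : Set (DualLattice N)) = coneOf G := by
  ext v
  simp only [mem_coneOf]
  refine ⟨fun h m hm => h m (AddSubmonoid.subset_closure hm), fun h m hm => ?_⟩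
  induction hm using AddSubmonoid.closure_induction with
  | mem m hm => exact h m hm
  | zero => simp [realChar]
  | add a b _ _ ha hb => rw [realChar_add]; exact add_nonneg ha hb

/-- Farkas' lemma: the vectors `A` cutting out the hull of `G` are nonnegative on `G`, so they lie
in `coneOf G`, and a functional nonnegative there satisfies all the inequalities of the hull. -/
theorem dualCone_coneOf {G : Set (DualLattice N)} (hG : G.Finite) :
    dualCone (coneOf G) = PointedCone.hull ℝ (realChar '' G) := by
  obtain ⟨A, hA⟩ := exists_inequalities_of_hull_dual hG
  refine le_antisymm (fun φ hφ => ?_) (fun φ hφ => ?_)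
  · refine (hA ℝ φ).2 fun a ha => mem_dualCone.1 hφ _ (mem_coneOf.2 fun m hm => ?_)
    exact (hA ℝ (realChar m)).1 (Submodule.subset_span ⟨m, hm, rfl⟩) a ha
  · exact mem_dualCone.2 fun v hv => nonneg_of_mem_hull (φ := Module.Dual.eval ℝ _ v) hφ
      fun m hm => mem_coneOf.1 hv m hm

/-- The generators are the vectors `A` that cut out the hull of `G`. An inequality valid on `A` lies
in that hull, which is the dual of `coneOf G`, so it is valid on the whole cone. -/
theorem isRationalPolyhedral_coneOf {G : Set (DualLattice N)} (hG : G.Finite) :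
    IsRationalPolyhedral (coneOf G) := by
  obtain ⟨A, hA⟩ := exists_inequalities_of_hull_dual hG
  refine ⟨A, A.finite_toSet, le_antisymm (fun v hv => ?_) (Submodule.span_le.2 ?_)⟩
  · obtain ⟨B, hB⟩ := exists_inequalities_of_hull A.finite_toSet
    refine (hB v).2 fun b hb => ?_
    have : realChar b ∈ dualCone (coneOf G) := by
      rw [dualCone_coneOf hG]
      exact (hA ℝ _).2 fun a ha => (hB _).1 (Submodule.subset_span ⟨a, ha, rfl⟩) b hb
    exact mem_dualCone.1 this v hv
  · rintro _ ⟨a, ha, rfl⟩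
    exact mem_coneOf.2 fun m hm => (hA ℝ (realChar m)).1 (Submodule.subset_span ⟨m, hm, rfl⟩) a ha

/-- A rational cone is recovered from a set of characters generating its dual. -/
theorem IsRationalPolyhedral.eq_coneOf {σ : PointedCone ℝ (RealSpace N)}
    (hσ : IsRationalPolyhedral σ) {G : Set (DualLattice N)}
    (hG : PointedCone.hull ℝ (realChar '' G) = dualCone σ) : σ = coneOf G := by
  obtain ⟨S, hS, rfl⟩ := hσ
  obtain ⟨A, hA⟩ := exists_inequalities_of_hull hS
  refine le_antisymm (fun v hv => mem_coneOf.2 fun m hm => ?_) (fun v hv => (hA v).2 fun a ha => ?_)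
  · have : realChar m ∈ PointedCone.hull ℝ (realChar '' G) := Submodule.subset_span ⟨m, hm, rfl⟩
    rw [hG] at this
    exact mem_dualCone.1 this v hv
  · have : realChar a ∈ PointedCone.hull ℝ (realChar '' G) := by
      rw [hG]
      exact mem_dualCone.2 fun w hw => (hA w).1 hw a ha
    exact nonneg_of_mem_hull (φ := Module.Dual.eval ℝ _ v) this fun m hm => mem_coneOf.1 hv m hm

/-- Supplies the condition `hull_eq_dualCone` of a triple when the cone is constructed from the
semigroup. -/
theorem hull_realChar_eq_dualCone {Γ : AddSubmonoid (DualLattice N)} (hΓ : Γ.FG) :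
    PointedCone.hull ℝ (realChar '' (Γ : Set (DualLattice N))) = dualCone (coneOf Γ) := by
  refine le_antisymm (Submodule.span_le.2 ?_) ?_
  · rintro _ ⟨m, hm, rfl⟩
    exact mem_dualCone.2 fun v hv => mem_coneOf.1 hv m hm
  · obtain ⟨G, rfl⟩ := hΓ
    rw [coneOf_closure, dualCone_coneOf G.finite_toSet]
    exact Submodule.span_mono (Set.image_mono AddSubmonoid.subset_closure)

omit [Module.Free ℤ N] [Module.Finite ℤ N] in
-- Clearing the denominators of the finitely many rational coefficients.
theorem exists_nsmul_mem_of_mem_hull_rat {G : Set (DualLattice N)} {φ : Module.Dual ℚ (ℚ ⊗[ℤ] N)}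
    (hφ : φ ∈ PointedCone.hull ℚ ((fun m : DualLattice N => m.baseChange ℚ) '' G)) :
    ∃ c : ℕ, 0 < c ∧ ∃ g ∈ AddSubmonoid.closure G, c • φ = g.baseChange ℚ := by
  have hz : (0 : DualLattice N).baseChange ℚ = 0 := by
    ext; simp
  let i : DualLattice N →+ Module.Dual ℚ (ℚ ⊗[ℤ] N) :=
    AddMonoidHom.mk' (fun m => m.baseChange ℚ) (baseChange_add ℚ)
  change ∃ c : ℕ, 0 < c ∧ ∃ g ∈ AddSubmonoid.closure G, c • φ = i g
  induction hφ using Submodule.span_induction with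
  | mem x hx =>
    obtain ⟨m, hm, rfl⟩ := hx
    exact ⟨1, one_pos, m, AddSubmonoid.subset_closure hm, by simp [i]⟩
  | zero => exact ⟨1, one_pos, 0, zero_mem _, by simp⟩
  | add x y _ _ hx hy =>
    obtain ⟨c, hc, g, hg, h⟩ := hx
    obtain ⟨c', hc', g', hg', h'⟩ := hy
    refine ⟨c * c', Nat.mul_pos hc hc', c' • g + c • g',
      add_mem (nsmul_mem hg _) (nsmul_mem hg' _), ?_⟩
    rw [map_add, map_nsmul, map_nsmul, ← h, ← h', smul_add, mul_comm, mul_smul, mul_comm, mul_smul]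
  | smul r x _ hx =>
    obtain ⟨c, hc, g, hg, h⟩ := hx
    refine ⟨r.1.den * c, Nat.mul_pos r.1.den_pos hc, r.1.num.toNat • g, nsmul_mem hg _, ?_⟩
    rw [map_nsmul, ← h, ← Nonneg.coe_smul, ← Nat.cast_smul_eq_nsmul ℚ, ← Nat.cast_smul_eq_nsmul ℚ,
      ← Nat.cast_smul_eq_nsmul ℚ, smul_smul, smul_smul]
    congr 1
    have h1 : ((r.1.num.toNat : ℕ) : ℚ) = (r.1.num : ℚ) := by
      exact_mod_cast congrArg (Int.cast (R := ℚ)) (Int.toNat_of_nonneg (Rat.num_nonneg.2 r.2))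
    rw [h1, Nat.cast_mul, ← Rat.mul_den_eq_num r.1]
    ring

/-- A character which is nonnegative on the cone of `Γ` has a multiple in `Γ`. -/
theorem exists_nsmul_mem {Γ : AddSubmonoid (DualLattice N)} (hΓ : Γ.FG) {m : DualLattice N}
    (hm : ∀ v ∈ coneOf (Γ : Set (DualLattice N)), 0 ≤ realChar m v) : ∃ c : ℕ, 0 < c ∧ c • m ∈ Γ := by
  obtain ⟨G, rfl⟩ := hΓ
  obtain ⟨A, hA⟩ := exists_inequalities_of_hull_dual G.finite_toSet
  rw [coneOf_closure] at hm
  have h1 : realChar m ∈ PointedCone.hull ℝ (realChar '' (G : Set (DualLattice N))) := by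
    rw [← dualCone_coneOf G.finite_toSet]
    exact mem_dualCone.2 hm
  -- The inequalities `A` are independent of the field and take integral values on `m`, so
  -- membership in the real cone transfers to the rational cone.
  have h2 := (hA ℚ (m.baseChange ℚ)).2 fun a ha => by
    have := (hA ℝ (realChar m)).1 h1 a ha
    rw [realChar_tmul, _root_.one_mul] at this
    rw [baseChange_one_tmul]
    exact_mod_cast this
  obtain ⟨c, hc, g, hg, h⟩ := exists_nsmul_mem_of_mem_hull_rat h2
  refine ⟨c, hc, ?_⟩
  convert hg
  ext n
  have := congr($h (1 ⊗ₜ n))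
  rw [LinearMap.smul_apply, baseChange_one_tmul, baseChange_one_tmul] at this
  rw [LinearMap.smul_apply]
  rw [nsmul_eq_mul] at this ⊢
  exact_mod_cast this

/-- Some `(c + 1) • (-m)` lies in `Γ` by saturation; adding `c • m` leaves `-m`. -/
theorem neg_mem_of_forall_eq_zero {Γ : AddSubmonoid (DualLattice N)} (hΓ : Γ.FG) {m : DualLattice N}
    (hm : m ∈ Γ) (h : ∀ v ∈ coneOf (Γ : Set (DualLattice N)), realChar m v = 0) : -m ∈ Γ := by
  have hneg : realChar (-m) = - realChar m := realCharHom.map_neg m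
  obtain ⟨c, hc, hcm⟩ := exists_nsmul_mem hΓ (m := -m) fun v hv => by simp [hneg, h v hv]
  obtain ⟨c, rfl⟩ := Nat.exists_eq_add_of_lt hc
  have := add_mem hcm (nsmul_mem hm c)
  convert this using 1
  simp only [zero_add, succ_nsmul, smul_neg]
  abel

omit [Module.Free ℤ N] [Module.Finite ℤ N] in
-- A face contains both summands of each of its sums, so only the generators lying in the face can
-- contribute to its elements.
theorem mem_hull_of_isFaceOf {S : Set N} {τ : PointedCone ℝ (RealSpace N)}
    (hτ : τ.IsFaceOf (PointedCone.hull ℝ ((fun v : N => (1 : ℝ) ⊗ₜ[ℤ] v) '' S))) {v : RealSpace N}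
    (hv : v ∈ τ) :
    v ∈ PointedCone.hull ℝ ((fun v : N => (1 : ℝ) ⊗ₜ[ℤ] v) '' {s ∈ S | (1 : ℝ) ⊗ₜ[ℤ] s ∈ τ}) := by
  have hv' := hτ.le hv
  induction hv' using Submodule.span_induction with
  | mem x hx =>
    obtain ⟨s, hs, rfl⟩ := hx
    exact Submodule.subset_span ⟨s, ⟨hs, hv⟩, rfl⟩
  | zero => exact zero_mem _
  | add x y hx hy ihx ihy =>
    exact add_mem (ihx (hτ.mem_of_add_mem_left hx hy hv)) (ihy (hτ.mem_of_add_mem_right hx hy hv))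
  | smul c x hx ih =>
    rcases eq_or_ne c 0 with rfl | hc
    · simp
    · refine Submodule.smul_mem _ _ (ih ?_)
      have h : (c : ℝ) ≠ 0 := fun h => hc (Subtype.ext h)
      have := PointedCone.smul_mem τ (inv_nonneg.2 c.2) hv
      rwa [← Nonneg.coe_smul, smul_smul, inv_mul_cancel₀ h, one_smul] at this

/-- A face of the cone of `Γ` is exposed by elements of `Γ`. -/
theorem exists_pos_of_notMem_face {Γ : AddSubmonoid (DualLattice N)} (hΓ : Γ.FG)
    {τ : PointedCone ℝ (RealSpace N)} (hτ : τ.IsFaceOf (coneOf (Γ : Set (DualLattice N))))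
    {v : RealSpace N} (hv : v ∈ coneOf (Γ : Set (DualLattice N))) (hvτ : v ∉ τ) :
    ∃ m ∈ Γ, (∀ w ∈ τ, realChar m w = 0) ∧ 0 < realChar m v := by
  have hrat : IsRationalPolyhedral (coneOf (Γ : Set (DualLattice N))) := by
    obtain ⟨G, rfl⟩ := hΓ
    rw [coneOf_closure]
    exact isRationalPolyhedral_coneOf G.finite_toSet
  obtain ⟨S, hS, hσ⟩ := hrat
  let T : Set N := {s ∈ S | (1 : ℝ) ⊗ₜ[ℤ] s ∈ τ}
  -- The hull of `S ∪ -T` lies in `σ - τ`, which misses `-v`: from `v + y ∈ τ` with `y ∈ σ` the face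
  -- property gives `v ∈ τ`. An inequality of this hull violated by `-v` is nonnegative on `σ`, zero
  -- on `τ` and positive at `v`.
  obtain ⟨A, hA⟩ := exists_inequalities_of_hull (hS.union (hS.subset (Set.sep_subset _ _ : T ⊆ S)).neg)
  have hcone : ∀ x ∈ PointedCone.hull ℝ ((fun v : N => (1 : ℝ) ⊗ₜ[ℤ] v) '' (S ∪ -T)),
      ∃ y ∈ coneOf (Γ : Set (DualLattice N)), ∃ t ∈ τ, x = y - t := by
    intro x hx
    induction hx using Submodule.span_induction with
    | mem x hx =>
      obtain ⟨s, hs | hs, rfl⟩ := hx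
      · exact ⟨_, hσ ▸ Submodule.subset_span ⟨s, hs, rfl⟩, 0, zero_mem _, (sub_zero _).symm⟩
      · exact ⟨0, zero_mem _, _, hs.2, by simp [TensorProduct.tmul_neg]⟩
    | zero => exact ⟨0, zero_mem _, 0, zero_mem _, by simp⟩
    | add x y _ _ ihx ihy =>
      obtain ⟨a, ha, t, ht, rfl⟩ := ihx
      obtain ⟨b, hb, t', ht', rfl⟩ := ihy
      exact ⟨_, add_mem ha hb, _, add_mem ht ht', by abel⟩
    | smul c x _ ih =>
      obtain ⟨a, ha, t, ht, rfl⟩ := ih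
      exact ⟨_, Submodule.smul_mem _ c ha, _, Submodule.smul_mem _ c ht, smul_sub _ _ _⟩
  have hnot : -v ∉ PointedCone.hull ℝ ((fun v : N => (1 : ℝ) ⊗ₜ[ℤ] v) '' (S ∪ -T)) := by
    intro h
    obtain ⟨y, hy, t, ht, h⟩ := hcone _ h
    have : v + y ∈ τ := by
      convert ht
      rw [neg_eq_iff_add_eq_zero] at h
      rw [← sub_eq_zero, ← h]; abel
    exact hvτ (hτ.mem_of_add_mem_left hv hy this)
  rw [hA] at hnot
  push Not at hnot
  obtain ⟨a, ha, hav⟩ := hnot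
  rw [map_neg, neg_lt_zero] at hav
  have hpos : ∀ w ∈ coneOf (Γ : Set (DualLattice N)), 0 ≤ realChar a w := by
    intro w hw
    rw [hσ] at hw
    exact (hA w).1 (Submodule.span_mono (Set.image_mono Set.subset_union_left) hw) a ha
  have hzero : ∀ w ∈ τ, realChar a w = 0 := by
    intro w hw
    refine le_antisymm ?_ (hpos w (hτ.le hw))
    rw [← neg_nonneg, ← LinearMap.neg_apply]
    refine nonneg_of_mem_hull (mem_hull_of_isFaceOf (hσ ▸ hτ) hw) fun s hs => ?_
    have := (hA _).1 (Submodule.subset_span ⟨-s, Or.inr (by simpa [T] using hs), rfl⟩) a ha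
    simpa using this
  obtain ⟨c, hc, hcm⟩ := exists_nsmul_mem hΓ hpos
  have hsmul : realChar (c • a) = c • realChar a := map_nsmul realCharHom c a
  refine ⟨c • a, hcm, fun w hw => ?_, ?_⟩
  · rw [hsmul, LinearMap.smul_apply, hzero w hw, smul_zero]
  · rw [hsmul, LinearMap.smul_apply]
    exact nsmul_pos hav hc.ne'

omit [Module.Finite ℤ N] in
theorem salient_coneOf {Γ : AddSubmonoid (DualLattice N)}
    (hΓ : AddSubgroup.closure (Γ : Set (DualLattice N)) = ⊤) :
    (coneOf (Γ : Set (DualLattice N)) : ConvexCone ℝ (RealSpace N)).Salient := by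
  intro v hv hv0 hv'
  refine hv0 (realSpace_ext fun m => ?_)
  have hm : m ∈ AddSubgroup.closure (Γ : Set (DualLattice N)) := hΓ ▸ AddSubgroup.mem_top m
  change realCharHom m v = 0
  induction hm using AddSubgroup.closure_induction with
  | mem m hm =>
    have h1 := mem_coneOf.1 hv m hm
    have h2 := mem_coneOf.1 hv' m hm
    rw [map_neg] at h2
    exact le_antisymm (neg_nonneg.1 h2) h1
  | zero => simp
  | add a b _ _ ha hb => rw [map_add, LinearMap.add_apply, ha, hb, add_zero]
  | neg a _ ha => rw [map_neg, LinearMap.neg_apply, ha, neg_zero]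

end Duality

/-! ### Localizations of semigroups at faces -/

section Monoid

variable {M : Type*} [AddCommGroup M]

/-- The semigroup obtained from `S` by inverting `a`. -/
def locAt (S : AddSubmonoid M) (a : M) : AddSubmonoid M where
  carrier := {x | ∃ n : ℕ, x + n • a ∈ S}
  zero_mem' := ⟨0, by simp⟩
  add_mem' := by
    rintro x y ⟨n, hn⟩ ⟨m, hm⟩
    refine ⟨n + m, ?_⟩
    convert add_mem hn hm using 1
    rw [add_smul]; abel

theorem le_locAt (S : AddSubmonoid M) (a : M) : S ≤ locAt S a := fun x hx => ⟨0, by simpa⟩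

/-- The semigroup obtained from `S` by inverting the elements of `F`. -/
def invert (S : AddSubmonoid M) (F : Set M) : AddSubmonoid M :=
  S ⊔ (AddSubgroup.closure F).toAddSubmonoid

theorem le_invert (S : AddSubmonoid M) (F : Set M) : S ≤ invert S F := le_sup_left

theorem neg_mem_invert (S : AddSubmonoid M) {F : Set M} {f : M} (hf : f ∈ F) : -f ∈ invert S F :=
  (le_sup_right : (AddSubgroup.closure F).toAddSubmonoid ≤ invert S F)
    ((AddSubgroup.closure F).neg_mem (AddSubgroup.subset_closure hf))

theorem invert_le {S T : AddSubmonoid M} {F : Set M} (hS : S ≤ T) (hF : ∀ f ∈ F, f ∈ T)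
    (hF' : ∀ f ∈ F, -f ∈ T) : invert S F ≤ T := by
  refine sup_le hS fun x hx => ?_
  change x ∈ AddSubgroup.closure F at hx
  suffices h : x ∈ T ∧ -x ∈ T from h.1
  induction hx using AddSubgroup.closure_induction with
  | mem f hf => exact ⟨hF f hf, hF' f hf⟩
  | zero => simp
  | add a b _ _ ha hb =>
    exact ⟨add_mem ha.1 hb.1, by rw [neg_add]; exact add_mem ha.2 hb.2⟩
  | neg a _ ha => exact ⟨ha.2, by simpa using ha.1⟩

/-- A face of the semigroup `S`. -/
structure IsFaceSubset (F : Set M) (S : AddSubmonoid M) : Prop where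
  subset : F ⊆ S
  zero_mem' : 0 ∈ F
  add_mem' : ∀ {x y}, x ∈ F → y ∈ F → x + y ∈ F
  mem_of_add_mem : ∀ {x y}, x ∈ S → y ∈ S → x + y ∈ F → x ∈ F

/-- Take for `a` the sum of the generators of `S` in `F`. Inverting a sum inverts its summands, and
every element of the face is a sum of generators in the face. -/
theorem IsFaceSubset.exists_invert_eq_locAt {F : Set M} {S : AddSubmonoid M} (hF : IsFaceSubset F S)
    (hS : S.FG) : ∃ a ∈ F, invert S F = locAt S a := by
  classical
  obtain ⟨G, rfl⟩ := hS
  have hsum : ∀ H : Finset M, (H : Set M) ⊆ F → ∑ g ∈ H, g ∈ F := by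
    intro H
    induction H using Finset.induction_on with
    | empty => intro _; simpa using hF.zero_mem'
    | insert a s ha ih =>
      intro h
      rw [Finset.sum_insert ha]
      exact hF.add_mem' (h (by simp)) (ih fun x hx => h (by simp [hx]))
  let H := G.filter (· ∈ F)
  have hH : (H : Set M) ⊆ F := by intro x hx; simp [H] at hx; exact hx.2
  refine ⟨∑ g ∈ H, g, hsum H hH, le_antisymm (invert_le (le_locAt _ _)
    (fun f hf => le_locAt _ _ (hF.subset hf)) fun f hf => ?_) ?_⟩
  · have hfS := hF.subset hf
    induction hfS using AddSubmonoid.closure_induction with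
    | mem g hg =>
      refine ⟨1, ?_⟩
      have hgH : g ∈ H := by simp [H, hf]; simpa using hg
      rw [one_smul, ← Finset.add_sum_erase _ _ hgH, neg_add_cancel_left]
      refine sum_mem fun x hx => AddSubmonoid.subset_closure ?_
      have := Finset.mem_of_mem_erase hx
      simp only [H, Finset.mem_filter] at this
      exact this.1
    | zero => simp
    | add x y hx hy ihx ihy =>
      rw [neg_add]
      exact add_mem (ihx (hF.mem_of_add_mem hx hy hf))
        (ihy (hF.mem_of_add_mem hy hx (by rwa [add_comm])))
  · rintro x ⟨n, hn⟩
    have := add_mem (le_invert _ F hn) (nsmul_mem (neg_mem_invert _ (hsum H hH)) n)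
    simpa using this

/-- A semigroup between `S` and its group of differences each of whose elements has a denominator
invertible in it is a localization of `S` at a face. -/
theorem eq_invert_of_exists {S S' : AddSubmonoid M} (h : S ≤ S')
    (hd : ∀ x ∈ S', ∃ a ∈ S, -a ∈ S' ∧ a + x ∈ S) : S' = invert S {a | a ∈ S ∧ -a ∈ S'} := by
  refine le_antisymm (fun x hx => ?_) (invert_le h (fun f hf => h hf.1) fun f hf => hf.2)
  obtain ⟨a, ha, ha', hax⟩ := hd x hx
  have := add_mem (neg_mem_invert S (F := {a | a ∈ S ∧ -a ∈ S'}) ⟨ha, ha'⟩) (le_invert _ _ hax)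
  simpa using this

/-- If `x + y` is invertible in `S'`, then `y - (x + y)` is an inverse of `x`. -/
theorem isFaceSubset_units {S S' : AddSubmonoid M} (h : S ≤ S') :
    IsFaceSubset {a | a ∈ S ∧ -a ∈ S'} S where
  subset := fun _ hx => hx.1
  zero_mem' := by simp
  add_mem' := fun hx hy => ⟨add_mem hx.1 hy.1, by rw [neg_add]; exact add_mem hx.2 hy.2⟩
  mem_of_add_mem := fun {x y} hx hy hxy => ⟨hx, by
    have := add_mem hxy.2 (h hy)
    simpa using this⟩

/-- A finitely generated semigroup has finitely many localizations. -/
theorem finite_localizations {S : AddSubmonoid M} (hS : S.FG) :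
    {S' | ∃ F, IsFaceSubset F S ∧ S' = invert S F}.Finite := by
  classical
  obtain ⟨G, hG⟩ := hS
  -- A localization at a face depends only on the set of generators that lie in the face.
  refine (G.powerset.finite_toSet.image fun H : Finset M => invert S (H : Set M)).subset ?_
  rintro _ ⟨F, hF, rfl⟩
  refine ⟨G.filter (· ∈ F), Finset.mem_coe.2 (Finset.mem_powerset.2 (Finset.filter_subset _ _)), ?_⟩
  refine le_antisymm (invert_le (le_invert _ _) (fun f hf => le_invert _ _ ?_) fun f hf => ?_)
    (invert_le (le_invert _ _) (fun f hf => le_invert _ _ (hF.subset hf)) fun f hf => ?_)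
  · simp only [Finset.coe_filter, Set.mem_ofPred_eq] at hf
    exact hF.subset hf.2
  · simp only [Finset.coe_filter, Set.mem_ofPred_eq] at hf
    exact neg_mem_invert _ hf.2
  · have hfS := hF.subset hf
    rw [← hG] at hfS
    induction hfS using AddSubmonoid.closure_induction with
    | mem g hg => exact neg_mem_invert _ (by simp [hf]; simpa using hg)
    | zero => simp
    | add x y hx hy ihx ihy =>
      rw [hG] at hx hy
      rw [neg_add]
      exact add_mem (ihx (hF.mem_of_add_mem hx hy hf))
        (ihy (hF.mem_of_add_mem hy hx (by rwa [add_comm])))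

end Monoid

/-! ### Faces of a cone and localizations of its semigroup. -/

section Cones

variable {N : Type u} [AddCommGroup N]

/-- The characters of `S` vanishing on `τ`. -/
def perp (τ : PointedCone ℝ (RealSpace N)) (S : AddSubmonoid (DualLattice N)) :
    Set (DualLattice N) :=
  {m | m ∈ S ∧ ∀ v ∈ τ, realChar m v = 0}

theorem realChar_zero : realChar (0 : DualLattice N) = 0 := realCharHom.map_zero

theorem realChar_neg (m : DualLattice N) : realChar (-m) = -realChar m := realCharHom.map_neg m

theorem isFaceSubset_perp {τ : PointedCone ℝ (RealSpace N)} {S : AddSubmonoid (DualLattice N)}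
    (h : τ ≤ coneOf (S : Set (DualLattice N))) : IsFaceSubset (perp τ S) S where
  subset := fun _ hx => hx.1
  zero_mem' := ⟨zero_mem _, by simp [realChar_zero]⟩
  add_mem' := fun hx hy => ⟨add_mem hx.1 hy.1, fun v hv => by
    simp [realChar_add, hx.2 v hv, hy.2 v hv]⟩
  mem_of_add_mem := fun {x y} hx hy hxy => ⟨hx, fun v hv => by
    have h1 := mem_coneOf.1 (h hv) x hx
    have h2 := mem_coneOf.1 (h hv) y hy
    have h3 := hxy.2 v hv
    rw [realChar_add, LinearMap.add_apply] at h3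
    linarith⟩

theorem mem_coneOf_invert {S : AddSubmonoid (DualLattice N)} {F : Set (DualLattice N)}
    (hF : F ⊆ S) {v : RealSpace N} :
    v ∈ coneOf (invert S F : Set (DualLattice N)) ↔
      v ∈ coneOf (S : Set (DualLattice N)) ∧ ∀ f ∈ F, realChar f v = 0 := by
  constructor
  · intro h
    refine ⟨mem_coneOf.2 fun m hm => mem_coneOf.1 h m (le_invert _ _ hm), fun f hf => ?_⟩
    have h1 := mem_coneOf.1 h f (le_invert _ _ (hF hf))
    have h2 := mem_coneOf.1 h (-f) (neg_mem_invert _ hf)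
    rw [realChar_neg, LinearMap.neg_apply] at h2
    linarith
  · rintro ⟨h, h0⟩
    let T : AddSubmonoid (DualLattice N) :=
      { carrier := {m | 0 ≤ realChar m v}
        zero_mem' := by simp [realChar_zero]
        add_mem' := fun {a b} ha hb => by
          simp only [Set.mem_ofPred_eq, realChar_add, LinearMap.add_apply] at *
          exact add_nonneg ha hb }
    have : invert S F ≤ T := invert_le (fun m hm => mem_coneOf.1 h m hm)
      (fun f hf => mem_coneOf.1 h f (hF hf)) fun f hf => by simp [T, realChar_neg, h0 f hf]
    exact mem_coneOf.2 fun m hm => this hm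

theorem isFaceOf_coneOf_invert {S : AddSubmonoid (DualLattice N)} {F : Set (DualLattice N)}
    (hF : F ⊆ S) :
    (coneOf (invert S F : Set (DualLattice N))).IsFaceOf (coneOf (S : Set (DualLattice N))) where
  le := fun v hv => ((mem_coneOf_invert hF).1 hv).1
  mem_of_smul_add_mem := by
    intro x y a hx hy ha hxy
    rw [mem_coneOf_invert hF] at hxy ⊢
    refine ⟨hx, fun f hf => ?_⟩
    have h1 := mem_coneOf.1 hx f (hF hf)
    have h2 := mem_coneOf.1 hy f (hF hf)
    have h3 := hxy.2 f hf
    rw [map_add, map_smul, smul_eq_mul] at h3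
    nlinarith

theorem coneOf_sup (S S' : AddSubmonoid (DualLattice N)) :
    coneOf ((S ⊔ S' : AddSubmonoid (DualLattice N)) : Set (DualLattice N)) =
      coneOf (S : Set (DualLattice N)) ⊓ coneOf (S' : Set (DualLattice N)) := by
  have h : S ⊔ S' = AddSubmonoid.closure ((S : Set (DualLattice N)) ∪ S') := by
    rw [AddSubmonoid.closure_union, AddSubmonoid.closure_eq, AddSubmonoid.closure_eq]
  rw [h, coneOf_closure, coneOf, Set.image_union, PointedCone.dual_union]
  rfl

variable [Module.Free ℤ N] [Module.Finite ℤ N]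

/-- A vector of the cone outside `τ` is excluded by an element of `S` that vanishes on `τ` and is
positive at the vector. Thus every face of the cone comes from a localization. -/
theorem coneOf_invert_perp {S : AddSubmonoid (DualLattice N)} (hS : S.FG)
    {τ : PointedCone ℝ (RealSpace N)} (hτ : τ.IsFaceOf (coneOf (S : Set (DualLattice N)))) :
    coneOf (invert S (perp τ S) : Set (DualLattice N)) = τ := by
  ext v
  rw [mem_coneOf_invert (fun _ h => h.1)]
  refine ⟨fun ⟨h, h0⟩ => ?_, fun h => ⟨hτ.le h, fun f hf => hf.2 v h⟩⟩
  by_contra hv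
  obtain ⟨m, hm, hm0, hpos⟩ := exists_pos_of_notMem_face hS hτ h hv
  exact hpos.ne' (h0 m ⟨hm, hm0⟩)

/-- A localization of `S` that contains elements negative on its cone only is determined by its
cone. -/
theorem invert_le_of_coneOf_le {S T : AddSubmonoid (DualLattice N)} {F : Set (DualLattice N)}
    (hF : F ⊆ S) (hT : T.FG) (hST : S ≤ T)
    (h : coneOf (T : Set (DualLattice N)) ≤ coneOf (invert S F : Set (DualLattice N))) :
    invert S F ≤ T :=
  invert_le hST (fun _ hf => hST (hF hf)) fun f hf => neg_mem_of_forall_eq_zero hT (hST (hF hf))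
    fun _ hv => ((mem_coneOf_invert hF).1 (h hv)).2 f hf

end Cones

/-! ### Semigroup algebras -/

section Algebra

variable (k : Type u) [Field k] {M : Type u} [AddCommGroup M]

/-- The inclusion of semigroup algebras. -/
abbrev inclAlg {S S' : AddSubmonoid M} (h : S ≤ S') :
    AddMonoidAlgebra k S →ₐ[k] AddMonoidAlgebra k S' :=
  AddMonoidAlgebra.mapDomainAlgHom k k (AddSubmonoid.inclusion h)

/-- The inclusion of a semigroup algebra into the group algebra. -/
abbrev subAlg (S : AddSubmonoid M) : AddMonoidAlgebra k S →ₐ[k] AddMonoidAlgebra k M :=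
  AddMonoidAlgebra.mapDomainAlgHom k k S.subtype

variable {k}

theorem inclAlg_single {S S' : AddSubmonoid M} (h : S ≤ S') (s : S) (r : k) :
    inclAlg k h (.single s r) = .single (AddSubmonoid.inclusion h s) r := by
  simp

theorem subAlg_single {S : AddSubmonoid M} (s : S) (r : k) :
    subAlg k S (.single s r) = .single (s : M) r := by
  simp

theorem inclAlg_injective {S S' : AddSubmonoid M} (h : S ≤ S') :
    Function.Injective (inclAlg k h) :=
  AddMonoidAlgebra.mapDomain_injective (AddSubmonoid.inclusion_injective h)

theorem subAlg_injective (S : AddSubmonoid M) : Function.Injective (subAlg k S) :=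
  AddMonoidAlgebra.mapDomain_injective Subtype.val_injective

theorem subAlg_comp_inclAlg {S S' : AddSubmonoid M} (h : S ≤ S') :
    (subAlg k S').comp (inclAlg k h) = subAlg k S := by
  ext; simp

theorem coeff_subAlg {S : AddSubmonoid M} (f : AddMonoidAlgebra k S) (s : S) :
    (subAlg k S f).coeff s = f.coeff s :=
  Finsupp.mapDomain_apply Subtype.val_injective _ _

theorem coeff_subAlg_of_notMem {S : AddSubmonoid M} (f : AddMonoidAlgebra k S) {m : M}
    (hm : m ∉ S) : (subAlg k S f).coeff m = 0 :=
  Finsupp.mapDomain_of_notMem_range _ _ (by simpa using hm)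

theorem mem_of_coeff_ne_zero {S : AddSubmonoid M} {f : AddMonoidAlgebra k S} {m : M}
    (hm : (subAlg k S f).coeff m ≠ 0) : m ∈ S := by
  by_contra h
  exact hm (coeff_subAlg_of_notMem f h)

instance instIsDomainGroupAlg [Module.Free ℤ M] [Module.Finite ℤ M] (K : Type*) [Field K] :
    IsDomain (AddMonoidAlgebra K M) := by
  have : IsAddTorsionFree M := Module.isTorsionFree_int_iff_isAddTorsionFree.1 inferInstance
  have : AddMonoid.FG M := AddGroup.fg_iff_addMonoid_fg.1 (Module.Finite.iff_addGroup_fg.1 inferInstance)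
  infer_instance

instance instIsDomainSemigroupAlg [Module.Free ℤ M] [Module.Finite ℤ M] (S : AddSubmonoid M) :
    IsDomain (AddMonoidAlgebra k S) :=
  (subAlg_injective (k := k) S).isDomain

open Classical in
/-- The projection of `k[S]` to the group algebra spanned by the invertible characters. -/
def unitProj (S : AddSubmonoid M) : AddMonoidAlgebra k S →ₐ[k] AddMonoidAlgebra k M :=
  AddMonoidAlgebra.lift k _ S
    { toFun := fun s => if -(s.toAdd : M) ∈ S then .single (s.toAdd : M) 1 else 0
      map_one' := by
        rw [if_pos (by simp)]
        rfl
      map_mul' := fun s t => by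
        by_cases hs : -(s.toAdd : M) ∈ S
        · by_cases ht : -(t.toAdd : M) ∈ S
          · rw [if_pos hs, if_pos ht, if_pos (by simpa using add_mem ht hs)]
            simp [AddMonoidAlgebra.single_mul_single]
          · rw [if_neg ht, mul_zero, if_neg fun h => ht ?_]
            have := add_mem h s.toAdd.2
            simpa using this
        · rw [if_neg hs, zero_mul, if_neg fun h => hs ?_]
          have := add_mem h t.toAdd.2
          simpa using this }

open Classical in
theorem unitProj_single (S : AddSubmonoid M) (s : S) (r : k) :
    unitProj S (.single s r) = if -(s : M) ∈ S then .single (s : M) r else 0 := by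
  rw [unitProj, AddMonoidAlgebra.lift_single]
  simp

open Classical in
theorem coeff_unitProj (S : AddSubmonoid M) (f : AddMonoidAlgebra k S) (m : M) :
    (unitProj S f).coeff m = if -m ∈ S then (subAlg k S f).coeff m else 0 := by
  induction f using AddMonoidAlgebra.induction_linear with
  | zero => simp
  | add f g hf hg => simp only [map_add, AddMonoidAlgebra.coeff_add, Finsupp.add_apply, hf, hg]; split_ifs <;> simp
  | single s r =>
    rw [unitProj_single, subAlg_single]
    by_cases h : (s : M) = m
    · subst h
      split_ifs <;> simp
    · split_ifs <;> simp [h]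

/-- The prime ideal of `k[S]` spanned by the characters that are not invertible. -/
def nonunitIdeal (k : Type u) [Field k] (S : AddSubmonoid M) : Ideal (AddMonoidAlgebra k S) :=
  RingHom.ker (unitProj (k := k) S)

instance [Module.Free ℤ M] [Module.Finite ℤ M] (S : AddSubmonoid M) : (nonunitIdeal k S).IsPrime :=
  RingHom.ker_isPrime _

theorem mem_nonunitIdeal {S : AddSubmonoid M} {f : AddMonoidAlgebra k S} :
    f ∈ nonunitIdeal k S ↔ ∀ m, -m ∈ S → (subAlg k S f).coeff m = 0 := by
  classical
  rw [nonunitIdeal, RingHom.mem_ker]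
  constructor
  · intro h m hm
    have := coeff_unitProj S f m
    rw [if_pos hm] at this
    rw [← this]
    change (unitProj S f).coeff m = 0
    rw [show unitProj S f = 0 from h]; rfl
  · intro h
    ext m
    rw [coeff_unitProj]
    split_ifs with hm
    · simpa using h m hm
    · simp

/-- An open immersion of affine toric varieties with the same torus is the inversion of characters:
every character has an invertible denominator. -/
theorem exists_denominator [Module.Free ℤ M] [Module.Finite ℤ M] {S S' : AddSubmonoid M} (h : S ≤ S')
    (hs : (inclAlg k h).toRingHom.SurjectiveOnStalks) {x : M} (hx : x ∈ S') :
    ∃ a ∈ S, -a ∈ S' ∧ a + x ∈ S := by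
  -- Surjectivity on the stalk at `nonunitIdeal k S'` writes `χ^x` as a fraction `f / r`. The
  -- denominator is outside this prime, so it has a nonzero coefficient at a character `a`
  -- invertible in `S'`; comparing coefficients at `a + x` gives `a + x ∈ S`.
  obtain ⟨f, r, c, hc, hr, e⟩ := (RingHom.surjective_localRingHom_iff
    (f := (inclAlg k h).toRingHom) (nonunitIdeal k S')).1 (hs _ inferInstance)
    (.single ⟨x, hx⟩ 1)
  have hc0 : c ≠ 0 := fun h => hc (h ▸ zero_mem _)
  rw [_root_.mul_assoc] at e
  replace e := mul_left_cancel₀ hc0 e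
  have hr' := mt mem_nonunitIdeal.2 hr
  push Not at hr'
  obtain ⟨a, ha, hra⟩ := hr'
  have hcomp : ∀ g, subAlg k S' ((inclAlg k h).toRingHom g) = subAlg k S g := fun g =>
    congr($(subAlg_comp_inclAlg (k := k) h) g)
  rw [hcomp] at hra
  refine ⟨a, mem_of_coeff_ne_zero hra, ha, ?_⟩
  have e' := congr((subAlg k S' $e).coeff (a + x))
  rw [map_mul, hcomp, hcomp, subAlg_single] at e'
  refine mem_of_coeff_ne_zero (f := f) (k := k) ?_
  rw [← e', AddMonoidAlgebra.coeff_mul_single_apply]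
  simpa using hra

theorem isLocalizationAway_locAt (S : AddSubmonoid M) {a : M} (ha : a ∈ S) :
    letI := (inclAlg k (le_locAt S a)).toRingHom.toAlgebra
    IsLocalization.Away (AddMonoidAlgebra.single (⟨a, ha⟩ : S) (1 : k))
      (AddMonoidAlgebra k (locAt S a)) := by
  let := (inclAlg k (le_locAt S a)).toRingHom.toAlgebra
  have halg : ∀ g, algebraMap (AddMonoidAlgebra k S) (AddMonoidAlgebra k (locAt S a)) g =
    inclAlg k (le_locAt S a) g := fun _ => rfl
  have hna : -a ∈ locAt S a := ⟨1, by simp⟩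
  refine IsLocalization.Away.mk _ ?_ ?_ ?_
  · rw [halg, inclAlg_single]
    refine IsUnit.of_mul_eq_one (.single ⟨-a, hna⟩ 1) ?_
    rw [AddMonoidAlgebra.single_mul_single, AddMonoidAlgebra.one_def]
    congr 1
    · ext; simp
    · simp
  · intro f
    induction f using AddMonoidAlgebra.induction_linear with
    | zero => exact ⟨0, 0, by simp⟩
    | add f g hf hg =>
      obtain ⟨n, f', hf⟩ := hf
      obtain ⟨m, g', hg⟩ := hg
      refine ⟨n + m, f' * .single ⟨a, ha⟩ 1 ^ m + g' * .single ⟨a, ha⟩ 1 ^ n, ?_⟩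
      rw [map_add, map_mul, map_mul, ← hf, ← hg, map_pow, map_pow]
      ring
    | single s r =>
      obtain ⟨n, hn⟩ := s.2
      refine ⟨n, .single ⟨_, hn⟩ r, ?_⟩
      rw [halg, halg, inclAlg_single, inclAlg_single, AddMonoidAlgebra.single_pow,
        AddMonoidAlgebra.single_mul_single]
      congr 1
      simp
  · intro x y h
    exact ⟨0, by rw [inclAlg_injective _ h]⟩

theorem isOpenImmersion_locAt (S : AddSubmonoid M) {a : M} (ha : a ∈ S) :
    IsOpenImmersion (affineToricMap k (AddSubmonoid.inclusion (le_locAt S a))).left := by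
  let := (inclAlg k (le_locAt S a)).toRingHom.toAlgebra
  have := isLocalizationAway_locAt (k := k) S ha
  exact IsOpenImmersion.of_isLocalization (S := AddMonoidAlgebra k (locAt S a))
    (AddMonoidAlgebra.single (⟨a, ha⟩ : S) (1 : k))

theorem exists_denominator_of_isOpenImmersion [Module.Free ℤ M] [Module.Finite ℤ M] {S S' : AddSubmonoid M} (h : S ≤ S')
    [H : IsOpenImmersion (affineToricMap k (AddSubmonoid.inclusion h)).left] {x : M} (hx : x ∈ S') :
    ∃ a ∈ S, -a ∈ S' ∧ a + x ∈ S := by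
  refine exists_denominator (k := k) h ?_ hx
  have : SurjectiveOnStalks (affineToricMap k (AddSubmonoid.inclusion h)).left := inferInstance
  exact SurjectiveOnStalks.Spec_iff.1 this

end Algebra

/-! ### The torus and its action on affine toric varieties -/

section Coaction

instance (k : Type u) [Field k] : (algSpec (CommRingCat.of k)).Faithful := algSpec.instFaithful
instance (k : Type u) [Field k] : (algSpec (CommRingCat.of k)).Full := algSpec.instFull
instance (k : Type u) [Field k] : (algSpec (CommRingCat.of k)).Braided := braidedAlgSpec

variable (k : Type u) [Field k] {M : Type u} [AddCommGroup M]

/-- The coaction `k[S] → k[M] ⊗ k[S]`, `χ^s ↦ χ^s ⊗ χ^s`. -/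
def coactAlg (S : AddSubmonoid M) :
    AddMonoidAlgebra k S →ₐ[k] AddMonoidAlgebra k M ⊗[k] AddMonoidAlgebra k S :=
  AddMonoidAlgebra.lift k _ S
    { toFun := fun s => .single (s.toAdd : M) 1 ⊗ₜ .single s.toAdd 1
      map_one' := rfl
      map_mul' := fun s t => by
        simp [AddMonoidAlgebra.single_mul_single] }

/-- The affine scheme of a `k`-algebra, over `k`. -/
abbrev specK (A : Type u) [CommRing A] [Algebra k A] : KScheme k :=
  (algSpec (CommRingCat.of k)).obj (.op (CommAlgCat.of k A))

/-- The morphism of affine schemes of a homomorphism of `k`-algebras. -/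
abbrev specKMap {k : Type u} [Field k] {A B : Type u} [CommRing A] [Algebra k A] [CommRing B]
    [Algebra k B] (f : A →ₐ[k] B) : specK k B ⟶ specK k A :=
  (algSpec (CommRingCat.of k)).map (CommAlgCat.ofHom f).op

variable {k}
theorem specKMap_comp {A B C : Type u} [CommRing A] [Algebra k A] [CommRing B]
    [Algebra k B] [CommRing C] [Algebra k C] (f : A →ₐ[k] B) (g : B →ₐ[k] C) :
    specKMap (g.comp f) = specKMap g ≫ specKMap f := by
  rw [← Functor.map_comp]; rfl

theorem specKMap_injective {A B : Type u} [CommRing A] [Algebra k A] [CommRing B]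
    [Algebra k B] : Function.Injective (specKMap : (A →ₐ[k] B) → _) := fun f g h => by
  have := (algSpec (CommRingCat.of k)).map_injective h
  exact congr(($this).unop.hom)

theorem exists_eq_specKMap {A B : Type u} [CommRing A] [Algebra k A] [CommRing B]
    [Algebra k B] (f : specK k B ⟶ specK k A) : ∃ g : A →ₐ[k] B, f = specKMap g :=
  ⟨((algSpec (CommRingCat.of k)).preimage f).unop.hom,
    ((algSpec (CommRingCat.of k)).map_preimage f).symm⟩

/-- The product of affine schemes. -/
def specKProd (A B : Type u) [CommRing A] [Algebra k A] [CommRing B] [Algebra k B] :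
    specK k A ⊗ specK k B ≅ specK k (A ⊗[k] B) :=
  Functor.Monoidal.μIso (algSpec (CommRingCat.of k)) (.op (CommAlgCat.of k A)) (.op (CommAlgCat.of k B))

variable {A B C D : Type u} [CommRing A] [Algebra k A] [CommRing B] [Algebra k B]
  [CommRing C] [Algebra k C] [CommRing D] [Algebra k D]

theorem specKProd_inv_fst : (specKProd A B).inv ≫ fst _ _ =
    specKMap (k := k) Algebra.TensorProduct.includeLeft := by
  exact Functor.OplaxMonoidal.δ_fst (algSpec (CommRingCat.of k)) _ _

theorem specKProd_inv_snd : (specKProd A B).inv ≫ snd _ _ =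
    specKMap (k := k) Algebra.TensorProduct.includeRight := by
  exact Functor.OplaxMonoidal.δ_snd (algSpec (CommRingCat.of k)) _ _

theorem specKMap_tensorHom (f : A →ₐ[k] C) (g : B →ₐ[k] D) :
    (specKProd C D).inv ≫ (specKMap f ⊗ₘ specKMap g) =
      specKMap (Algebra.TensorProduct.map f g) ≫ (specKProd A B).inv := by
  apply CartesianMonoidalCategory.hom_ext
  · rw [Category.assoc, tensorHom_fst, ← Category.assoc, specKProd_inv_fst, Category.assoc,
      specKProd_inv_fst, ← specKMap_comp, ← specKMap_comp]
    congr 1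
    ext; simp
  · rw [Category.assoc, tensorHom_snd, ← Category.assoc, specKProd_inv_snd, Category.assoc,
      specKProd_inv_snd, ← specKMap_comp, ← specKMap_comp]
    congr 1
    ext; simp

theorem specKMap_tensorHom' (f : A →ₐ[k] C) (g : B →ₐ[k] D) :
    (specKMap f ⊗ₘ specKMap g) ≫ (specKProd A B).hom =
      (specKProd C D).hom ≫ specKMap (Algebra.TensorProduct.map f g) := by
  rw [← Iso.inv_comp_eq, ← Category.assoc, specKMap_tensorHom, Category.assoc, Iso.inv_hom_id,
    Category.comp_id]

theorem specKMap_whiskerLeft (f : A →ₐ[k] C) :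
    (specK k B ◁ specKMap f) ≫ (specKProd B A).hom =
      (specKProd B C).hom ≫ specKMap (Algebra.TensorProduct.map (.id k B) f) := by
  rw [← specKMap_tensorHom', ← id_tensorHom]
  congr 2
  exact ((algSpec (CommRingCat.of k)).map_id _).symm

theorem diagGroup_mul : (μ : (diagGroup k M).X ⊗ (diagGroup k M).X ⟶ (diagGroup k M).X) =
    (specKProd (AddMonoidAlgebra k M) (AddMonoidAlgebra k M)).hom ≫
      specKMap (Bialgebra.comulAlgHom k (AddMonoidAlgebra k M)) := rfl

/-- The action of the torus on an affine toric variety. -/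
def affineAct (S : AddSubmonoid M) : (diagGroup k M).X ⊗ affineToric k S ⟶ affineToric k S :=
  (specKProd (AddMonoidAlgebra k M) (AddMonoidAlgebra k S)).hom ≫ specKMap (coactAlg k S)

/-- Both composites are dual to `χ^s ↦ χ^s ⊗ χ^s`. -/
theorem whiskerLeft_affineAct (S : AddSubmonoid M) :
    ((diagGroup k M).X ◁ (affineToricMap k S.subtype)) ≫ affineAct S =
      (μ : (diagGroup k M).X ⊗ (diagGroup k M).X ⟶ (diagGroup k M).X) ≫
        affineToricMap k S.subtype := by
  rw [diagGroup_mul]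
  change (specK k _ ◁ specKMap (subAlg k S)) ≫ (specKProd _ _).hom ≫ specKMap (coactAlg k S) =
    ((specKProd _ _).hom ≫ _) ≫ specKMap (subAlg k S)
  rw [← Category.assoc, specKMap_whiskerLeft, Category.assoc, Category.assoc, ← specKMap_comp,
    ← specKMap_comp]
  congr 2
  ext m
  simp [coactAlg]

end Coaction

/-! ### The closed orbit of an affine toric variety. -/

section ClosedPoint

variable (k : Type u) [Field k] {M : Type u} [AddCommGroup M] [Module.Free ℤ M] [Module.Finite ℤ M]

/-- The generic point of the closed orbit of an affine toric variety. -/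
def orbitPoint (S : AddSubmonoid M) : (affineToric k S).left :=
  (⟨nonunitIdeal k S, inferInstance⟩ : PrimeSpectrum (AddMonoidAlgebra k S))

variable {k}

/-- Every orbit closure contains the closed orbit. -/
theorem exists_specializes_orbitPoint (S : AddSubmonoid M) (x : (affineToric k S).left) :
    ∃ z : ((diagGroup k M).X ⊗ affineToric k S).left,
      (snd (diagGroup k M).X (affineToric k S)).left z = x ∧
        (affineAct S).left z ⤳ orbitPoint k S := by
  let x' : PrimeSpectrum (AddMonoidAlgebra k S) := x
  -- `K` is the residue field at `x`, and `ev` is evaluation at `x`.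
  let K := FractionRing (AddMonoidAlgebra k S ⧸ x'.asIdeal)
  let ev : AddMonoidAlgebra k S →ₐ[k] K := (IsScalarTower.toAlgHom k _ K).comp
    (Ideal.Quotient.mkₐ k x'.asIdeal)
  have hker : RingHom.ker ev = x'.asIdeal := by
    ext f
    rw [RingHom.mem_ker]
    change algebraMap (AddMonoidAlgebra k S ⧸ x'.asIdeal) K (Ideal.Quotient.mk _ f) = 0 ↔ _
    rw [(IsFractionRing.injective (AddMonoidAlgebra k S ⧸ x'.asIdeal) K).eq_iff' (map_zero _),
      Ideal.Quotient.eq_zero_iff_mem]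
  let a : AddMonoidAlgebra k M →ₐ[k] AddMonoidAlgebra K M :=
    AddMonoidAlgebra.lift k _ M (AddMonoidAlgebra.of K M)
  let b : K →ₐ[k] AddMonoidAlgebra K M := AddMonoidAlgebra.singleZeroAlgHom
  -- Dual to the pair (universal point of the torus over `K`, `x`). The image of the generic point
  -- `q` is the pair whose product is a general translate of `x`.
  let θ : AddMonoidAlgebra k M ⊗[k] AddMonoidAlgebra k S →ₐ[k] AddMonoidAlgebra K M :=
    Algebra.TensorProduct.lift a (b.comp ev) fun _ _ => Commute.all _ _
  let q : (specK k (AddMonoidAlgebra K M)).left :=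
    (⊥ : PrimeSpectrum (AddMonoidAlgebra K M))
  -- On the translate, distinct characters stay linearly independent over `K`, so the terms of `f`
  -- cannot cancel one another.
  have hcoeff : ∀ (f : AddMonoidAlgebra k S) (s : S),
      (θ (coactAlg k S f)).coeff s = ev (.single s (f.coeff s)) := by
    intro f s
    induction f using AddMonoidAlgebra.induction_linear with
    | zero => simp
    | add f g hf hg => simp [map_add, hf, hg, AddMonoidAlgebra.single_add]
    | single t r =>
      have h1 : coactAlg k S (.single t r) = r • (.single (t : M) 1 ⊗ₜ .single t 1) := by
        simp [coactAlg]
      have h2 : θ (.single (t : M) 1 ⊗ₜ .single t 1) = .single (t : M) (ev (.single t 1)) := by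
        simp [θ, a, b, AddMonoidAlgebra.single_mul_single]
      have h3 : ∀ r : k, ev (.single t r) = r • ev (.single t 1) := fun r => by
        rw [← map_smul, AddMonoidAlgebra.smul_single, smul_eq_mul, _root_.mul_one]
      rw [h1, map_smul, h2, AddMonoidAlgebra.coeff_smul_apply]
      by_cases hts : t = s
      · subst hts
        rw [h3 (AddMonoidAlgebra.coeff (.single t r) t)]
        simp
      · have : (t : M) ≠ s := fun h => hts (Subtype.ext h)
        simp [hts, this]
  obtain ⟨w, hw1, hw2⟩ : ∃ w : specK k (AddMonoidAlgebra K M) ⟶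
      (diagGroup k M).X ⊗ affineToric k S,
      w ≫ snd _ _ = specKMap (θ.comp Algebra.TensorProduct.includeRight) ∧
        w ≫ affineAct S = specKMap (θ.comp (coactAlg k S)) := by
    refine ⟨specKMap θ ≫ (specKProd (AddMonoidAlgebra k M) (AddMonoidAlgebra k S)).inv, ?_, ?_⟩
    · rw [specKMap_comp, ← specKProd_inv_snd]
      exact Category.assoc _ _ _
    · rw [specKMap_comp]
      exact (Category.assoc _ _ _).trans (congrArg (specKMap θ ≫ ·) (Iso.inv_hom_id_assoc _ _))
  refine ⟨w.left q, ?_, ?_⟩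
  · rw [← Scheme.Hom.comp_apply, ← Over.comp_left, hw1]
    refine PrimeSpectrum.ext ?_
    change Ideal.comap (θ.comp Algebra.TensorProduct.includeRight).toRingHom ⊥ = x'.asIdeal
    refine Eq.trans ?_ hker
    ext f
    rw [Ideal.mem_comap, Ideal.mem_bot, RingHom.mem_ker]
    change θ (1 ⊗ₜ f) = 0 ↔ _
    rw [Algebra.TensorProduct.lift_tmul, map_one, _root_.one_mul]
    change AddMonoidAlgebra.single 0 (ev f) = 0 ↔ _
    simp
  · rw [← Scheme.Hom.comp_apply, ← Over.comp_left, hw2]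
    refine (PrimeSpectrum.le_iff_specializes _ _).1 ?_
    change Ideal.comap (θ.comp (coactAlg k S)).toRingHom ⊥ ≤ nonunitIdeal k S
    intro f hf
    rw [Ideal.mem_comap, Ideal.mem_bot] at hf
    change θ (coactAlg k S f) = 0 at hf
    rw [mem_nonunitIdeal]
    intro m hm
    by_contra hne
    have hmS := mem_of_coeff_ne_zero hne
    have h0 := hcoeff f ⟨m, hmS⟩
    rw [hf] at h0
    rw [coeff_subAlg f ⟨m, hmS⟩] at hne
    -- An invertible character has nonzero value at every point, so its coefficient in a function
    -- vanishing at the translate must be zero.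
    have hu : IsUnit (AddMonoidAlgebra.single (⟨m, hmS⟩ : S) (f.coeff ⟨m, hmS⟩)) := by
      refine IsUnit.of_mul_eq_one (.single ⟨-m, hm⟩ (f.coeff ⟨m, hmS⟩)⁻¹) ?_
      rw [AddMonoidAlgebra.single_mul_single, AddMonoidAlgebra.one_def, mul_inv_cancel₀ hne]
      congr 1
      ext; simp
    exact (hu.map ev).ne_zero h0.symm

end ClosedPoint

/-! ### Integrality of products, density arguments and extension of morphisms. -/

section Integral

variable {k : Type u} [Field k] {M : Type u} [AddCommGroup M] [Module.Free ℤ M] [Module.Finite ℤ M]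

/-- For every field extension `K`, the ring `K ⊗ k[M] ≅ K[M]` is a domain because `M` is free of
finite rank. -/
instance geometricallyIntegral_diagGroup : GeometricallyIntegral (diagGroup k M).X.hom := by
  rw [geometricallyIntegral_iff]
  refine geometrically_iff_of_commRing.2 fun K _ _ Y f g h => ?_
  have : IsDomain (K ⊗[k] AddMonoidAlgebra k M) :=
    (AddMonoidAlgebra.scalarTensorEquiv k K (M := M)).toRingEquiv.toMulEquiv.isDomain
  have : IsDomain (AddMonoidAlgebra k M ⊗[k] K) :=
    (Algebra.TensorProduct.comm k (AddMonoidAlgebra k M) K).toRingEquiv.toMulEquiv.isDomain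
  let e : Y ≅ Spec (.of (AddMonoidAlgebra k M ⊗[k] K)) :=
    h.isoPullback ≪≫ pullbackSpecIso k (AddMonoidAlgebra k M) K
  have : Nonempty Y := Nonempty.map e.inv (inferInstanceAs (Nonempty (PrimeSpectrum _)))
  exact isIntegral_of_isOpenImmersion e.hom

instance locallyOfFiniteType_diagGroup : LocallyOfFiniteType (diagGroup k M).X.hom := by
  have : AddMonoid.FG M :=
    AddGroup.fg_iff_addMonoid_fg.1 (Module.Finite.iff_addGroup_fg.1 inferInstance)
  exact locallyOfFiniteType_specOverSpec (R := .of k) (A := .of (AddMonoidAlgebra k M))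

omit [Module.Free ℤ M] [Module.Finite ℤ M] in
theorem locallyOfFiniteType_affineToric {S : AddSubmonoid M} (hS : S.FG) :
    LocallyOfFiniteType (affineToric k S).hom := by
  have : AddMonoid.FG S := (AddMonoid.fg_iff_addSubmonoid_fg S).2 hS
  exact locallyOfFiniteType_specOverSpec (R := .of k) (A := .of (AddMonoidAlgebra k S))

omit [Module.Free ℤ M] [Module.Finite ℤ M] in
theorem fg_of_locallyOfFiniteType {S : AddSubmonoid M}
    [H : LocallyOfFiniteType (affineToric k S).hom] : S.FG := by
  have h : (algebraMap k (AddMonoidAlgebra k S)).FiniteType :=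
    (HasRingHomProperty.Spec_iff (P := @LocallyOfFiniteType)).1 H
  have : Algebra.FiniteType k (AddMonoidAlgebra k S) := RingHom.finiteType_algebraMap.1 h
  exact (AddMonoid.fg_iff_addSubmonoid_fg S).1 (AddMonoidAlgebra.fg_of_finiteType (R := k))

/-- Needed so that open subschemes such as `T × T ⊆ T × X` are dense over an arbitrary field, and
equivariance can be tested on them. -/
theorem isIntegral_tensorObj (T X : KScheme k) [GeometricallyIntegral T.hom]
    [IsIntegral X.left] [LocallyOfFiniteType X.hom] : IsIntegral (T ⊗ X).left := by
  have : IsLocallyNoetherian X.left := LocallyOfFiniteType.isLocallyNoetherian X.hom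
  have : UniversallyOpen T.hom := inferInstance
  exact inferInstanceAs (IsIntegral (Limits.pullback T.hom X.hom))

instance [Nonempty M] (S : AddSubmonoid M) : IsIntegral (affineToric k S).left :=
  inferInstanceAs (IsIntegral (Spec (.of (AddMonoidAlgebra k S))))

/-- Morphisms to a separated scheme that agree on a dominant subscheme agree. -/
theorem ext_of_dominant {D X Y : KScheme k} [IsReduced X.left] [IsSeparated Y.hom]
    (j : D ⟶ X) [IsDominant j.left] {f g : X ⟶ Y} (h : j ≫ f = j ≫ g) : f = g := by
  ext1
  refine ext_of_isDominant_of_isSeparated Y.hom ?_ j.left ?_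
  · rw [Over.w, Over.w]
  · rw [← Over.comp_left, h, Over.comp_left]

theorem isDominant_of_isOpenImmersion {X Y : Scheme.{u}} (f : X ⟶ Y) [IsOpenImmersion f]
    [Nonempty X] [IrreducibleSpace Y] : IsDominant f :=
  ⟨f.isOpenEmbedding.isOpen_range.dense (Set.range_nonempty _)⟩

theorem isDominant_specKMap {A B : Type u} [CommRing A] [Algebra k A] [CommRing B] [Algebra k B]
    [IsDomain A] {f : A →ₐ[k] B} (hf : Function.Injective f) : IsDominant (specKMap f).left := by
  refine ⟨?_⟩
  exact (PrimeSpectrum.denseRange_comap_iff_ker_le_nilRadical f.toRingHom).2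
    (by rw [(RingHom.injective_iff_ker_eq_bot f.toRingHom).1 hf]; exact bot_le)

theorem isPullback_whiskerLeft (T : KScheme k) {X Y : KScheme k} (f : X ⟶ Y) :
    IsPullback (T ◁ f).left (snd T X).left (snd T Y).left f.left := by
  have : IsPullback (T ◁ f) (snd T X) (snd T Y) f := by
    refine ⟨⟨by simp⟩, ⟨Limits.PullbackCone.IsLimit.mk _
      (fun s => lift (s.fst ≫ fst _ _) s.snd) (fun s => ?_) (fun s => ?_) fun s m h1 h2 => ?_⟩⟩
    · apply CartesianMonoidalCategory.hom_ext
      · simp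
      · simp [s.condition]
    · simp
    · apply CartesianMonoidalCategory.hom_ext
      · simp [← h1]
      · simpa using h2
  exact this.map (Over.forget _)

instance (T : KScheme k) {X Y : KScheme k} (f : X ⟶ Y) [IsOpenImmersion f.left] :
    IsOpenImmersion (T ◁ f).left :=
  MorphismProperty.of_isPullback (isPullback_whiskerLeft T f).flip ‹_›

theorem opensRange_whiskerLeft (T : KScheme k) {X Y : KScheme k} (f : X ⟶ Y)
    [IsOpenImmersion f.left] :
    (T ◁ f).left.opensRange = (snd T Y).left ⁻¹ᵁ f.left.opensRange := by
  have h := isPullback_whiskerLeft T f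
  ext x
  constructor
  · rintro ⟨y, rfl⟩
    exact ⟨(snd T X).left y, by rw [← Scheme.Hom.comp_apply, ← Scheme.Hom.comp_apply, h.w]⟩
  · rintro ⟨y, hy⟩
    obtain ⟨z, hz, -⟩ := Scheme.Pullback.exists_preimage_pullback (f := (snd T Y).left)
      (g := f.left) x y hy.symm
    refine ⟨h.isoPullback.inv z, ?_⟩
    rw [← Scheme.Hom.comp_apply, h.isoPullback_inv_fst, hz]

/-- A morphism on a dense open subscheme extends if it does so locally. -/
theorem exists_extension {D P Y : KScheme k} [IsIntegral P.left] [IsSeparated Y.hom]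
    [Nonempty D.left] (j : D ⟶ P) [IsOpenImmersion j.left] (g : D ⟶ Y) {I : Type*}
    {Q : I → KScheme k} (q : ∀ i, Q i ⟶ P) [∀ i, IsOpenImmersion (q i).left]
    (hq : ⨆ i, (q i).left.opensRange = ⊤) (s : ∀ i, D ⟶ Q i) (hs : ∀ i, s i ≫ q i = j)
    (f : ∀ i, Q i ⟶ Y) (hf : ∀ i, s i ≫ f i = g) : ∃ F : P ⟶ Y, ∀ i, q i ≫ F = f i := by
  -- Both local morphisms restrict to `g` on `D`, which is a nonempty open subscheme of the integral
  -- overlap, hence dense; the target is separated.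
  have hcompat : ∀ a b : I, Limits.pullback.fst (q a).left (q b).left ≫ (f a).left =
      Limits.pullback.snd (q a).left (q b).left ≫ (f b).left := by
    intro a b
    let p := Limits.pullback.fst (q a).left (q b).left ≫ (q a).left
    let l : D.left ⟶ Limits.pullback (q a).left (q b).left :=
      Limits.pullback.lift (s a).left (s b).left
        (by rw [← Over.comp_left, ← Over.comp_left, hs, hs])
    have hl : l ≫ p = j.left := by
      rw [Limits.pullback.lift_fst_assoc, ← Over.comp_left, hs]
    have : IsOpenImmersion p := inferInstance
    have : IsOpenImmersion (l ≫ p) := by rw [hl]; infer_instance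
    have : IsOpenImmersion l := IsOpenImmersion.of_comp l p
    have : Nonempty (Limits.pullback (q a).left (q b).left :) := ⟨l (Classical.arbitrary _)⟩
    have : IsIntegral (Limits.pullback (q a).left (q b).left) := isIntegral_of_isOpenImmersion p
    have := isDominant_of_isOpenImmersion l
    refine ext_of_isDominant_of_isSeparated Y.hom ?_ l ?_
    · rw [Category.assoc, Category.assoc, Over.w, Over.w, ← Over.w (q a), ← Over.w (q b),
        Limits.pullback.condition_assoc]
    · rw [Limits.pullback.lift_fst_assoc, Limits.pullback.lift_snd_assoc, ← Over.comp_left,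
        ← Over.comp_left, hf, hf]
  let 𝒰 : P.left.OpenCover := Scheme.Cover.mkOfCovers I (fun i => (Q i).left) (fun i => (q i).left)
    fun x => by
      have : x ∈ ⨆ i, (q i).left.opensRange := hq ▸ trivial
      obtain ⟨i, y, hy⟩ := TopologicalSpace.Opens.mem_iSup.1 this
      exact ⟨i, y, hy⟩
  have hι : ∀ i : I, (q i).left ≫ 𝒰.glueMorphisms (fun i => (f i).left) hcompat = (f i).left :=
    fun i => 𝒰.ι_glueMorphisms (fun i => (f i).left) hcompat i
  refine ⟨Over.homMk (𝒰.glueMorphisms (fun i => (f i).left) hcompat) ?_, fun i => ?_⟩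
  · refine 𝒰.hom_ext _ _ fun (i : I) => ?_
    change (q i).left ≫ _ ≫ Y.hom = (q i).left ≫ P.hom
    rw [← Category.assoc, hι, Over.w, Over.w]
  · ext1
    exact hι i

end Integral

/-! ### Charts of toric varieties -/

section Torus

variable {k : Type u} [Field k]

instance nonempty_torus (T : Grp (KScheme k)) : Nonempty T.X.left :=
  Nonempty.map (MonObj.one : 𝟙_ (KScheme k) ⟶ T.X).left
    (inferInstanceAs (Nonempty (PrimeSpectrum k)))

theorem geometricallyIntegral_of_iso {T T' : KScheme k} (e : T ≅ T')
    [GeometricallyIntegral T'.hom] : GeometricallyIntegral T.hom := by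
  rw [← Over.w e.hom]
  have : IsIso e.hom.left := inferInstanceAs (IsIso ((Over.forget _).map e.hom))
  have : MorphismProperty.RespectsIso @GeometricallyIntegral.{u} :=
    MorphismProperty.IsStableUnderBaseChange.respectsIso
  exact (MorphismProperty.cancel_left_of_respectsIso @GeometricallyIntegral _ _).2 ‹_›

instance geometricallyIntegral_torus (Y : ToricVariety k) : GeometricallyIntegral Y.T.X.hom := by
  obtain ⟨d, ⟨e⟩⟩ := Y.isTorus
  have e' : Y.T.X ≅ (diagGroup k (ULift.{u} (Fin d) → ℤ)).X := (Grp.forget _).mapIso e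
  have : Module.Free ℤ (ULift.{u} (Fin d) → ℤ) := inferInstance
  exact geometricallyIntegral_of_iso e'

instance isIntegral_torus_tensor (Y : ToricVariety k) : IsIntegral (Y.T.X ⊗ Y.X).left :=
  isIntegral_tensorObj _ _

instance isIntegral_torus (Y : ToricVariety k) : IsIntegral Y.T.X.left :=
  isIntegral_of_isOpenImmersion Y.emb.left

instance locallyOfFiniteType_torus (Y : ToricVariety k) : LocallyOfFiniteType Y.T.X.hom := by
  rw [← Over.w Y.emb]; infer_instance

instance isIntegral_torus_tensor_torus (Y : ToricVariety k) : IsIntegral (Y.T.X ⊗ Y.T.X).left :=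
  isIntegral_tensorObj _ _

instance isDominant_emb (Y : ToricVariety k) : IsDominant Y.emb.left :=
  isDominant_of_isOpenImmersion _

theorem isDominant_whiskerLeft (Y : ToricVariety k) {D : KScheme k} (j : D ⟶ Y.X)
    [IsOpenImmersion j.left] [Nonempty (Y.T.X ⊗ D).left] : IsDominant (Y.T.X ◁ j).left :=
  isDominant_of_isOpenImmersion _

instance isDominant_whiskerLeft_emb (Y : ToricVariety k) : IsDominant (Y.T.X ◁ Y.emb).left :=
  isDominant_whiskerLeft _ _

/-- A morphism of toric varieties is determined by its homomorphism of tori. -/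
theorem ToricVariety.hom_ext {Y Z : ToricVariety k} {f g : Y ⟶ Z}
    (h : f.torusHom = g.torusHom) : f = g := by
  refine ToricVariety.Hom.ext h (ext_of_dominant Y.emb ?_)
  rw [f.emb_hom, g.emb_hom, h]

/-- A morphism that extends a homomorphism of tori is equivariant. -/
theorem smul_hom_of_emb_hom {Y Z : ToricVariety k} (a : Y.T ⟶ Z.T) (f : Y.X ⟶ Z.X)
    (h : Y.emb ≫ f = a.hom.hom ≫ Z.emb) :
    actionMap Y.T Y.X ≫ f = (a.hom.hom ⊗ₘ f) ≫ actionMap Z.T Z.X := by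
  refine ext_of_dominant (Y.T.X ◁ Y.emb) ?_
  have h1 : (Y.T.X ◁ Y.emb) ≫ (a.hom.hom ⊗ₘ f) = (a.hom.hom ⊗ₘ a.hom.hom) ≫ (Z.T.X ◁ Z.emb) := by
    rw [← id_tensorHom, ← id_tensorHom, tensorHom_comp_tensorHom, tensorHom_comp_tensorHom, h]
    simp
  rw [← Category.assoc, ← Y.mul_emb, Category.assoc, h, ← Category.assoc,
    IsMonHom.mul_hom a.hom.hom, Category.assoc, Z.mul_emb, ← Category.assoc, ← h1, Category.assoc]

theorem lift_lift_act (T : Grp (KScheme k)) (X : KScheme k) [ModObj T.X X] {W : KScheme k}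
    (a b : W ⟶ T.X) (x : W ⟶ X) :
    lift a (lift b x ≫ actionMap T X) ≫ actionMap T X =
      lift (lift a b ≫ MonObj.mul) x ≫ actionMap T X := by
  have h : (α_ T.X T.X X).hom ≫ (T.X ◁ actionMap T X) ≫ actionMap T X =
      (MonObj.mul ▷ X) ≫ actionMap T X := (ModObj.mul_smul (M := T.X) X).symm
  have := congr(lift (lift a b) x ≫ $h)
  rwa [lift_whiskerRight_assoc, lift_lift_associator_hom_assoc, lift_whiskerLeft_assoc] at this

theorem lift_one_act (T : Grp (KScheme k)) (X : KScheme k) [ModObj T.X X] {W : KScheme k}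
    (x : W ⟶ X) : lift (toUnit W ≫ MonObj.one) x ≫ actionMap T X = x := by
  have h : (MonObj.one ▷ X) ≫ actionMap T X = (λ_ X).hom := ModObj.one_smul (M := T.X) X
  have := congr(lift (toUnit W) x ≫ $h)
  rwa [lift_whiskerRight_assoc, lift_leftUnitor_hom] at this

/-- The action of the inverse element undoes the action. -/
theorem exists_act_swap (T : Grp (KScheme k)) (X : KScheme k) [ModObj T.X X] :
    ∃ Φ : T.X ⊗ X ⟶ T.X ⊗ X, Φ ≫ snd _ _ = actionMap T X ∧ Φ ≫ actionMap T X = snd _ _ := by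
  refine ⟨lift (fst _ _ ≫ ι) (actionMap T X), by simp, ?_⟩
  have h := lift_lift_act T X (fst T.X X ≫ ι) (fst T.X X) (snd T.X X)
  rwa [lift_fst_snd, Category.id_comp, GrpObj.lift_comp_inv_left, lift_one_act] at h

/-- An invariant open subscheme is also invariant under the inverse action. -/
theorem IsInvariantOpen.act_preimage_le {T : Grp (KScheme k)} {X : KScheme k} [ModObj T.X X]
    {U : X.left.Opens} (h : IsInvariantOpen T X U) :
    (actionMap T X).left ⁻¹ᵁ U ≤ (snd T.X X).left ⁻¹ᵁ U := by
  obtain ⟨Φ, h1, h2⟩ := exists_act_swap T X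
  intro z hz
  have h3 := h (x := Φ.left z) (by
    change (Φ.left ≫ (snd T.X X).left) z ∈ U
    rwa [← Over.comp_left, h1])
  change (Φ.left ≫ (actionMap T X).left) z ∈ U at h3
  rwa [← Over.comp_left, h2] at h3

end Torus

/-! ### Affine charts compatible with the torus. -/

section Chart

variable {k : Type u} [Field k] {M : Type u} [AddCommGroup M]
  {Y : ToricVariety k} (e : Y.T ≅ diagGroup k M)

/-- The map from the torus to an affine toric variety. -/
def torusMap (S : AddSubmonoid M) : Y.T.X ⟶ affineToric k S :=
  e.hom.hom.hom ≫ affineToricMap k S.subtype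

/-- An affine chart of a toric variety. -/
structure IsChart (S : AddSubmonoid M) (c : affineToric k S ⟶ Y.X) : Prop where
  isOpenImmersion : IsOpenImmersion c.left
  torusMap_comp : torusMap e S ≫ c = Y.emb

theorem torusMap_comp_inclusion {S S' : AddSubmonoid M} (h : S ≤ S') :
    torusMap e S' ≫ affineToricMap k (AddSubmonoid.inclusion h) = torusMap e S := by
  refine (Category.assoc _ _ _).trans (congrArg (e.hom.hom.hom ≫ ·) ?_)
  exact (specKMap_comp _ _).symm.trans (congrArg specKMap (subAlg_comp_inclAlg h))

theorem whiskerLeft_comp_act {T G Z : KScheme k} [MonObj T] [MonObj G] (a : T ⟶ G) [IsMonHom a]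
    (p : G ⟶ Z) (act : G ⊗ Z ⟶ Z) (h : (G ◁ p) ≫ act = MonObj.mul ≫ p) :
    (T ◁ (a ≫ p)) ≫ (a ▷ Z) ≫ act = (MonObj.mul : T ⊗ T ⟶ T) ≫ a ≫ p := by
  have h2 : (T ◁ (a ≫ p)) ≫ (a ▷ Z) = (a ⊗ₘ a) ≫ (G ◁ p) := by
    rw [← id_tensorHom, ← id_tensorHom, ← tensorHom_id, tensorHom_comp_tensorHom,
      tensorHom_comp_tensorHom]
    simp
  rw [← Category.assoc, h2, Category.assoc, h, ← Category.assoc, ← IsMonHom.mul_hom a,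
    Category.assoc]

variable [Module.Free ℤ M] [Module.Finite ℤ M]

instance isDominant_torusMap (S : AddSubmonoid M) : IsDominant (torusMap e S).left := by
  have h1 : IsDominant (affineToricMap k S.subtype).left :=
    isDominant_specKMap (subAlg_injective S)
  have h2 : IsIso e.hom.hom.hom.left :=
    inferInstanceAs (IsIso ((Over.forget _).map ((Grp.forget _).mapIso e).hom))
  have h3 : IsDominant e.hom.hom.hom.left := inferInstance
  exact ⟨h1.denseRange.comp h3.denseRange (affineToricMap k S.subtype).left.continuous⟩

variable {e}

theorem eq_of_torusMap_comp {S : AddSubmonoid M} {Z : KScheme k} [IsSeparated Z.hom]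
    {f g : affineToric k S ⟶ Z} (h : torusMap e S ≫ f = torusMap e S ≫ g) : f = g :=
  ext_of_dominant _ h

theorem IsChart.eq {S : AddSubmonoid M} {c c' : affineToric k S ⟶ Y.X} (h : IsChart e S c)
    (h' : IsChart e S c') : c = c' :=
  eq_of_torusMap_comp (h.torusMap_comp.trans h'.torusMap_comp.symm)

omit [Module.Free ℤ M] [Module.Finite ℤ M] in
theorem IsChart.isOpenImmersion_torusMap {S : AddSubmonoid M} {c : affineToric k S ⟶ Y.X}
    (h : IsChart e S c) : IsOpenImmersion (torusMap e S).left := by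
  have := h.isOpenImmersion
  have : IsOpenImmersion ((torusMap e S).left ≫ c.left) := by
    rw [← Over.comp_left, h.torusMap_comp]; infer_instance
  exact IsOpenImmersion.of_comp _ c.left

omit [Module.Free ℤ M] [Module.Finite ℤ M] in
-- An open subscheme of `Y` is locally of finite type over `k`, and a semigroup algebra of finite
-- type has a finitely generated semigroup.
theorem IsChart.fg {S : AddSubmonoid M} {c : affineToric k S ⟶ Y.X}
    (h : IsChart e S c) : S.FG := by
  have := h.isOpenImmersion
  have : LocallyOfFiniteType (affineToric k S).hom := by
    rw [← Over.w c]; infer_instance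
  exact fg_of_locallyOfFiniteType (k := k)

/-- Charts are automatically equivariant: both sides extend the multiplication of the torus from the
dense subscheme `T × T` of `T × T^S`. -/
theorem IsChart.affineAct_comp {S : AddSubmonoid M} {c : affineToric k S ⟶ Y.X}
    (h : IsChart e S c) :
    (e.hom.hom.hom ▷ affineToric k S) ≫ affineAct S ≫ c = (Y.T.X ◁ c) ≫ actionMap Y.T Y.X := by
  have := h.isOpenImmersion
  have := h.isOpenImmersion_torusMap
  have : LocallyOfFiniteType (affineToric k S).hom := locallyOfFiniteType_affineToric h.fg
  have : IsIntegral (Y.T.X ⊗ affineToric k S).left := isIntegral_tensorObj _ _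
  have : IsDominant (Y.T.X ◁ torusMap e S).left := isDominant_of_isOpenImmersion _
  refine ext_of_dominant (Y.T.X ◁ torusMap e S) ?_
  have h1 : (Y.T.X ◁ torusMap e S) ≫ (e.hom.hom.hom ▷ affineToric k S) ≫ affineAct S =
      (μ : Y.T.X ⊗ Y.T.X ⟶ _) ≫ torusMap e S := by
    exact whiskerLeft_comp_act e.hom.hom.hom (affineToricMap k S.subtype) _
      (whiskerLeft_affineAct S)
  rw [← MonoidalCategory.whiskerLeft_comp_assoc, h.torusMap_comp, ← Y.mul_emb, ← h.torusMap_comp,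
    ← Category.assoc, ← Category.assoc, Category.assoc _ _ (affineAct S), h1, Category.assoc]

theorem IsChart.isInvariantOpen {S : AddSubmonoid M} {c : affineToric k S ⟶ Y.X}
    (h : IsChart e S c) [IsOpenImmersion c.left] : IsInvariantOpen Y.T Y.X c.left.opensRange := by
  intro z hz
  rw [← opensRange_whiskerLeft] at hz
  obtain ⟨w, rfl⟩ := hz
  refine ⟨((e.hom.hom.hom ▷ affineToric k S) ≫ affineAct S).left w, ?_⟩
  rw [← Scheme.Hom.comp_apply, ← Scheme.Hom.comp_apply, ← Over.comp_left, ← Over.comp_left,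
    Category.assoc, h.affineAct_comp]

end Chart

/-! ### Morphisms of toric varieties and morphisms of triples. -/

section Morphisms

variable {k : Type u} [Field k]

theorem GluingData.isChart {t : ToricTriple.{u}} {Y : ToricVariety k} (R : GluingData t Y)
    (σ : t.fan.cones) : IsChart R.torusIso (t.Γ σ) (R.chart σ) :=
  ⟨R.isOpenImmersion σ, (Category.assoc _ _ _).trans (R.emb_eq σ)⟩

attribute [instance] GluingData.isOpenImmersion

/-- A morphism of triples induces a morphism of toric varieties. -/
theorem exists_hom {t' t : ToricTriple.{u}} {Y' Y : ToricVariety k} (R' : GluingData t' Y')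
    (R : GluingData t Y) (φ : t' ⟶ t) :
    ∃ h : Y' ⟶ Y, h.torusHom ≫ R.torusIso.hom =
      R'.torusIso.hom ≫ diagGroupMap k (dualMap φ.toLinearMap) := by
  let a : Y'.T ⟶ Y.T :=
    R'.torusIso.hom ≫ diagGroupMap k (dualMap φ.toLinearMap) ≫ R.torusIso.inv
  have ha : a ≫ R.torusIso.hom = R'.torusIso.hom ≫ diagGroupMap k (dualMap φ.toLinearMap) := by
    simp [a]
  -- The choice of `s` is harmless: every local morphism restricts to the homomorphism `a` on the
  -- torus, so they agree on overlaps.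
  choose s hs using φ.exists_cone
  let p : ∀ σ', t.Γ (s σ') →+ t'.Γ σ' := fun σ' =>
    { toFun := fun m => ⟨dualMap φ.toLinearMap m, hs σ' ⟨m, m.2, rfl⟩⟩
      map_zero' := Subtype.ext (map_zero _)
      map_add' := fun _ _ => Subtype.ext (map_add _ _ _) }
  have hp : ∀ σ', torusMap R'.torusIso (t'.Γ σ') ≫ affineToricMap k (p σ') =
      a.hom.hom ≫ torusMap R.torusIso (t.Γ (s σ')) := by
    intro σ'
    have h1 : affineToricMap k (t'.Γ σ').subtype ≫ affineToricMap k (p σ') =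
        affineToricMap k (dualMap φ.toLinearMap) ≫ affineToricMap k (t.Γ (s σ')).subtype := by
      refine (specKMap_comp _ _).symm.trans (Eq.trans (congrArg specKMap ?_) (specKMap_comp _ _))
      ext; simp [p]
    have h2 := congr(($ha).hom.hom ≫ affineToricMap k (t.Γ (s σ')).subtype)
    exact (Category.assoc _ _ _).trans
      ((congrArg (R'.torusIso.hom.hom.hom ≫ ·) h1).trans ((Category.assoc _ _ _).symm.trans
        (h2.symm.trans (Category.assoc _ _ _))))
  obtain ⟨f, hf⟩ := exists_extension Y'.emb (a.hom.hom ≫ Y.emb) R'.chart R'.cover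
    (fun σ' => torusMap R'.torusIso (t'.Γ σ')) (fun σ' => (R'.isChart σ').torusMap_comp)
    (fun σ' => affineToricMap k (p σ') ≫ R.chart (s σ'))
    (fun σ' => by rw [← Category.assoc, hp, Category.assoc, (R.isChart _).torusMap_comp])
  have hemb : Y'.emb ≫ f = a.hom.hom ≫ Y.emb := by
    obtain ⟨σ', hσ'⟩ := t'.fan.nonempty
    rw [← (R'.isChart ⟨σ', hσ'⟩).torusMap_comp, Category.assoc, hf, ← Category.assoc, hp,
      Category.assoc, (R.isChart _).torusMap_comp]
  exact ⟨⟨a, f, hemb, smul_hom_of_emb_hom a f hemb⟩, ha⟩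

/-- The preimage of a chart under an equivariant morphism that contains the closed orbit
contains the whole affine toric variety. -/
theorem range_le_of_orbitPoint_mem {Y' Y : ToricVariety k} (h : Y' ⟶ Y)
    {M' : Type u} [AddCommGroup M'] [Module.Free ℤ M'] [Module.Finite ℤ M']
    {e' : Y'.T ≅ diagGroup k M'} {S' : AddSubmonoid M'} {c' : affineToric k S' ⟶ Y'.X}
    (hc' : IsChart e' S' c') {U : Y.X.left.Opens} (hU : IsInvariantOpen Y.T Y.X U)
    (hx : (c' ≫ h.hom).left (orbitPoint k S') ∈ U) (x : (affineToric k S').left) :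
    (c' ≫ h.hom).left x ∈ U := by
  -- A translate of `x` specializes to the orbit point, so it lies in the open preimage of `U`.
  obtain ⟨z, rfl, hz⟩ := exists_specializes_orbitPoint S' x
  have h1 : (c' ≫ h.hom).left ((affineAct S').left z) ∈ U :=
    (hz.map (c' ≫ h.hom).left.continuous).mem_open U.isOpen hx
  let i : (diagGroup k M').X ⟶ Y'.T.X := e'.inv.hom.hom
  let w : (diagGroup k M').X ⊗ affineToric k S' ⟶ Y.T.X ⊗ Y.X :=
    (i ≫ h.torusHom.hom.hom) ⊗ₘ (c' ≫ h.hom)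
  have hi : (i ▷ affineToric k S') ≫ (e'.hom.hom.hom ▷ affineToric k S') = 𝟙 _ := by
    rw [← comp_whiskerRight]
    exact (congrArg (· ▷ affineToric k S') congr(($e'.inv_hom_id).hom.hom)).trans (id_whiskerRight _ _)
  have hw : w ≫ actionMap Y.T Y.X = affineAct S' ≫ c' ≫ h.hom := by
    have h2 : affineAct S' ≫ c' = (i ▷ affineToric k S') ≫ (Y'.T.X ◁ c') ≫ actionMap Y'.T Y'.X :=
      (Category.id_comp _).symm.trans ((congrArg (· ≫ affineAct S' ≫ c') hi.symm).trans
        ((Category.assoc _ _ _).trans (congrArg ((i ▷ affineToric k S') ≫ ·) hc'.affineAct_comp)))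
    have h3 : (i ▷ affineToric k S') ≫ (Y'.T.X ◁ c') ≫ (h.torusHom.hom.hom ⊗ₘ h.hom) = w := by
      rw [← tensorHom_id, ← id_tensorHom, tensorHom_comp_tensorHom, tensorHom_comp_tensorHom]
      simp [w]
    rw [← Category.assoc, h2, Category.assoc, Category.assoc, h.smul_hom, ← h3, Category.assoc,
      Category.assoc]
  have hw' : w ≫ snd _ _ = snd _ _ ≫ c' ≫ h.hom := tensorHom_snd _ _
  have h3 : (actionMap Y.T Y.X).left (w.left z) ∈ U := by
    rw [← Scheme.Hom.comp_apply, ← Over.comp_left] at h1 ⊢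
    rwa [hw]
  -- Acting by the inverse moves the translate back to the image of `x` inside `U`.
  have h4 := hU.act_preimage_le h3
  change (snd Y.T.X Y.X).left (w.left z) ∈ U at h4
  rw [← Scheme.Hom.comp_apply, ← Over.comp_left, hw'] at h4
  rwa [← Scheme.Hom.comp_apply, ← Over.comp_left]

/-- Lattices of finite rank are reflexive, so transposing twice returns `g`. -/
theorem exists_dualMap_eq {N' N : Type u} [AddCommGroup N'] [AddCommGroup N] [Module.Free ℤ N]
    [Module.Finite ℤ N] [Module.Free ℤ N'] [Module.Finite ℤ N']
    (g : DualLattice N →+ DualLattice N') : ∃ φ : N' →ₗ[ℤ] N, dualMap φ = g := by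
  refine ⟨(Module.evalEquiv ℤ N).symm.toLinearMap ∘ₗ
    (Module.Dual.transpose (R := ℤ) g.toIntLinearMap) ∘ₗ (Module.Dual.eval ℤ N'), ?_⟩
  ext m n
  exact Module.apply_evalEquiv_symm_apply ℤ N m _

theorem dualMap_injective {N' N : Type u} [AddCommGroup N'] [AddCommGroup N] [Module.Free ℤ N]
    [Module.Finite ℤ N] : Function.Injective (dualMap (N' := N') (N := N)) := by
  intro φ ψ h
  ext n
  refine Module.eval_apply_injective (K := ℤ) (V := N) (LinearMap.ext fun m => ?_)
  exact congr($h m n)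

/-- By fullness of `hopfSpec` the homomorphism is a bialgebra map. It preserves group-like elements,
which in a group algebra over a field are the characters. -/
theorem exists_eq_diagGroupMap {M' M : Type u} [AddCommGroup M'] [AddCommGroup M]
    (a : diagGroup k M' ⟶ diagGroup k M) : ∃ g : M →+ M', a = diagGroupMap k g := by
  let f := ((hopfSpec (CommRingCat.of k)).preimage a).unop.hom
  refine ⟨AddMonoidAlgebra.mapDomainOfBialgHom f, ?_⟩
  rw [diagGroupMap, AddMonoidAlgebra.mapDomainBialgHom_mapDomainOfBialgHom]
  exact ((hopfSpec (CommRingCat.of k)).map_preimage a).symm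

theorem diagGroupMap_injective {M' M : Type u} [AddCommGroup M'] [AddCommGroup M] :
    Function.Injective (diagGroupMap k : (M →+ M') → _) := by
  intro f g h
  have h1 : AddMonoidAlgebra.mapDomainAlgHom k k f = AddMonoidAlgebra.mapDomainAlgHom k k g :=
    specKMap_injective congr(($h).hom.hom)
  ext m
  have h2 := congr($h1 (.single m 1))
  simp only [AddMonoidAlgebra.mapDomainAlgHom_apply, AddMonoidAlgebra.mapDomain_single] at h2
  exact AddMonoidAlgebra.single_left_injective one_ne_zero h2

/-- The algebra map behind `l` carries `χ^m` to an element of `k[S']` equal to `χ^(g m)` in `k[M']`,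
which forces `g m ∈ S'`. -/
theorem map_le_of_comp_eq {M' M : Type u} [AddCommGroup M'] [AddCommGroup M] {g : M →+ M'}
    {S' : AddSubmonoid M'} {S : AddSubmonoid M} {l : affineToric k S' ⟶ affineToric k S}
    (h : affineToricMap k S'.subtype ≫ l = affineToricMap k g ≫ affineToricMap k S.subtype) :
    S.map g ≤ S' := by
  obtain ⟨ψ, rfl⟩ := exists_eq_specKMap l
  have h1 : (subAlg k S').comp ψ = (AddMonoidAlgebra.mapDomainAlgHom k k g).comp (subAlg k S) :=
    specKMap_injective ((specKMap_comp _ _).trans (h.trans (specKMap_comp _ _).symm))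
  rintro _ ⟨m, hm, rfl⟩
  have h2 := congr($h1 (.single ⟨m, hm⟩ 1))
  refine mem_of_coeff_ne_zero (f := ψ (.single ⟨m, hm⟩ 1)) (k := k) ?_
  change ((subAlg k S').comp ψ _).coeff _ ≠ 0
  rw [h2]
  simp

theorem exists_lift {U X Z : KScheme k} (i : U ⟶ X) [IsOpenImmersion i.left] (f : Z ⟶ X)
    (h : ∀ z, f.left z ∈ i.left.opensRange) : ∃ l : Z ⟶ U, l ≫ i = f := by
  have hr : Set.range f.left ⊆ Set.range i.left := by
    rintro _ ⟨z, rfl⟩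
    exact h z
  refine ⟨Over.homMk (IsOpenImmersion.lift i.left f.left hr) ?_, ?_⟩
  · rw [← Over.w i, IsOpenImmersion.lift_fac_assoc, Over.w]
  · ext1
    exact IsOpenImmersion.lift_fac _ _ _

/-- Identifies the restriction to the tori of a morphism between charts: it can be checked after the
monomorphism `c` and before the epimorphism `e'`. -/
theorem comp_eq_of_comm {C : Type*} [Category* C] {T' T D' D A' A X' X : C} {e' : T' ⟶ D'} (he : Epi e')
    {p' : D' ⟶ A'} {l : A' ⟶ A} {c : A ⟶ X} [Mono c] {c' : A' ⟶ X'} {h : X' ⟶ X} {a : T' ⟶ T}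
    {e : T ⟶ D} {p : D ⟶ A} {d : D' ⟶ D} {j' : T' ⟶ X'} {j : T ⟶ X} (h1 : e' ≫ p' ≫ c' = j')
    (h2 : e ≫ p ≫ c = j) (h3 : j' ≫ h = a ≫ j) (h4 : a ≫ e = e' ≫ d) (h5 : l ≫ c = c' ≫ h) :
    p' ≫ l = d ≫ p := by
  rw [← cancel_mono c, ← cancel_epi e', Category.assoc, h5, Category.assoc, ← reassoc_of% h4, h2,
    ← h3, ← h1, Category.assoc, Category.assoc]

/-- Every morphism of toric varieties comes from a morphism of triples. -/
theorem exists_preimage {t' t : ToricTriple.{u}} {Y' Y : ToricVariety k} (R' : GluingData t' Y')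
    (R : GluingData t Y) (h : Y' ⟶ Y) :
    ∃ φ : t' ⟶ t, h.torusHom ≫ R.torusIso.hom =
      R'.torusIso.hom ≫ diagGroupMap k (dualMap φ.toLinearMap) := by
  obtain ⟨g, hg⟩ := exists_eq_diagGroupMap (R'.torusIso.inv ≫ h.torusHom ≫ R.torusIso.hom)
  obtain ⟨φ, rfl⟩ := exists_dualMap_eq g
  rw [Iso.inv_comp_eq] at hg
  refine ⟨⟨φ, fun σ' => ?_⟩, hg⟩
  -- The cone `σ` is found as one whose chart contains the image of the generic point of the closed
  -- orbit of `T^{Γ'_σ'}`.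
  have : (R'.chart σ' ≫ h.hom).left (orbitPoint k _) ∈ ⨆ σ, (R.chart σ).left.opensRange := by
    rw [R.cover]; trivial
  obtain ⟨σ, hσ⟩ := TopologicalSpace.Opens.mem_iSup.1 this
  have hr := range_le_of_orbitPoint_mem h (R'.isChart σ') (R.isChart σ).isInvariantOpen hσ
  obtain ⟨l, hl⟩ := exists_lift (R.chart σ) (R'.chart σ' ≫ h.hom) hr
  refine ⟨σ, map_le_of_comp_eq (l := l) ?_⟩
  have := (R.isOpenImmersion σ)
  have hm : Mono (R.chart σ) := (Over.forget _).mono_of_mono_map (f := R.chart σ)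
    (inferInstanceAs (Mono (R.chart σ).left))
  have he : Epi R'.torusIso.hom.hom.hom :=
    inferInstanceAs (Epi ((Grp.forget _).mapIso R'.torusIso).hom)
  exact comp_eq_of_comm he (R'.emb_eq σ') (R.emb_eq σ) h.emb_hom congr(($hg).hom.hom) hl

theorem diagGroupMap_id (M : Type u) [AddCommGroup M] :
    diagGroupMap k (AddMonoidHom.id M) = 𝟙 _ := by
  have h : AddMonoidAlgebra.mapDomainBialgHom k (AddMonoidHom.id M) = .id k _ :=
    AddMonoidAlgebra.mapDomainBialgHom_id
  exact (congrArg (fun x => (hopfSpec (CommRingCat.of k)).map (CommHopfAlgCat.ofHom x).op) h).trans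
    ((hopfSpec (CommRingCat.of k)).map_id _)

theorem diagGroupMap_comp {M₁ M₂ M₃ : Type u} [AddCommGroup M₁] [AddCommGroup M₂]
    [AddCommGroup M₃] (f : M₁ →+ M₂) (g : M₂ →+ M₃) :
    diagGroupMap k (g.comp f) = diagGroupMap k g ≫ diagGroupMap k f := by
  have h : AddMonoidAlgebra.mapDomainBialgHom k (g.comp f) =
      (AddMonoidAlgebra.mapDomainBialgHom k g).comp (AddMonoidAlgebra.mapDomainBialgHom k f) :=
    AddMonoidAlgebra.mapDomainBialgHom_comp g f
  have h' : CommHopfAlgCat.ofHom (AddMonoidAlgebra.mapDomainBialgHom k (g.comp f)) =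
      CommHopfAlgCat.ofHom (AddMonoidAlgebra.mapDomainBialgHom k f) ≫
        CommHopfAlgCat.ofHom (AddMonoidAlgebra.mapDomainBialgHom k g) := by
    rw [h]; rfl
  rw [diagGroupMap, h', op_comp, Functor.map_comp]

end Morphisms

/-! ### The combinatorics of a triple -/

namespace ToricTriple

variable (t : ToricTriple.{u})

/-- A rational cone is determined by its dual, and the dual of `σ` is generated by `Γ_σ`. -/
theorem coneOf_Γ (σ : t.fan.cones) : coneOf (t.Γ σ : Set (DualLattice t.N)) = σ.1 :=
  ((t.fan.rational σ σ.2).eq_coneOf (t.hull_eq_dualCone σ)).symm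

variable {t}

theorem isFaceOf_of_le {σ τ : t.fan.cones} (h : σ ≤ τ) : σ.1.IsFaceOf τ.1 := by
  have := (t.fan.inter_isFace σ σ.2 τ τ.2).2
  rwa [inf_eq_left.2 (show σ.1 ≤ τ.1 from h)] at this

theorem isFaceSubset_perp_Γ {σ τ : t.fan.cones} (h : σ ≤ τ) :
    IsFaceSubset (perp σ.1 (t.Γ τ)) (t.Γ τ) :=
  isFaceSubset_perp (by rw [t.coneOf_Γ]; exact h)

theorem Γ_eq_invert {σ τ : t.fan.cones} (h : σ ≤ τ) :
    t.Γ σ = invert (t.Γ τ) (perp σ.1 (t.Γ τ)) :=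
  t.face_eq τ σ (isFaceOf_of_le h)

theorem Γ_anti {σ τ : t.fan.cones} (h : σ ≤ τ) : t.Γ τ ≤ t.Γ σ :=
  Γ_eq_invert h ▸ le_invert _ _

theorem exists_Γ_eq_locAt {σ τ : t.fan.cones} (h : σ ≤ τ) :
    ∃ a ∈ t.Γ τ, t.Γ σ = locAt (t.Γ τ) a := by
  obtain ⟨a, ha, h'⟩ := (isFaceSubset_perp_Γ h).exists_invert_eq_locAt (t.fg τ)
  exact ⟨a, ha.1, (Γ_eq_invert h).trans h'⟩

/-- The intersection of two cones of the fan. -/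
def inter (σ σ' : t.fan.cones) : t.fan.cones :=
  ⟨σ.1 ⊓ σ'.1, t.fan.face_mem σ σ.2 _ (t.fan.inter_isFace σ σ.2 σ' σ'.2).1⟩

theorem inter_le_left (σ σ' : t.fan.cones) : inter σ σ' ≤ σ := (inf_le_left : σ.1 ⊓ σ'.1 ≤ σ.1)

theorem inter_le_right (σ σ' : t.fan.cones) : inter σ σ' ≤ σ' :=
  (inf_le_right : σ.1 ⊓ σ'.1 ≤ σ'.1)

theorem le_inter {ρ σ σ' : t.fan.cones} (h : ρ ≤ σ) (h' : ρ ≤ σ') : ρ ≤ inter σ σ' :=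
  (le_inf h h' : ρ.1 ≤ σ.1 ⊓ σ'.1)

/-- The semigroup of an intersection of cones is the sum of the semigroups. -/
theorem Γ_inter (σ σ' : t.fan.cones) : t.Γ (inter σ σ') = t.Γ σ ⊔ t.Γ σ' := by
  refine le_antisymm ?_ (sup_le (Γ_anti (inter_le_left _ _)) (Γ_anti (inter_le_right _ _)))
  have h := Γ_eq_invert (inter_le_left σ σ')
  rw [h]
  -- The left side is a localization of `Γ_σ`, and the finitely generated sum has the same cone `σ ∩
  -- σ'`; the elements to be inverted vanish on it, so they are invertible in the sum already.
  refine invert_le_of_coneOf_le (fun _ hm => hm.1) ?_ le_sup_left ?_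
  · exact (t.fg σ).sup (t.fg σ')
  · rw [← h, coneOf_sup, t.coneOf_Γ, t.coneOf_Γ, t.coneOf_Γ]
    exact le_rfl

/-- If the chart of `τ` is the locus `χ^b ≠ 0` in the chart of `ρ`, then the chart of `σ ∩ τ` is the
same locus in the chart of `σ`. This controls overlaps in the gluing. -/
theorem Γ_inter_eq_locAt {ρ σ τ : t.fan.cones} (hσ : σ ≤ ρ) {b : DualLattice t.N}
    (hτ : t.Γ τ = locAt (t.Γ ρ) b) :
    t.Γ (inter σ τ) = locAt (t.Γ σ) b := by
  rw [Γ_inter]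
  refine le_antisymm (sup_le (le_locAt _ _) ?_) ?_
  · rw [hτ]
    rintro x ⟨n, hn⟩
    exact ⟨n, Γ_anti hσ hn⟩
  · rintro x ⟨n, hn⟩
    have hnb : -b ∈ t.Γ τ := by
      rw [hτ]; exact ⟨1, by simp⟩
    have := add_mem (SetLike.le_def.1 (le_sup_left : t.Γ σ ≤ t.Γ σ ⊔ t.Γ τ) hn)
      (nsmul_mem (SetLike.le_def.1 (le_sup_right : t.Γ τ ≤ t.Γ σ ⊔ t.Γ τ) hnb) n)
    simpa using this

/-- Strict convexity makes the zero cone a face; every character vanishes on it, so its semigroup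
contains the group spanned by `Γ_σ`, which is `M`. -/
theorem exists_Γ_eq_top : ∃ σ₀ : t.fan.cones, t.Γ σ₀ = ⊤ := by
  obtain ⟨σ, hσ⟩ := t.fan.nonempty
  have hface : (⊥ : PointedCone ℝ (RealSpace t.N)).IsFaceOf σ := by
    refine ⟨bot_le, ?_⟩
    intro x y a hx hy ha hxy
    by_contra hne
    have hx0 : a • x ≠ 0 := smul_ne_zero ha.ne' hne
    refine t.fan.strictlyConvex σ hσ (a • x) (σ.smul_mem ha.le hx) hx0 ?_
    rw [neg_eq_of_add_eq_zero_right hxy]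
    exact hy
  refine ⟨⟨⊥, t.fan.face_mem σ hσ ⊥ hface⟩, top_le_iff.1 ?_⟩
  rw [t.face_eq ⟨σ, hσ⟩ ⟨⊥, t.fan.face_mem σ hσ ⊥ hface⟩ hface]
  refine le_trans ?_ le_sup_right
  intro x _
  change x ∈ AddSubgroup.closure _
  have h : {m | m ∈ t.Γ ⟨σ, hσ⟩ ∧ ∀ v ∈ (⊥ : PointedCone ℝ (RealSpace t.N)), realChar m v = 0} =
      (t.Γ ⟨σ, hσ⟩ : Set (DualLattice t.N)) := by
    ext m
    simp
  rw [h, t.closure_eq_top]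
  trivial

end ToricTriple

/-! ### Inclusions of semigroups: open immersions and closed graphs. -/

section Charts

variable {k : Type u} [Field k] {M : Type u} [AddCommGroup M]

theorem isOpenImmersion_inclusion_of_eq_locAt {S S' : AddSubmonoid M} {a : M} (ha : a ∈ S)
    (h : S' = locAt S a) (hle : S ≤ S') :
    IsOpenImmersion (affineToricMap k (AddSubmonoid.inclusion hle)).left := by
  subst h
  exact isOpenImmersion_locAt S ha

theorem mem_range_inclusion_iff {S S' : AddSubmonoid M} {a : M} (ha : a ∈ S)
    (h : S' = locAt S a) (hle : S ≤ S') (x : PrimeSpectrum (AddMonoidAlgebra k S)) :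
    x ∈ Set.range (affineToricMap k (AddSubmonoid.inclusion hle)).left ↔
      AddMonoidAlgebra.single (⟨a, ha⟩ : S) (1 : k) ∉ x.asIdeal := by
  subst h
  let := (inclAlg k (le_locAt S a)).toRingHom.toAlgebra
  have := isLocalizationAway_locAt (k := k) S ha
  have h1 := PrimeSpectrum.localization_away_comap_range (AddMonoidAlgebra k (locAt S a))
    (AddMonoidAlgebra.single (⟨a, ha⟩ : S) (1 : k))
  exact Set.ext_iff.1 h1 x

theorem inclusion_comp_inclusion {S₁ S₂ S₃ : AddSubmonoid M} (h₁ : S₁ ≤ S₂) (h₂ : S₂ ≤ S₃) :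
    affineToricMap k (AddSubmonoid.inclusion h₂) ≫ affineToricMap k (AddSubmonoid.inclusion h₁) =
      affineToricMap k (AddSubmonoid.inclusion (h₁.trans h₂)) := by
  refine (specKMap_comp _ _).symm.trans (congrArg specKMap ?_)
  ext
  simp
  rfl

theorem inclusion_refl (S : AddSubmonoid M) :
    affineToricMap k (AddSubmonoid.inclusion (le_refl S)) = 𝟙 _ := by
  have h : AddMonoidAlgebra.mapDomainAlgHom k k (AddSubmonoid.inclusion (le_refl S)) =
      AlgHom.id k _ := by
    ext; simp; rfl
  exact (congrArg specKMap h).trans ((algSpec (CommRingCat.of k)).map_id _)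

theorem subtype_comp_inclusion {S S' : AddSubmonoid M} (h : S ≤ S') :
    affineToricMap k S'.subtype ≫ affineToricMap k (AddSubmonoid.inclusion h) =
      affineToricMap k S.subtype :=
  (specKMap_comp _ _).symm.trans (congrArg specKMap (subAlg_comp_inclAlg h))

theorem isIso_subtype {S : AddSubmonoid M} (h : S = ⊤) : IsIso (affineToricMap k S.subtype) := by
  subst h
  have h1 : (subAlg k (⊤ : AddSubmonoid M)).comp (AddMonoidAlgebra.mapDomainAlgHom k k
      AddSubmonoid.topEquiv.symm.toAddMonoidHom) = .id k _ := by
    ext; simp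
  have h2 : (AddMonoidAlgebra.mapDomainAlgHom k k
      AddSubmonoid.topEquiv.symm.toAddMonoidHom).comp (subAlg k (⊤ : AddSubmonoid M)) = .id k _ := by
    ext; simp; rfl
  refine ⟨⟨specKMap (AddMonoidAlgebra.mapDomainAlgHom k k
    AddSubmonoid.topEquiv.symm.toAddMonoidHom), ?_, ?_⟩⟩
  · exact (specKMap_comp _ _).symm.trans ((congrArg specKMap h1).trans
      ((algSpec (CommRingCat.of k)).map_id _))
  · exact (specKMap_comp _ _).symm.trans ((congrArg specKMap h2).trans
      ((algSpec (CommRingCat.of k)).map_id _))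

/-- The multiplication map of two semigroup algebras. -/
def mulAlg (k : Type u) [Field k] {S S' T : AddSubmonoid M} (h : S ≤ T) (h' : S' ≤ T) :
    AddMonoidAlgebra k S ⊗[k] AddMonoidAlgebra k S' →ₐ[k] AddMonoidAlgebra k T :=
  Algebra.TensorProduct.lift (inclAlg k h) (inclAlg k h') fun _ _ => Commute.all _ _

/-- A character of the sum is a product `χ^a χ^b` with `a ∈ S` and `b ∈ S'`. -/
theorem mulAlg_surjective {S S' T : AddSubmonoid M} (hT : T = S ⊔ S') (h : S ≤ T)
    (h' : S' ≤ T) : Function.Surjective (mulAlg k h h') := by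
  intro f
  induction f using AddMonoidAlgebra.induction_linear with
  | zero => exact ⟨0, map_zero _⟩
  | add f g hf hg =>
    obtain ⟨x, rfl⟩ := hf
    obtain ⟨y, rfl⟩ := hg
    exact ⟨x + y, map_add _ _ _⟩
  | single m r =>
    obtain ⟨m, hm⟩ := m
    obtain ⟨a, ha, b, hb, rfl⟩ := AddSubmonoid.mem_sup.1 (hT ▸ hm)
    refine ⟨.single ⟨a, ha⟩ r ⊗ₜ .single ⟨b, hb⟩ 1, ?_⟩
    simp only [mulAlg, Algebra.TensorProduct.lift_tmul, inclAlg_single,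
      AddMonoidAlgebra.single_mul_single, _root_.mul_one]
    rfl

theorem isClosedImmersion_lift_inclusion_iff {S S' T : AddSubmonoid M} (h : S ≤ T) (h' : S' ≤ T) :
    IsClosedImmersion (lift (affineToricMap k (AddSubmonoid.inclusion h))
      (affineToricMap k (AddSubmonoid.inclusion h'))).left ↔
      IsClosedImmersion (specKMap (mulAlg k h h')).left := by
  have h1 : (mulAlg k h h').comp Algebra.TensorProduct.includeLeft = inclAlg k h :=
    Algebra.TensorProduct.lift_comp_includeLeft _ _ _
  have h2 : (mulAlg k h h').comp Algebra.TensorProduct.includeRight = inclAlg k h' :=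
    Algebra.TensorProduct.lift_comp_includeRight' _ _ _
  have hl : lift (specKMap (inclAlg k h)) (specKMap (inclAlg k h')) =
      specKMap (mulAlg k h h') ≫ (specKProd _ _).inv := by
    apply CartesianMonoidalCategory.hom_ext
    · rw [lift_fst, Category.assoc, specKProd_inv_fst, ← specKMap_comp, h1]
    · rw [lift_snd, Category.assoc, specKProd_inv_snd, ← specKMap_comp, h2]
  have h4 : IsIso ((specKProd (k := k) (AddMonoidAlgebra k S) (AddMonoidAlgebra k S')).inv).left :=
    inferInstanceAs (IsIso ((Over.forget _).map (specKProd _ _).inv))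
  have h5 : IsClosedImmersion (specKMap (mulAlg k h h') ≫ (specKProd _ _).inv).left ↔ _ :=
    MorphismProperty.cancel_right_of_respectsIso @IsClosedImmersion _ _
  rwa [← hl] at h5

/-- The graph of the intersection of two affine toric varieties with the same torus is closed. -/
theorem isClosedImmersion_lift_inclusion {S S' T : AddSubmonoid M} (hT : T = S ⊔ S') (h : S ≤ T)
    (h' : S' ≤ T) : IsClosedImmersion (lift (affineToricMap k (AddSubmonoid.inclusion h))
      (affineToricMap k (AddSubmonoid.inclusion h'))).left :=
  (isClosedImmersion_lift_inclusion_iff h h').2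
    (IsClosedImmersion.spec_of_surjective _ (mulAlg_surjective hT h h'))

theorem surjective_of_isClosedImmersion {A B : Type u} [CommRing A] [Algebra k A] [CommRing B]
    [Algebra k B] {f : A →ₐ[k] B} (h : IsClosedImmersion (specKMap f).left) :
    Function.Surjective f := by
  let φ : CommRingCat.of A ⟶ CommRingCat.of B := CommRingCat.ofHom f.toRingHom
  have : IsClosedImmersion (Spec.map φ) := h
  have h1 := (IsClosedImmersion.isAffine_surjective_of_isAffine (Spec.map φ)).2
  have h2 := Scheme.ΓSpecIso_naturality φ
  intro b
  obtain ⟨a, ha⟩ := h1 ((Scheme.ΓSpecIso (.of B)).inv b)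
  refine ⟨(Scheme.ΓSpecIso (.of A)).hom a, ?_⟩
  change φ ((Scheme.ΓSpecIso (.of A)).hom a) = b
  rw [← CommRingCat.comp_apply, ← h2, CommRingCat.comp_apply, ha]
  exact congr(($((Scheme.ΓSpecIso (.of B)).inv_hom_id)).hom b)

/-- A closed graph makes `k[S] ⊗ k[S'] → k[T]` surjective, while the image of this map in `k[M]`
lies in `k[S + S']`. -/
theorem le_sup_of_isClosedImmersion {S S' T : AddSubmonoid M} (h : S ≤ T) (h' : S' ≤ T)
    (hcl : IsClosedImmersion (lift (affineToricMap k (AddSubmonoid.inclusion h))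
      (affineToricMap k (AddSubmonoid.inclusion h'))).left) : T ≤ S ⊔ S' := by
  have hsurj := surjective_of_isClosedImmersion ((isClosedImmersion_lift_inclusion_iff h h').1 hcl)
  have hle : ∀ {S₁ : AddSubmonoid M} (h₁ : S₁ ≤ S ⊔ S') (hT : S₁ ≤ T) (f : AddMonoidAlgebra k S₁),
      subAlg k T (inclAlg k hT f) ∈ (subAlg k (S ⊔ S')).range := fun h₁ hT f =>
    ⟨inclAlg k h₁ f, (congr($(subAlg_comp_inclAlg (k := k) h₁) f)).trans
      (congr($(subAlg_comp_inclAlg (k := k) hT) f)).symm⟩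
  have hr : ∀ z, subAlg k T (mulAlg k h h' z) ∈ (subAlg k (S ⊔ S')).range := fun z => by
    induction z using TensorProduct.induction_on with
    | zero => rw [map_zero, map_zero]; exact zero_mem _
    | add x y hx hy => rw [map_add, map_add]; exact add_mem hx hy
    | tmul f g =>
      rw [mulAlg, Algebra.TensorProduct.lift_tmul, map_mul]
      exact mul_mem (hle le_sup_left h f) (hle le_sup_right h' g)
  intro m hm
  obtain ⟨z, hz⟩ := hsurj (.single ⟨m, hm⟩ 1)
  obtain ⟨f, hf⟩ := hr z
  rw [hz, subAlg_single] at hf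
  refine mem_of_coeff_ne_zero (f := f) (k := k) ?_
  rw [show subAlg k (S ⊔ S') f = _ from hf]
  simp

theorem isPullback_of_range {W U V X : Scheme.{u}} {a : W ⟶ U} {b : W ⟶ V} {f : U ⟶ X}
    {g : V ⟶ X} [IsOpenImmersion b] [IsOpenImmersion f] [IsOpenImmersion g] (h : a ≫ f = b ≫ g)
    (hr : Set.range f ∩ Set.range g ⊆ Set.range (b ≫ g)) : IsPullback a b f g := by
  refine IsOpenImmersion.isPullback _ _ _ _ h.symm (le_antisymm (fun x hx => ?_) ?_)
  · obtain ⟨z, hz⟩ := hr ⟨hx, x, rfl⟩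
    exact ⟨z, g.isOpenEmbedding.injective (by rw [← hz]; exact (Scheme.Hom.comp_apply _ _ _).symm)⟩
  · rintro _ ⟨z, rfl⟩
    exact ⟨a z, by rw [← Scheme.Hom.comp_apply, h, Scheme.Hom.comp_apply]⟩

end Charts

/-! ### The toric variety of a triple -/

section Glue

open Limits

variable (k : Type u) [Field k] (t : ToricTriple.{u})

/-- The diagram of affine toric varieties of the cones of a fan. -/
def affineDiagram : t.fan.cones ⥤ KScheme k where
  obj σ := affineToric k (t.Γ σ)
  map f := affineToricMap k (AddSubmonoid.inclusion (ToricTriple.Γ_anti f.le))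
  map_id _ := inclusion_refl _
  map_comp _ _ := (inclusion_comp_inclusion _ _).symm

/-- The diagram of affine toric varieties as a diagram of schemes. -/
abbrev affineDiagramScheme : t.fan.cones ⥤ Scheme.{u} := affineDiagram k t ⋙ Over.forget _

instance isOpenImmersion_affineDiagram {σ τ : t.fan.cones} (f : σ ⟶ τ) :
    IsOpenImmersion ((affineDiagramScheme k t).map f) := by
  obtain ⟨a, ha, h⟩ := ToricTriple.exists_Γ_eq_locAt f.le
  exact isOpenImmersion_inclusion_of_eq_locAt ha h _

/-- Points of the charts of `σ` and `τ` with the same image in the chart of `ρ` come from the chart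
of `σ ∩ τ`: the character `b` that cuts out `τ` is nonzero at the point `x` as well. -/
instance isLocallyDirected_affineDiagram :
    (affineDiagramScheme k t ⋙ Scheme.forget).IsLocallyDirected where
  cond {σ τ ρ} f g x y h := by
    change (affineDiagramScheme k t).map f x = (affineDiagramScheme k t).map g y at h
    obtain ⟨b, hb, hτ⟩ := ToricTriple.exists_Γ_eq_locAt g.le
    have hσ := ToricTriple.Γ_inter_eq_locAt f.le hτ
    have hx : x ∈ Set.range ((affineDiagramScheme k t).map
        (homOfLE (ToricTriple.inter_le_left σ τ))) := by
      refine (mem_range_inclusion_iff (ToricTriple.Γ_anti f.le hb) hσ _ x).2 fun hmem => ?_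
      have h1 := (mem_range_inclusion_iff (k := k) hb hτ (ToricTriple.Γ_anti g.le) _).1 ⟨y, h.symm⟩
      refine h1 ?_
      change inclAlg k _ _ ∈ x.asIdeal
      rw [inclAlg_single]
      exact hmem
    obtain ⟨z, hz⟩ := hx
    let i := homOfLE (ToricTriple.inter_le_left σ τ)
    let j := homOfLE (ToricTriple.inter_le_right σ τ)
    refine ⟨_, i, j, z, hz, ((affineDiagramScheme k t).map g).isOpenEmbedding.injective ?_⟩
    refine Eq.trans ?_ h
    rw [← hz]
    change ((affineDiagramScheme k t).map g) ((affineDiagramScheme k t).map j z) =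
      ((affineDiagramScheme k t).map f) ((affineDiagramScheme k t).map i z)
    rw [← Scheme.Hom.comp_apply, ← Scheme.Hom.comp_apply, ← Functor.map_comp, ← Functor.map_comp]
    rfl

/-- The underlying scheme of the toric variety of a triple. -/
def gluedOver : KScheme k :=
  Over.mk (colimit.desc (affineDiagramScheme k t)
    ⟨_, { app := fun σ => (affineToric k (t.Γ σ)).hom
          naturality := fun _ _ f => (Over.w ((affineDiagram k t).map f)).trans
            (Category.comp_id _).symm }⟩)

/-- The affine charts of the toric variety of a triple. -/
def gluedChart (σ : t.fan.cones) : affineToric k (t.Γ σ) ⟶ gluedOver k t :=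
  Over.homMk (colimit.ι (affineDiagramScheme k t) σ) (colimit.ι_desc _ _)

instance isOpenImmersion_gluedChart (σ : t.fan.cones) : IsOpenImmersion (gluedChart k t σ).left :=
  inferInstanceAs (IsOpenImmersion (colimit.ι (affineDiagramScheme k t) σ))

variable {t}

theorem inclusion_comp_gluedChart {σ τ : t.fan.cones} (h : σ ≤ τ) :
    affineToricMap k (AddSubmonoid.inclusion (ToricTriple.Γ_anti h)) ≫ gluedChart k t τ =
      gluedChart k t σ := by
  ext1
  exact colimit.w (affineDiagramScheme k t) (homOfLE h)

theorem subtype_comp_gluedChart (σ τ : t.fan.cones) :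
    affineToricMap k (t.Γ σ).subtype ≫ gluedChart k t σ =
      affineToricMap k (t.Γ τ).subtype ≫ gluedChart k t τ := by
  rw [← subtype_comp_inclusion (ToricTriple.Γ_anti (ToricTriple.inter_le_left σ τ)),
    ← subtype_comp_inclusion (ToricTriple.Γ_anti (ToricTriple.inter_le_right σ τ)), Category.assoc,
    Category.assoc, inclusion_comp_gluedChart k (ToricTriple.inter_le_left σ τ),
    inclusion_comp_gluedChart k (ToricTriple.inter_le_right σ τ)]

theorem iSup_opensRange_gluedChart : ⨆ σ, (gluedChart k t σ).left.opensRange = ⊤ := by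
  refine top_le_iff.1 fun x _ => ?_
  obtain ⟨σ, y, hy⟩ := Scheme.IsLocallyDirected.ι_jointly_surjective (affineDiagramScheme k t) x
  exact TopologicalSpace.Opens.mem_iSup.2 ⟨σ, y, hy⟩

theorem opensRange_gluedChart_le {σ τ : t.fan.cones} (h : σ ≤ τ) :
    (gluedChart k t σ).left.opensRange ≤ (gluedChart k t τ).left.opensRange := by
  rintro _ ⟨x, rfl⟩
  rw [← inclusion_comp_gluedChart k h]
  exact ⟨_, (Scheme.Hom.comp_apply _ _ _).symm⟩

/-- Two points are identified in the colimit only through a common cone `ρ ≤ σ, τ`, and such a `ρ`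
lies in `σ ∩ τ`. -/
theorem opensRange_gluedChart_inf (σ τ : t.fan.cones) :
    (gluedChart k t σ).left.opensRange ⊓ (gluedChart k t τ).left.opensRange =
      (gluedChart k t (ToricTriple.inter σ τ)).left.opensRange := by
  refine le_antisymm ?_ (le_inf (opensRange_gluedChart_le k (ToricTriple.inter_le_left σ τ))
    (opensRange_gluedChart_le k (ToricTriple.inter_le_right σ τ)))
  rintro _ ⟨⟨x, rfl⟩, ⟨y, hy⟩⟩
  obtain ⟨ρ, f, g, z, rfl, -⟩ :=
    (Scheme.IsLocallyDirected.ι_eq_ι_iff (affineDiagramScheme k t)).1 hy.symm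
  refine opensRange_gluedChart_le k (ToricTriple.le_inter f.le g.le) ⟨z, ?_⟩
  exact congr($(colimit.w (affineDiagramScheme k t) f) z).symm

variable (t) in
/-- The covering of the toric variety of a triple by its affine charts. -/
def gluedCover : (gluedOver k t).left.OpenCover :=
  Scheme.IsLocallyDirected.openCover (affineDiagramScheme k t)

instance locallyOfFiniteType_gluedOver : LocallyOfFiniteType (gluedOver k t).hom := by
  have := HasRingHomProperty.instIsZariskiLocalAtSource (P := @LocallyOfFiniteType.{u})
  refine IsZariskiLocalAtSource.of_openCover (P := @LocallyOfFiniteType.{u}) (gluedCover k t)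
    fun (σ : t.fan.cones) => ?_
  have h : LocallyOfFiniteType ((gluedChart k t σ).left ≫ (gluedOver k t).hom) := by
    rw [Over.w]
    exact locallyOfFiniteType_affineToric (t.fg σ)
  exact h

instance quasiCompact_gluedOver : QuasiCompact (gluedOver k t).hom := by
  have : Finite (gluedCover k t).I₀ := t.fan.finite
  have h : ∀ i, CompactSpace ((gluedCover k t).X i) := fun (σ : t.fan.cones) =>
    inferInstanceAs (CompactSpace (PrimeSpectrum (AddMonoidAlgebra k (t.Γ σ))))
  have : CompactSpace (gluedOver k t).left := (gluedCover k t).compactSpace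
  exact quasiCompact_of_compactSpace _

instance isReduced_gluedOver : IsReduced (gluedOver k t).left := by
  have h : ∀ i, IsReduced ((gluedCover k t).X i) := fun (σ : t.fan.cones) =>
    inferInstanceAs (IsReduced (affineToric k (t.Γ σ)).left)
  exact IsReduced.of_openCover (𝒰 := gluedCover k t)

/-- All charts receive the same irreducible torus with dense image, so the glued scheme is
irreducible; it is reduced chart by chart. -/
instance isIntegral_gluedOver : IsIntegral (gluedOver k t).left := by
  obtain ⟨σ₀, hσ₀⟩ := t.fan.nonempty
  let j := affineToricMap k (t.Γ ⟨σ₀, hσ₀⟩).subtype ≫ gluedChart k t ⟨σ₀, hσ₀⟩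
  have hj : DenseRange j.left := by
    refine fun x => mem_closure_iff.2 fun U hU hxU => ?_
    obtain ⟨σ, y, rfl⟩ := Scheme.IsLocallyDirected.ι_jointly_surjective (affineDiagramScheme k t) x
    have h1 : IsDominant (affineToricMap k (t.Γ σ).subtype).left :=
      isDominant_specKMap (subAlg_injective _)
    obtain ⟨z, hz⟩ := h1.denseRange.exists_mem_open
      (hU.preimage (gluedChart k t σ).left.continuous) ⟨y, hxU⟩
    refine ⟨j.left z, ?_, ⟨z, rfl⟩⟩
    have h2 : j = affineToricMap k (t.Γ σ).subtype ≫ gluedChart k t σ :=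
      subtype_comp_gluedChart k _ _
    rw [h2]
    exact hz
  have : IrreducibleSpace (gluedOver k t).left := by
    have h1 : IsIrreducible (Set.univ : Set (affineToric k (DualLattice t.N)).left) :=
      @IrreducibleSpace.isIrreducible_univ _ _
        (inferInstanceAs (IrreducibleSpace (PrimeSpectrum (AddMonoidAlgebra k (DualLattice t.N)))))
    have h2 := (h1.image j.left j.left.continuous.continuousOn).closure
    rw [Set.image_univ, hj.closure_range] at h2
    exact (irreducibleSpace_def _).2 h2
  exact isIntegral_of_irreducibleSpace_of_isReduced _

/-- The intersection `U ×_X V` is the preimage of the diagonal in `U × V`. This links separatedness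
with closed graphs of intersections, and is used in both directions. -/
theorem isPullback_diagonal {C : Type*} [Category* C] [CartesianMonoidalCategory C] {W U V X : C}
    {a : W ⟶ U} {b : W ⟶ V} {f : U ⟶ X} {g : V ⟶ X} (h : IsPullback a b f g) :
    IsPullback (a ≫ f) (lift a b) (lift (𝟙 X) (𝟙 X)) (f ⊗ₘ g) := by
  refine ⟨⟨?_⟩, ⟨PullbackCone.IsLimit.mk _ (fun s => h.lift (s.snd ≫ fst _ _) (s.snd ≫ snd _ _) ?_)
    (fun s => ?_) (fun s => ?_) fun s m h1 h2 => ?_⟩⟩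
  · apply CartesianMonoidalCategory.hom_ext
    · simp
    · simp [h.w]
  · have h1 := congr($s.condition ≫ fst _ _)
    have h2 := congr($s.condition ≫ snd _ _)
    simp only [Category.assoc, lift_fst, lift_snd, tensorHom_fst, tensorHom_snd] at h1 h2
    simp [← h1, ← h2]
  · have h1 := congr($s.condition ≫ fst _ _)
    simp only [Category.assoc, lift_fst, tensorHom_fst, Category.comp_id] at h1
    simp [h1]
  · apply CartesianMonoidalCategory.hom_ext <;> simp
  · apply h.hom_ext
    · simp [← h2]
    · simp [← h2]

theorem isPullback_gluedChart (σ τ : t.fan.cones) :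
    IsPullback (affineToricMap k (AddSubmonoid.inclusion
        (ToricTriple.Γ_anti (ToricTriple.inter_le_left σ τ)))).left
      (affineToricMap k (AddSubmonoid.inclusion
        (ToricTriple.Γ_anti (ToricTriple.inter_le_right σ τ)))).left
      (gluedChart k t σ).left (gluedChart k t τ).left := by
  have : IsOpenImmersion (affineToricMap k (AddSubmonoid.inclusion
      (ToricTriple.Γ_anti (ToricTriple.inter_le_right σ τ)))).left :=
    isOpenImmersion_affineDiagram k t (homOfLE (ToricTriple.inter_le_right σ τ))
  refine isPullback_of_range ?_ ?_
  · rw [← Over.comp_left, ← Over.comp_left,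
      inclusion_comp_gluedChart k (ToricTriple.inter_le_left σ τ),
      inclusion_comp_gluedChart k (ToricTriple.inter_le_right σ τ)]
  · rw [← Over.comp_left, inclusion_comp_gluedChart k (ToricTriple.inter_le_right σ τ)]
    exact fun x hx => (opensRange_gluedChart_inf k σ τ).le hx

variable {k} in
theorem isPullback_whiskerRight {X Y : KScheme k} (f : X ⟶ Y) (T : KScheme k) :
    IsPullback (f ▷ T).left (fst X T).left (fst Y T).left f.left := by
  have : IsPullback (f ▷ T) (fst X T) (fst Y T) f := by
    refine ⟨⟨by simp⟩, ⟨Limits.PullbackCone.IsLimit.mk _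
      (fun s => lift s.snd (s.fst ≫ snd _ _)) (fun s => ?_) (fun s => ?_) fun s m h1 h2 => ?_⟩⟩
    · apply CartesianMonoidalCategory.hom_ext
      · simp [s.condition]
      · simp
    · simp
    · apply CartesianMonoidalCategory.hom_ext
      · simpa using h2
      · simp [← h1]
  exact this.map (Over.forget _)

theorem exists_of_isPullback {P X Y Z : Scheme.{u}} {p : P ⟶ X} {q : P ⟶ Y} {f : X ⟶ Z}
    {g : Y ⟶ Z} (h : IsPullback p q f g) {x : X} {y : Y} (hxy : f x = g y) : ∃ z, p z = x := by
  obtain ⟨z, hz, -⟩ := Scheme.Pullback.exists_preimage_pullback x y hxy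
  refine ⟨h.isoPullback.inv z, ?_⟩
  rw [← Scheme.Hom.comp_apply, h.isoPullback_inv_fst, hz]

variable {k} in
theorem isOpenImmersion_tensorHom {U V X : KScheme k} (f : U ⟶ X) (g : V ⟶ X)
    [IsOpenImmersion f.left] [IsOpenImmersion g.left] : IsOpenImmersion (f ⊗ₘ g).left := by
  rw [MonoidalCategory.tensorHom_def, Over.comp_left]
  have : IsOpenImmersion (f ▷ V).left :=
    MorphismProperty.of_isPullback (isPullback_whiskerRight f V).flip ‹_›
  infer_instance

variable {k} in
/-- A scheme is separated if the intersections of the members of a covering are closed in the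
products of these members. -/
theorem isSeparated_of_cover {X : KScheme k} {I : Type*} {U : I → KScheme k} (c : ∀ i, U i ⟶ X)
    [∀ i, IsOpenImmersion (c i).left] (hc : ⨆ i, (c i).left.opensRange = ⊤)
    {W : I → I → KScheme k} (a : ∀ i j, W i j ⟶ U i) (b : ∀ i j, W i j ⟶ U j)
    (h : ∀ i j, IsPullback (a i j) (b i j) (c i) (c j))
    (hab : ∀ i j, IsClosedImmersion (lift (a i j) (b i j)).left) : IsSeparated X.hom := by
  have hsurj : ∀ x : X.left, ∃ i y, (c i).left y = x := fun x => by
    have : x ∈ ⨆ i, (c i).left.opensRange := hc ▸ trivial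
    obtain ⟨i, y, hy⟩ := TopologicalSpace.Opens.mem_iSup.1 this
    exact ⟨i, y, hy⟩
  have (ij : I × I) : IsOpenImmersion (c ij.1 ⊗ₘ c ij.2).left := isOpenImmersion_tensorHom _ _
  let 𝒰 : (X ⊗ X).left.OpenCover := Scheme.Cover.mkOfCovers (I × I) (fun ij => (U ij.1 ⊗ U ij.2).left)
    (fun ij => (c ij.1 ⊗ₘ c ij.2).left) fun x => by
      obtain ⟨i, y, hy⟩ := hsurj ((fst X X).left x)
      obtain ⟨j, z, hz⟩ := hsurj ((snd X X).left x)
      obtain ⟨x', rfl⟩ := exists_of_isPullback (isPullback_whiskerRight (c i) X) hy.symm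
      have h1 : (snd (U i) X).left x' = (c j).left z := by
        rw [hz, ← whiskerRight_snd (c i) X, Over.comp_left, Scheme.Hom.comp_apply]
      obtain ⟨w, rfl⟩ := exists_of_isPullback (isPullback_whiskerLeft (U i) (c j)) h1
      refine ⟨(i, j), w, ?_⟩
      rw [MonoidalCategory.tensorHom_def', Over.comp_left, Scheme.Hom.comp_apply]
  have hΔ : IsClosedImmersion (lift (𝟙 X) (𝟙 X)).left := by
    refine IsZariskiLocalAtTarget.of_openCover (P := @IsClosedImmersion) 𝒰 fun (ij : I × I) => ?_
    have h1 := (isPullback_diagonal (h ij.1 ij.2)).map (Over.forget _)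
    have h3 := (MorphismProperty.cancel_left_of_respectsIso @IsClosedImmersion
      h1.isoPullback.inv _).2 (hab ij.1 ij.2)
    exact (congrArg (fun f => IsClosedImmersion f) h1.isoPullback_inv_snd).mp h3
  exact ⟨hΔ⟩

instance isSeparated_gluedOver : IsSeparated (gluedOver k t).hom := by
  refine isSeparated_of_cover (gluedChart k t) (iSup_opensRange_gluedChart k) _ _ (fun σ τ => ?_)
    fun σ τ => isClosedImmersion_lift_inclusion (ToricTriple.Γ_inter σ τ)
      (ToricTriple.Γ_anti (ToricTriple.inter_le_left σ τ))
      (ToricTriple.Γ_anti (ToricTriple.inter_le_right σ τ))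
  exact IsPullback.of_map (Over.forget _) (by
    rw [inclusion_comp_gluedChart k (ToricTriple.inter_le_left σ τ),
      inclusion_comp_gluedChart k (ToricTriple.inter_le_right σ τ)]) (isPullback_gluedChart k σ τ)

theorem gluedChart_subtype_isOpenImmersion (σ : t.fan.cones) :
    IsOpenImmersion (affineToricMap k (t.Γ σ).subtype ≫ gluedChart k t σ).left := by
  obtain ⟨σ₀, h⟩ := t.exists_Γ_eq_top
  rw [subtype_comp_gluedChart k σ σ₀]
  have := isIso_subtype (k := k) h
  have h1 : IsIso (affineToricMap k (t.Γ σ₀).subtype).left :=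
    inferInstanceAs (IsIso ((Over.forget _).map (affineToricMap k (t.Γ σ₀).subtype)))
  exact (MorphismProperty.cancel_left_of_respectsIso @IsOpenImmersion
    (affineToricMap k (t.Γ σ₀).subtype).left _).2 (isOpenImmersion_gluedChart k t σ₀)

end Glue

/-! ### Torus actions obtained by extending the multiplication. -/

section Action

variable {k : Type u} [Field k] {T : Grp (KScheme k)} [GeometricallyIntegral T.X.hom]
  [LocallyOfFiniteType T.X.hom] {X : KScheme k} [IsIntegral X.left] [IsSeparated X.hom]
  [LocallyOfFiniteType X.hom] (j : T.X ⟶ X) [IsOpenImmersion j.left]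

/-- A morphism that extends the multiplication of the torus is an action. -/
abbrev modObjOfExtends (act : T.X ⊗ X ⟶ X) (h : (T.X ◁ j) ≫ act = MonObj.mul ≫ j) :
    ModObj T.X X where
  smul := act
  one_smul := by
    have : IsDominant j.left := isDominant_of_isOpenImmersion _
    have h1 : lift (toUnit X ≫ MonObj.one) (𝟙 X) ≫ act = 𝟙 X := by
      refine ext_of_dominant j ?_
      have h2 : j ≫ lift (toUnit X ≫ MonObj.one) (𝟙 X) =
          lift (toUnit T.X ≫ MonObj.one) (𝟙 T.X) ≫ (T.X ◁ j) := by
        apply CartesianMonoidalCategory.hom_ext <;> simp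
      rw [← Category.assoc, h2, Category.assoc, h, MonObj.lift_comp_one_left_assoc]
      simp
    have h3 : ((MonObj.one : 𝟙_ (KScheme k) ⟶ T.X) ▷ X) = (λ_ X).hom ≫ lift (toUnit X ≫ MonObj.one) (𝟙 X) := by
      apply CartesianMonoidalCategory.hom_ext
      · simp [toUnit_unique (fst (𝟙_ (KScheme k)) X) (snd (𝟙_ (KScheme k)) X ≫ toUnit X)]
      · simp [leftUnitor_hom]
    change ((MonObj.one : 𝟙_ (KScheme k) ⟶ T.X) ▷ X) ≫ act = _
    rw [h3, Category.assoc, h1, Category.comp_id]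
    rfl
  mul_smul := by
    have : LocallyOfFiniteType (T.X ⊗ X).hom := by
      rw [← Over.w (snd T.X X)]
      have : LocallyOfFiniteType (snd T.X X).left :=
        inferInstanceAs (LocallyOfFiniteType (Limits.pullback.snd T.X.hom X.hom))
      infer_instance
    have h1 : IsIntegral (T.X ⊗ X).left := isIntegral_tensorObj _ _
    have h2 : IsIntegral (T.X ⊗ T.X ⊗ X).left := isIntegral_tensorObj _ _
    have : Nonempty ((T.X ⊗ T.X) ⊗ T.X).left :=
      Nonempty.map (lift (lift (𝟙 T.X) (𝟙 T.X)) (𝟙 T.X)).left inferInstance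
    have : Nonempty ((T.X ⊗ T.X) ⊗ X).left := Nonempty.map ((T.X ⊗ T.X) ◁ j).left inferInstance
    have h3 : IsIntegral ((T.X ⊗ T.X) ⊗ X).left := by
      have : IsIso (α_ T.X T.X X).hom.left :=
        inferInstanceAs (IsIso ((Over.forget _).map (α_ T.X T.X X).hom))
      exact isIntegral_of_isOpenImmersion (α_ T.X T.X X).hom.left
    have : IsDominant ((T.X ⊗ T.X) ◁ j).left := isDominant_of_isOpenImmersion _
    change (MonObj.mul ▷ X) ≫ act = (α_ T.X T.X X).hom ≫ (T.X ◁ act) ≫ act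
    -- On the dense open subscheme `T × T × T` the identity is associativity of the multiplication.
    refine ext_of_dominant ((T.X ⊗ T.X) ◁ j) ?_
    have h4 : ((T.X ⊗ T.X) ◁ j) ≫ (MonObj.mul ▷ X) ≫ act =
        (MonObj.mul ▷ T.X) ≫ MonObj.mul ≫ j := by
      rw [whisker_exchange_assoc, h]
    have h5 : ((T.X ⊗ T.X) ◁ j) ≫ (α_ T.X T.X X).hom ≫ (T.X ◁ act) ≫ act =
        (α_ T.X T.X T.X).hom ≫ (T.X ◁ MonObj.mul) ≫ MonObj.mul ≫ j := by
      rw [tensor_whiskerLeft, Category.assoc, Category.assoc, Iso.inv_hom_id_assoc,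
        ← whiskerLeft_comp_assoc, h, whiskerLeft_comp_assoc, h]
    rw [h4, h5, MonObj.mul_assoc_assoc]

end Action

/-- The isomorphism of group schemes induced by an isomorphism of groups. -/
def diagGroupIso (k : Type u) [Field k] {A B : Type u} [AddCommGroup A] [AddCommGroup B]
    (f : A ≃+ B) : diagGroup k A ≅ diagGroup k B where
  hom := diagGroupMap k f.symm.toAddMonoidHom
  inv := diagGroupMap k f.toAddMonoidHom
  hom_inv_id := by
    rw [← diagGroupMap_comp, ← diagGroupMap_id]
    congr 1
    ext; simp
  inv_hom_id := by
    rw [← diagGroupMap_comp, ← diagGroupMap_id]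
    congr 1
    ext; simp

theorem isTorus_diagGroup (k : Type u) [Field k] (M : Type u) [AddCommGroup M] [Module.Free ℤ M]
    [Module.Finite ℤ M] : IsTorus k (diagGroup k M) :=
  ⟨_, ⟨diagGroupIso k ((Module.finBasis ℤ M).reindex Equiv.ulift.symm).equivFun.toAddEquiv⟩⟩

/-- The coactions on the charts all restrict to the multiplication of the torus; density makes them
glue and yields the axioms of an action. -/
theorem exists_gluingData (k : Type u) [Field k] (t : ToricTriple.{u}) :
    ∃ Y : ToricVariety k, Nonempty (GluingData t Y) := by
  let T := diagGroup k (DualLattice t.N)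
  obtain ⟨σ₀, hσ₀⟩ := t.fan.nonempty
  let s : ∀ σ, T.X ⟶ affineToric k (t.Γ σ) := fun σ => affineToricMap k (t.Γ σ).subtype
  let j : T.X ⟶ gluedOver k t := s ⟨σ₀, hσ₀⟩ ≫ gluedChart k t ⟨σ₀, hσ₀⟩
  have hj (σ) : s σ ≫ gluedChart k t σ = j := subtype_comp_gluedChart k _ _
  have : IsOpenImmersion j.left := gluedChart_subtype_isOpenImmersion k _
  have : IsIntegral (T.X ⊗ gluedOver k t).left := isIntegral_tensorObj _ _
  have : Nonempty (T.X ⊗ T.X).left := Nonempty.map (lift (𝟙 T.X) (𝟙 T.X)).left inferInstance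
  obtain ⟨act, hact⟩ := exists_extension (T.X ◁ j) ((MonObj.mul : T.X ⊗ T.X ⟶ T.X) ≫ j)
    (fun σ => T.X ◁ gluedChart k t σ) (by
      simp_rw [opensRange_whiskerLeft]
      rw [← Scheme.Hom.preimage_iSup, iSup_opensRange_gluedChart]
      rfl)
    (fun σ => T.X ◁ s σ) (fun σ => by rw [← whiskerLeft_comp, hj])
    (fun σ => affineAct (t.Γ σ) ≫ gluedChart k t σ) (fun σ => by
      rw [← hj σ]
      exact (Category.assoc _ _ _).symm.trans
        ((congrArg (· ≫ gluedChart k t σ) (whiskerLeft_affineAct (t.Γ σ))).trans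
          (Category.assoc _ _ _)))
  have hmul : (T.X ◁ j) ≫ act = MonObj.mul ≫ j := by
    rw [← hj ⟨σ₀, hσ₀⟩, whiskerLeft_comp, Category.assoc, hact]
    exact (Category.assoc _ _ _).symm.trans
        ((congrArg (· ≫ gluedChart k t ⟨σ₀, hσ₀⟩) (whiskerLeft_affineAct (t.Γ ⟨σ₀, hσ₀⟩))).trans
          (Category.assoc _ _ _))
  let := modObjOfExtends j act hmul
  have haff (σ) : IsAffineOpen (gluedChart k t σ).left.opensRange := by
    have : IsAffine (affineToric k (t.Γ σ)).left :=
      inferInstanceAs (IsAffine (Spec (.of (AddMonoidAlgebra k (t.Γ σ)))))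
    exact isAffineOpen_opensRange _
  have hinv (σ) : IsInvariantOpen T (gluedOver k t) (gluedChart k t σ).left.opensRange := by
    intro z hz
    rw [← opensRange_whiskerLeft] at hz
    obtain ⟨w, rfl⟩ := hz
    refine ⟨(affineAct (t.Γ σ)).left w, ?_⟩
    rw [← Scheme.Hom.comp_apply, ← Scheme.Hom.comp_apply, ← Over.comp_left, ← Over.comp_left]
    exact congr(($(hact σ)).left w).symm
  refine ⟨{ X := gluedOver k t
            T := T
            isTorus := isTorus_diagGroup k _
            emb := j
            mul_emb := hmul.symm
            exists_cover := ⟨Set.range fun σ => (gluedChart k t σ).left.opensRange,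
              have : Finite t.fan.cones := t.fan.finite
              Set.finite_range _, by rintro _ ⟨σ, rfl⟩; exact ⟨haff σ, hinv σ⟩,
              iSup_opensRange_gluedChart k⟩ }, ⟨?_⟩⟩
  exact
    { torusIso := Iso.refl _
      chart := gluedChart k t
      emb_eq := fun σ => (Category.id_comp _).trans (hj σ)
      chart_face := fun σ τ _ hστ => inclusion_comp_gluedChart k (σ := τ) (τ := σ) hστ.le
      cover := iSup_opensRange_gluedChart k
      inter := fun σ σ' τ h => by
        rw [opensRange_gluedChart_inf, show ToricTriple.inter σ σ' = τ from Subtype.ext h.symm] }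

/-! ### Invariant affine open subschemes -/

section Coaction

variable {k : Type u} [Field k] {M : Type u} [AddCommGroup M]

/-- The projection of the group algebra to the line spanned by a character. -/
def charProj (m : M) : AddMonoidAlgebra k M →ₗ[k] k where
  toFun f := f.coeff m
  map_add' _ _ := rfl
  map_smul' _ _ := rfl

/-- Comultiplication sends `χ^m` to `χ^m ⊗ χ^m`, so contracting the first factor with the
coefficient at `m` isolates the component of weight `m`. -/
theorem rid_charProj_comul (m : M) (f : AddMonoidAlgebra k M) :
    TensorProduct.lid k _ ((charProj m).rTensor _ (Bialgebra.comulAlgHom k _ f)) =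
      .single m (f.coeff m) := by
  induction f using AddMonoidAlgebra.induction_linear with
  | zero => simp
  | add f g hf hg => simp only [map_add, hf, hg, AddMonoidAlgebra.coeff_add, Finsupp.add_apply,
      AddMonoidAlgebra.single_add]
  | single m' r =>
    have h1 : Bialgebra.comulAlgHom k (AddMonoidAlgebra k M) (.single m' r) =
        .single m' 1 ⊗ₜ .single m' r := by
      simp [Bialgebra.comulAlgHom_apply, AddMonoidAlgebra.comul_single]
    rw [h1, LinearMap.rTensor_tmul, TensorProduct.lid_tmul]
    change AddMonoidAlgebra.coeff (.single m' (1 : k)) m • _ = _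
    by_cases hm : m' = m
    · subst hm
      simp
    · simp [hm]

/-- A subalgebra of the group algebra that is stable under the coaction is spanned by
characters. -/
theorem single_mem_range {A : Type u} [CommRing A] [Algebra k A] {ψ : A →ₐ[k] AddMonoidAlgebra k M}
    {δ : A →ₐ[k] AddMonoidAlgebra k M ⊗[k] A}
    (h : (Algebra.TensorProduct.map (.id k _) ψ).comp δ =
      (Bialgebra.comulAlgHom k (AddMonoidAlgebra k M)).comp ψ) (f : A) (m : M) :
    .single m ((ψ f).coeff m) ∈ ψ.range := by
  rw [← rid_charProj_comul]
  have h1 : Bialgebra.comulAlgHom k (AddMonoidAlgebra k M) (ψ f) =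
    Algebra.TensorProduct.map (.id k _) ψ (δ f) := congr($h f).symm
  rw [h1]
  induction δ f using TensorProduct.induction_on with
  | zero => simp
  | add x y hx hy => rw [map_add, map_add, map_add]; exact add_mem hx hy
  | tmul g a =>
    simp only [Algebra.TensorProduct.map_tmul, LinearMap.rTensor_tmul, TensorProduct.lid_tmul]
    exact Subalgebra.smul_mem _ (AlgHom.mem_range_self ψ a) _

/-- The semigroup of the characters in a subalgebra. -/
def charMonoid (B : Subalgebra k (AddMonoidAlgebra k M)) : AddSubmonoid M where
  carrier := {m | .single m 1 ∈ B}
  zero_mem' := by exact one_mem B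
  add_mem' {a b} (ha : _ ∈ B) (hb : _ ∈ B) := by
    change _ ∈ B
    have := mul_mem ha hb
    rwa [AddMonoidAlgebra.single_mul_single, _root_.mul_one] at this

/-- A stable subalgebra contains all weight components of its elements, and a nonzero component is a
character up to a scalar. -/
theorem range_subAlg_charMonoid {A : Type u} [CommRing A] [Algebra k A]
    {ψ : A →ₐ[k] AddMonoidAlgebra k M} {δ : A →ₐ[k] AddMonoidAlgebra k M ⊗[k] A}
    (h : (Algebra.TensorProduct.map (.id k _) ψ).comp δ =
      (Bialgebra.comulAlgHom k (AddMonoidAlgebra k M)).comp ψ) :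
    (subAlg k (charMonoid ψ.range)).range = ψ.range := by
  refine le_antisymm ?_ ?_
  · rintro _ ⟨f, rfl⟩
    change subAlg k _ f ∈ ψ.range
    induction f using AddMonoidAlgebra.induction_linear with
    | zero => rw [map_zero]; exact zero_mem _
    | add f g hf hg => rw [map_add]; exact add_mem hf hg
    | single s r =>
      rw [subAlg_single]
      have : AddMonoidAlgebra.single (s : M) r = r • AddMonoidAlgebra.single (s : M) (1 : k) := by
        simp
      rw [this]
      exact Subalgebra.smul_mem _ s.2 _
  · rintro _ ⟨a, rfl⟩
    change ψ a ∈ _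
    have hs : ∀ m, AddMonoidAlgebra.single m ((ψ a).coeff m) ∈
        (subAlg k (charMonoid ψ.range)).range := fun m => by
      by_cases hm : (ψ a).coeff m = 0
      · rw [hm, AddMonoidAlgebra.single_zero]; exact zero_mem _
      · have h1 := Subalgebra.smul_mem _ (single_mem_range h a m) ((ψ a).coeff m)⁻¹
        rw [AddMonoidAlgebra.smul_single, smul_eq_mul, inv_mul_cancel₀ hm] at h1
        exact ⟨.single ⟨m, h1⟩ ((ψ a).coeff m), subAlg_single _ _⟩
    have hsum : ψ a = ∑ m ∈ (ψ a).coeff.support, AddMonoidAlgebra.single m ((ψ a).coeff m) :=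
      (ψ a).sum_coeff_single.symm
    rw [hsum]
    exact sum_mem fun m _ => hs m

end Coaction

section InvariantAffine

variable {k : Type u} [Field k] {M : Type u} [AddCommGroup M] [Module.Free ℤ M] [Module.Finite ℤ M]
  {Y : ToricVariety k} (e : Y.T ≅ diagGroup k M)

omit [Module.Free ℤ M] [Module.Finite ℤ M] in
theorem exists_isChart_top : ∃ c, IsChart e (⊤ : AddSubmonoid M) c := by
  have h1 := isIso_subtype (k := k) (rfl : (⊤ : AddSubmonoid M) = ⊤)
  let i : affineToric k M ⟶ Y.T.X := e.inv.hom.hom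
  have hi : e.hom.hom.hom ≫ i = 𝟙 _ := congr(($e.hom_inv_id).hom.hom)
  have h2 : IsIso i := inferInstanceAs (IsIso ((Grp.forget _).mapIso e).inv)
  have h3 : IsIso (inv (affineToricMap k (⊤ : AddSubmonoid M).subtype) ≫ i).left :=
    inferInstanceAs (IsIso ((Over.forget _).map (inv (affineToricMap k _) ≫ i)))
  refine ⟨(inv (affineToricMap k (⊤ : AddSubmonoid M).subtype) ≫ i) ≫ Y.emb, ?_, ?_⟩
  · rw [Over.comp_left]
    infer_instance
  · refine (Category.assoc _ _ _).trans ?_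
    refine (congrArg (e.hom.hom.hom ≫ ·) ?_).trans
      ((Category.assoc _ _ _).symm.trans ((congrArg (· ≫ Y.emb) hi).trans (Category.id_comp _)))
    exact (congrArg (_ ≫ ·) (Category.assoc _ _ _)).trans (@IsIso.hom_inv_id_assoc _ _ _ _ _ h1 _ _)

omit [Module.Free ℤ M] [Module.Finite ℤ M] in
-- On the torus all characters are invertible, so the orbit point is the generic point.
theorem nonunitIdeal_top : nonunitIdeal k (⊤ : AddSubmonoid M) = ⊥ := by
  refine (Submodule.eq_bot_iff _).2 fun f hf => subAlg_injective _ ?_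
  rw [map_zero]
  ext m
  exact mem_nonunitIdeal.1 hf m trivial

include e in
/-- A nonempty invariant open subscheme contains the torus. -/
theorem range_emb_subset {U : Y.X.left.Opens} (hU : IsInvariantOpen Y.T Y.X U)
    (hne : (U : Set Y.X.left).Nonempty) (x : Y.T.X.left) : Y.emb.left x ∈ U := by
  obtain ⟨c, hc⟩ := exists_isChart_top e
  obtain ⟨y, hy⟩ := Y.emb.left.denseRange.exists_mem_open U.isOpen hne
  have hemb : ∀ y, Y.emb.left y = (c ≫ 𝟙 Y.X).left ((torusMap e ⊤).left y) := fun y => by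
    rw [← hc.torusMap_comp, Category.comp_id]; rfl
  have hs : orbitPoint k (⊤ : AddSubmonoid M) ⤳ (torusMap e ⊤).left y := by
    refine (PrimeSpectrum.le_iff_specializes _ _).1 ?_
    change nonunitIdeal k (⊤ : AddSubmonoid M) ≤ _
    rw [nonunitIdeal_top]
    exact bot_le
  rw [hemb]
  refine range_le_of_orbitPoint_mem (𝟙 Y) hc hU ?_ _
  rw [hemb] at hy
  exact (hs.map (c ≫ 𝟙 Y.X).left.continuous).mem_open U.isOpen hy

omit [Module.Free ℤ M] [Module.Finite ℤ M] in
-- Rewrites the compatibility of `T → U ⊆ X` with the actions as an identity on `U` alone, by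
-- cancelling the monomorphism `v`.
theorem whiskerLeft_comp_eq {T G A X : KScheme k} [MonObj T] [MonObj G] {i : G ⟶ T} [IsMonHom i]
    {j : T ⟶ X} {act : T ⊗ X ⟶ X} (h : (T ◁ j) ≫ act = MonObj.mul ≫ j) {l : G ⟶ A} {v : A ⟶ X}
    [Mono v] (hl : l ≫ v = i ≫ j) {a : G ⊗ A ⟶ A} (ha : a ≫ v = (i ⊗ₘ v) ≫ act) :
    (G ◁ l) ≫ a = (MonObj.mul : G ⊗ G ⟶ G) ≫ l := by
  have h1 : (G ◁ l) ≫ (i ⊗ₘ v) = (i ⊗ₘ i) ≫ (T ◁ j) := by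
    rw [← id_tensorHom, ← id_tensorHom, tensorHom_comp_tensorHom, tensorHom_comp_tensorHom, hl]
    simp
  rw [← cancel_mono v, Category.assoc, ha, ← Category.assoc, h1, Category.assoc, h,
    Category.assoc, hl, ← Category.assoc, ← IsMonHom.mul_hom i, Category.assoc]

/-- A nonempty invariant affine open subscheme is an affine toric variety. -/
theorem exists_isChart_of_isAffineOpen {U : Y.X.left.Opens} (hU : IsInvariantOpen Y.T Y.X U)
    (haff : IsAffineOpen U) (hne : (U : Set Y.X.left).Nonempty) :
    ∃ (S : AddSubmonoid M) (c : affineToric k S ⟶ Y.X), IsChart e S c ∧ Set.range c.left = U := by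
  let UK : KScheme k := Over.mk (U.ι ≫ Y.X.hom)
  have hUaff : IsAffine UK.left := haff
  obtain ⟨⟨A⟩, ⟨f⟩⟩ := essImage_algSpec.2 hUaff
  let v : specK k A ⟶ Y.X := f.hom ≫ Over.homMk U.ι
  have hf : IsIso f.hom.left := inferInstanceAs (IsIso ((Over.forget _).map f.hom))
  have hv : IsOpenImmersion v.left := inferInstanceAs (IsOpenImmersion (f.hom.left ≫ U.ι))
  have hvr : Set.range v.left = U := by
    have h1 : Set.range (f.hom.left ≫ U.ι) = Set.range U.ι := by
      rw [Scheme.Hom.comp_base, TopCat.coe_comp]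
      exact f.hom.left.surjective.range_comp _
    exact h1.trans U.range_ι
  have hvr' : ∀ x, x ∈ v.left.opensRange ↔ x ∈ U := fun x => by
    change x ∈ Set.range v.left ↔ _
    rw [hvr]; rfl
  have hmono : Mono v := (Over.forget _).mono_of_mono_map (f := v)
    (inferInstanceAs (Mono v.left))
  let i : (diagGroup k M).X ⟶ Y.T.X := e.inv.hom.hom
  have hi : e.hom.hom.hom ≫ i = 𝟙 _ := congr(($e.hom_inv_id).hom.hom)
  -- With `U = Spec A`, the torus embedding and the action factor through `U`; they become `ψ : A →
  -- k[M]` and the coaction `δ`.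
  obtain ⟨l, hl⟩ := exists_lift v (i ≫ Y.emb) fun z =>
    (hvr' _).2 (range_emb_subset e hU hne (i.left z))
  obtain ⟨a, ha⟩ := exists_lift v ((i ⊗ₘ v) ≫ actionMap Y.T Y.X) fun z => by
    refine (hvr' _).2 (hU (x := (i ⊗ₘ v).left z) ?_)
    have h1 : (snd Y.T.X Y.X).left ((i ⊗ₘ v).left z) = v.left ((snd (diagGroup k M).X (specK k A)).left z) := by
      rw [← Scheme.Hom.comp_apply, ← Over.comp_left, tensorHom_snd]
      rfl
    change (snd Y.T.X Y.X).left ((i ⊗ₘ v).left z) ∈ U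
    rw [h1]
    exact (hvr' _).1 ⟨_, rfl⟩
  have hcomm := whiskerLeft_comp_eq Y.mul_emb.symm hl ha
  obtain ⟨ψ, hψ⟩ : ∃ ψ : A →ₐ[k] AddMonoidAlgebra k M, l = specKMap ψ := exists_eq_specKMap l
  obtain ⟨δ, hδ⟩ : ∃ δ : A →ₐ[k] AddMonoidAlgebra k M ⊗[k] A,
      a = (specKProd (AddMonoidAlgebra k M) A).hom ≫ specKMap δ := by
    obtain ⟨δ, hδ⟩ := exists_eq_specKMap ((specKProd (AddMonoidAlgebra k M) A).inv ≫ a)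
    exact ⟨δ, (Iso.hom_inv_id_assoc _ _).symm.trans (congrArg (_ ≫ ·) hδ)⟩
  -- Equivariance of the torus embedding says that `ψ` intertwines `δ` with comultiplication, so its
  -- image is a stable subalgebra.
  have hcoact : (Algebra.TensorProduct.map (.id k _) ψ).comp δ =
      (Bialgebra.comulAlgHom k (AddMonoidAlgebra k M)).comp ψ := by
    apply specKMap_injective (k := k)
    have h1 : (specK k (AddMonoidAlgebra k M) ◁ specKMap ψ) ≫
        (specKProd (AddMonoidAlgebra k M) A).hom ≫ specKMap δ =
        ((specKProd (AddMonoidAlgebra k M) (AddMonoidAlgebra k M)).hom ≫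
          specKMap (Bialgebra.comulAlgHom k (AddMonoidAlgebra k M))) ≫ specKMap ψ := by
      rw [hψ, hδ] at hcomm
      exact hcomm
    rwa [← Category.assoc, specKMap_whiskerLeft, Category.assoc, Category.assoc, ← specKMap_comp,
      ← specKMap_comp, cancel_epi] at h1
  -- The torus is dense in the integral scheme `Spec A`.
  have hinj : Function.Injective ψ := by
    have h1 : IsOpenImmersion (l.left ≫ v.left) := by
      rw [← Over.comp_left, hl]
      have : IsIso i.left :=
        inferInstanceAs (IsIso ((Over.forget _).map ((Grp.forget _).mapIso e).inv))
      exact inferInstanceAs (IsOpenImmersion (i.left ≫ Y.emb.left))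
    have h2 : IsOpenImmersion l.left := IsOpenImmersion.of_comp l.left v.left
    have h3 : Nonempty (specK k A).left := Nonempty.map l.left (nonempty_torus (diagGroup k M))
    have h4 : IsIntegral (specK k A).left := isIntegral_of_isOpenImmersion v.left
    have h5 : IsDomain A := (affine_isIntegral_iff (.of A)).1 h4
    have h6 : IsDominant l.left :=
      @isDominant_of_isOpenImmersion _ _ l.left h2 (nonempty_torus (diagGroup k M)) inferInstance
    rw [hψ] at h6
    have h7 := (PrimeSpectrum.denseRange_comap_iff_ker_le_nilRadical ψ.toRingHom).1 h6.denseRange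
    rw [nilradical_eq_zero, Ideal.zero_eq_bot, le_bot_iff] at h7
    exact (RingHom.injective_iff_ker_eq_bot ψ.toRingHom).2 h7
  have hrange := range_subAlg_charMonoid hcoact
  set S := charMonoid ψ.range
  let θ : A ≃ₐ[k] AddMonoidAlgebra k S :=
    (AlgEquiv.ofInjective ψ hinj).trans ((Subalgebra.equivOfEq _ _ hrange.symm).trans
      (AlgEquiv.ofInjective (subAlg k S) (subAlg_injective S)).symm)
  have hθ : (subAlg k S).comp θ.toAlgHom = ψ := by
    ext1 x
    change (AlgEquiv.ofInjective (subAlg k S) (subAlg_injective S)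
      ((AlgEquiv.ofInjective (subAlg k S) (subAlg_injective S)).symm
        ⟨ψ x, hrange ▸ AlgHom.mem_range_self ψ x⟩) : AddMonoidAlgebra k M) = ψ x
    rw [AlgEquiv.apply_symm_apply]
  have hθi : IsIso (specKMap θ.toAlgHom) := by
    refine ⟨specKMap θ.symm.toAlgHom, ?_, ?_⟩
    · rw [← specKMap_comp, AlgEquiv.comp_symm]
      exact (algSpec (CommRingCat.of k)).map_id _
    · rw [← specKMap_comp, AlgEquiv.symm_comp]
      exact (algSpec (CommRingCat.of k)).map_id _
  have hθi' : IsIso (specKMap θ.toAlgHom).left :=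
    inferInstanceAs (IsIso ((Over.forget _).map (specKMap θ.toAlgHom)))
  refine ⟨S, specKMap θ.toAlgHom ≫ v, ⟨?_, ?_⟩, ?_⟩
  · exact inferInstanceAs (IsOpenImmersion ((specKMap θ.toAlgHom).left ≫ v.left))
  · have h1 : specKMap (subAlg k S) ≫ specKMap θ.toAlgHom = specKMap ψ := by
      rw [← specKMap_comp, hθ]
    have h2 : specKMap (subAlg k S) ≫ specKMap θ.toAlgHom ≫ v = i ≫ Y.emb := by
      rw [← Category.assoc, h1]
      exact (congrArg (· ≫ v) hψ.symm).trans hl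
    exact (Category.assoc _ _ _).trans ((congrArg (e.hom.hom.hom ≫ ·) h2).trans
      ((Category.assoc _ _ _).symm.trans ((congrArg (· ≫ Y.emb) hi).trans (Category.id_comp _))))
  · rw [← hvr, Over.comp_left, Scheme.Hom.comp_base, TopCat.coe_comp]
    exact (specKMap θ.toAlgHom).left.surjective.range_comp _

end InvariantAffine

/-! ### The fan of a toric variety -/

section Charts

variable {k : Type u} [Field k] {M : Type u} [AddCommGroup M] [Module.Free ℤ M] [Module.Finite ℤ M]
  {Y : ToricVariety k} {e : Y.T ≅ diagGroup k M} {S S' : AddSubmonoid M}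
  {c : affineToric k S ⟶ Y.X} {c' : affineToric k S' ⟶ Y.X}

theorem IsChart.inclusion_comp (hc : IsChart e S c) (hc' : IsChart e S' c') (h : S ≤ S') :
    affineToricMap k (AddSubmonoid.inclusion h) ≫ c = c' := by
  refine eq_of_torusMap_comp (e := e) ?_
  rw [← Category.assoc, torusMap_comp_inclusion, hc.torusMap_comp, hc'.torusMap_comp]

omit [Module.Free ℤ M] [Module.Finite ℤ M] in
theorem IsChart.of_inclusion (hc : IsChart e S c) (h : S ≤ S')
    (ho : IsOpenImmersion (affineToricMap k (AddSubmonoid.inclusion h)).left) :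
    IsChart e S' (affineToricMap k (AddSubmonoid.inclusion h) ≫ c) := by
  have := hc.isOpenImmersion
  refine ⟨?_, ?_⟩
  · rw [Over.comp_left]; infer_instance
  · rw [← Category.assoc, torusMap_comp_inclusion, hc.torusMap_comp]

theorem IsChart.isOpenImmersion_inclusion (hc : IsChart e S c) (hc' : IsChart e S' c')
    (h : S ≤ S') : IsOpenImmersion (affineToricMap k (AddSubmonoid.inclusion h)).left := by
  have := hc.isOpenImmersion
  have := hc'.isOpenImmersion
  have : IsOpenImmersion ((affineToricMap k (AddSubmonoid.inclusion h)).left ≫ c.left) := by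
    rw [← Over.comp_left, hc.inclusion_comp hc' h]; infer_instance
  exact IsOpenImmersion.of_comp _ c.left

/-- The map between the two charts is an open immersion, so every character of `S'` has a
denominator in `S` that is invertible in `S'`. -/
theorem IsChart.exists_eq_invert (hc : IsChart e S c) (hc' : IsChart e S' c') (h : S ≤ S') :
    ∃ F, IsFaceSubset F S ∧ S' = invert S F := by
  have := hc.isOpenImmersion_inclusion hc' h
  exact ⟨_, isFaceSubset_units h,
    eq_invert_of_exists h fun x hx => exists_denominator_of_isOpenImmersion (k := k) h hx⟩

omit [Module.Free ℤ M] [Module.Finite ℤ M] in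
theorem IsChart.exists_isChart_invert (hc : IsChart e S c) {F : Set M} (hF : IsFaceSubset F S) :
    ∃ c', IsChart e (invert S F) c' := by
  obtain ⟨a, ha, h⟩ := hF.exists_invert_eq_locAt hc.fg
  exact ⟨_, hc.of_inclusion (le_invert S F)
    (isOpenImmersion_inclusion_of_eq_locAt (hF.subset ha) h _)⟩

/-- The torus is open in the chart, so every character is a difference of two elements of `S`. -/
theorem IsChart.closure_eq_top (hc : IsChart e S c) : AddSubgroup.closure (S : Set M) = ⊤ := by
  obtain ⟨c', hc'⟩ := exists_isChart_top e
  have := hc.isOpenImmersion_inclusion hc' le_top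
  refine top_le_iff.1 fun x _ => ?_
  obtain ⟨a, ha, -, hax⟩ := exists_denominator_of_isOpenImmersion (k := k) (le_top : S ≤ ⊤)
    (AddSubmonoid.mem_top x)
  have h1 := sub_mem (AddSubgroup.subset_closure hax) (AddSubgroup.subset_closure (k := (S : Set M)) ha)
  simpa using h1

omit [Module.Free ℤ M] [Module.Finite ℤ M] in
-- The smaller chart factors through the larger one, and the factorization is the identity on the
-- torus.
theorem IsChart.le_of_range_subset (hc : IsChart e S c) (hc' : IsChart e S' c')
    (h : Set.range c'.left ⊆ Set.range c.left) : S ≤ S' := by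
  have := hc.isOpenImmersion
  have hm : Mono c := (Over.forget _).mono_of_mono_map (f := c) (inferInstanceAs (Mono c.left))
  obtain ⟨l, hl⟩ := exists_lift c c' fun z => h ⟨z, rfl⟩
  have h1 : torusMap e S' ≫ l = torusMap e S := by
    rw [← cancel_mono c, Category.assoc, hl, hc.torusMap_comp, hc'.torusMap_comp]
  have he : Epi e.hom.hom.hom := inferInstanceAs (Epi ((Grp.forget _).mapIso e).hom)
  have h2 : affineToricMap k S'.subtype ≫ l =
      affineToricMap k (AddMonoidHom.id M) ≫ affineToricMap k S.subtype := by
    have h3 : affineToricMap k (AddMonoidHom.id M) = 𝟙 _ := by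
      have : AddMonoidAlgebra.mapDomainAlgHom k k (AddMonoidHom.id M) = .id k _ := by ext; simp
      exact (congrArg specKMap this).trans ((algSpec (CommRingCat.of k)).map_id _)
    rw [h3, Category.id_comp]
    exact he.left_cancellation _ _ ((Category.assoc _ _ _).symm.trans h1)
  simpa using map_le_of_comp_eq h2

/-- The intersection of two charts is the chart of the sum of their semigroups. -/
theorem IsChart.exists_isChart_sup (hc : IsChart e S c) (hc' : IsChart e S' c') :
    ∃ c'' : affineToric k (S ⊔ S' : AddSubmonoid M) ⟶ Y.X, IsChart e (S ⊔ S') c'' ∧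
      Set.range c''.left = Set.range c.left ∩ Set.range c'.left := by
  have := hc.isOpenImmersion
  have := hc'.isOpenImmersion
  -- Separatedness makes the intersection of the two affine charts affine, so it is again a chart,
  -- of some semigroup `T`.
  have hsep : Y.X.left.IsSeparated := ⟨by
    rw [← Limits.terminal.comp_from Y.X.hom]; infer_instance⟩
  have haff (S : AddSubmonoid M) : IsAffine (affineToric k S).left :=
    inferInstanceAs (IsAffine (Spec (.of (AddMonoidAlgebra k S))))
  have hne : Nonempty Y.T.X.left := inferInstance
  have hinv : IsInvariantOpen Y.T Y.X (c.left.opensRange ⊓ c'.left.opensRange) := fun z hz =>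
    ⟨hc.isInvariantOpen hz.1, hc'.isInvariantOpen hz.2⟩
  have hmem : ∀ {S : AddSubmonoid M} {c : affineToric k S ⟶ Y.X}, IsChart e S c →
      ∀ x, Y.emb.left x ∈ Set.range c.left := fun hc x => by
    rw [← hc.torusMap_comp]
    exact ⟨_, (Scheme.Hom.comp_apply _ _ _).symm⟩
  obtain ⟨T, c'', hc'', hr⟩ := exists_isChart_of_isAffineOpen e hinv
    ((isAffineOpen_opensRange c.left).inf (isAffineOpen_opensRange c'.left))
    ⟨Y.emb.left (Classical.arbitrary _), hmem hc _, hmem hc' _⟩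
  have hr' : Set.range c''.left = Set.range c.left ∩ Set.range c'.left := hr
  have h := hc.le_of_range_subset hc'' (hr'.trans_subset Set.inter_subset_left)
  have h' := hc'.le_of_range_subset hc'' (hr'.trans_subset Set.inter_subset_right)
  have hpb : IsPullback (affineToricMap k (AddSubmonoid.inclusion h))
      (affineToricMap k (AddSubmonoid.inclusion h')) c c' := by
    have := hc'.isOpenImmersion_inclusion hc'' h'
    refine IsPullback.of_map (Over.forget _)
      ((hc.inclusion_comp hc'' h).trans (hc'.inclusion_comp hc'' h').symm) ?_
    refine isPullback_of_range (f := c.left) (g := c'.left)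
      (b := (affineToricMap k (AddSubmonoid.inclusion h')).left) ?_ ?_
    · change (affineToricMap k _).left ≫ c.left = (affineToricMap k _).left ≫ c'.left
      rw [← Over.comp_left, ← Over.comp_left, hc.inclusion_comp hc'' h,
        hc'.inclusion_comp hc'' h']
    · rw [← Over.comp_left, hc'.inclusion_comp hc'' h', hr']
  -- The graph of the intersection is the pullback of the closed diagonal; this forces `T ≤ S + S'`.
  have hcl : IsClosedImmersion (lift (affineToricMap k (AddSubmonoid.inclusion h))
      (affineToricMap k (AddSubmonoid.inclusion h'))).left := by
    have h1 := (isPullback_diagonal hpb).map (Over.forget _)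
    have h2 : IsClosedImmersion (lift (𝟙 Y.X) (𝟙 Y.X)).left :=
      inferInstanceAs (IsClosedImmersion (Limits.pullback.diagonal Y.X.hom))
    exact MorphismProperty.of_isPullback (P := @IsClosedImmersion) h1 h2
  obtain rfl : T = S ⊔ S' := le_antisymm (le_sup_of_isClosedImmersion h h' hcl) (sup_le h h')
  exact ⟨c'', hc'', hr'⟩

end Charts

/-! ### The triple of a toric variety. -/

section FanOfCharts

variable {k : Type u} [Field k]

theorem ToricVariety.exists_torusIso (Y : ToricVariety k) :
    ∃ d : ℕ, Nonempty (Y.T ≅ diagGroup k (DualLattice (ULift.{u} (Fin d) → ℤ))) := by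
  obtain ⟨d, ⟨i⟩⟩ := Y.isTorus
  exact ⟨d, ⟨i ≪≫ diagGroupIso k (Pi.basisFun ℤ (ULift.{u} (Fin d))).toDualEquiv.toAddEquiv⟩⟩

section

variable {M : Type u} [AddCommGroup M] [Module.Free ℤ M] [Module.Finite ℤ M]
  {Y : ToricVariety k} {e : Y.T ≅ diagGroup k M} {S : AddSubmonoid M}

theorem exists_isChart_of_mem {U : Y.X.left.Opens} (hU : IsInvariantOpen Y.T Y.X U)
    (haff : IsAffineOpen U) {c : affineToric k S ⟶ Y.X} (hc : IsChart e S c)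
    (hx : c.left (orbitPoint k S) ∈ U) :
    ∃ (S' : AddSubmonoid M) (c' : affineToric k S' ⟶ Y.X), IsChart e S' c' ∧
      Set.range c'.left = U ∧ S' ≤ S := by
  obtain ⟨S', c', hc', hr⟩ := exists_isChart_of_isAffineOpen e hU haff ⟨_, hx⟩
  have h := range_le_of_orbitPoint_mem (𝟙 Y) hc hU
    (by rwa [show c ≫ ToricVariety.Hom.hom (𝟙 Y) = c from Category.comp_id c])
  rw [show c ≫ ToricVariety.Hom.hom (𝟙 Y) = c from Category.comp_id c] at h
  refine ⟨S', c', hc', hr, hc'.le_of_range_subset hc ?_⟩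
  rw [hr]
  rintro _ ⟨x, rfl⟩
  exact h x

variable (e) in
/-- The semigroups of the affine charts of a toric variety. -/
def chartMonoids : Set (AddSubmonoid M) := {S | ∃ c : affineToric k S ⟶ Y.X, IsChart e S c}

variable (e) in
-- The orbit point of a chart lies in a member of the finite cover, which then contains the whole
-- chart. So the semigroup is one of the finitely many localizations of that member's semigroup.
theorem finite_chartMonoids : (chartMonoids e).Finite := by
  obtain ⟨𝒰, hfin, h𝒰, hcov⟩ := Y.exists_cover
  have key (U : Y.X.left.Opens) : {S ∈ chartMonoids e | ∃ S' c', IsChart e S' c' ∧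
      Set.range c'.left = U ∧ S' ≤ S}.Finite := by
    by_cases hS' : ∃ S' c', IsChart e S' c' ∧ Set.range c'.left = U
    · obtain ⟨S', c', hc', hr'⟩ := hS'
      refine (finite_localizations hc'.fg).subset ?_
      rintro S ⟨⟨c, hc⟩, S'', c'', hc'', hr'', hle⟩
      exact hc'.exists_eq_invert hc ((hc'.le_of_range_subset hc'' (hr''.trans hr'.symm).le).trans hle)
    · refine Set.finite_empty.subset ?_
      rintro S ⟨-, S', c', hc', hr', -⟩
      exact hS' ⟨S', c', hc', hr'⟩
  refine (hfin.biUnion fun U _ => key U).subset ?_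
  rintro S ⟨c, hc⟩
  have hx : c.left (orbitPoint k S) ∈ sSup 𝒰 := by rw [hcov]; trivial
  obtain ⟨U, hU, hxU⟩ := TopologicalSpace.Opens.mem_sSup.1 hx
  exact Set.mem_biUnion hU ⟨⟨c, hc⟩, exists_isChart_of_mem (h𝒰 U hU).2 (h𝒰 U hU).1 hc hxU⟩

variable (e) in
theorem exists_isChart_of_point (x : Y.X.left) :
    ∃ (S : AddSubmonoid M) (c : affineToric k S ⟶ Y.X), IsChart e S c ∧ x ∈ Set.range c.left := by
  obtain ⟨𝒰, hfin, h𝒰, hcov⟩ := Y.exists_cover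
  have hx : x ∈ sSup 𝒰 := by rw [hcov]; trivial
  obtain ⟨U, hU, hxU⟩ := TopologicalSpace.Opens.mem_sSup.1 hx
  obtain ⟨S, c, hc, hr⟩ := exists_isChart_of_isAffineOpen e (h𝒰 U hU).2 (h𝒰 U hU).1 ⟨x, hxU⟩
  exact ⟨S, c, hc, hr ▸ hxU⟩

end

variable {N : Type u} [AddCommGroup N] [Module.Free ℤ N] [Module.Finite ℤ N]
  {Y : ToricVariety k} {e : Y.T ≅ diagGroup k (DualLattice N)} {S S' : AddSubmonoid (DualLattice N)}

/-- The intersection of the two charts is a localization of `S` with the cone of `S`; the characters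
inverted vanish on this cone and are invertible in `S` already. -/
theorem IsChart.sup_le_of_coneOf_eq {c : affineToric k S ⟶ Y.X} {c' : affineToric k S' ⟶ Y.X}
    (hc : IsChart e S c) (hc' : IsChart e S' c')
    (h : coneOf (S : Set (DualLattice N)) = coneOf (S' : Set (DualLattice N))) : S ⊔ S' ≤ S := by
  obtain ⟨c'', hc'', -⟩ := hc.exists_isChart_sup hc'
  obtain ⟨F, hF, hS⟩ := hc.exists_eq_invert hc'' le_sup_left
  rw [hS]
  refine invert_le_of_coneOf_le hF.subset hc.fg le_rfl ?_
  rw [← hS, coneOf_sup, ← h, inf_idem]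

theorem coneOf_injOn_chartMonoids :
    Set.InjOn (fun S : AddSubmonoid (DualLattice N) => coneOf (S : Set (DualLattice N)))
      (chartMonoids e) := by
  rintro S ⟨c, hc⟩ S' ⟨c', hc'⟩ h
  exact le_antisymm (le_sup_right.trans (hc'.sup_le_of_coneOf_eq hc h.symm))
    (le_sup_right.trans (hc.sup_le_of_coneOf_eq hc' h))

variable (e) in
/-- The fan of a toric variety. -/
def fanOf : Fan N where
  cones := (fun S : AddSubmonoid (DualLattice N) => coneOf (S : Set (DualLattice N))) ''
    chartMonoids e
  finite := (finite_chartMonoids e).image _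
  nonempty := ⟨_, ⊤, exists_isChart_top e, rfl⟩
  rational := by
    rintro _ ⟨S, ⟨c, hc⟩, rfl⟩
    obtain ⟨G, rfl⟩ := hc.fg
    simp only [coneOf_closure]
    exact isRationalPolyhedral_coneOf G.finite_toSet
  strictlyConvex := by
    rintro _ ⟨S, ⟨c, hc⟩, rfl⟩
    exact salient_coneOf hc.closure_eq_top
  face_mem := by
    rintro _ ⟨S, ⟨c, hc⟩, rfl⟩ τ hτ
    exact ⟨_, hc.exists_isChart_invert (isFaceSubset_perp hτ.le), coneOf_invert_perp hc.fg hτ⟩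
  inter_isFace := by
    have key {S S' : AddSubmonoid (DualLattice N)} (h : S ∈ chartMonoids e)
        (h' : S' ∈ chartMonoids e) :
        (coneOf (S : Set (DualLattice N)) ⊓ coneOf (S' : Set (DualLattice N))).IsFaceOf
          (coneOf (S : Set (DualLattice N))) := by
      obtain ⟨c, hc⟩ := h
      obtain ⟨c', hc'⟩ := h'
      -- The intersection of the cones is the cone of `S + S'`, a localization of `S`, hence a face.
      obtain ⟨c'', hc'', -⟩ := hc.exists_isChart_sup hc'
      obtain ⟨F, hF, hS⟩ := hc.exists_eq_invert hc'' le_sup_left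
      rw [← coneOf_sup, hS]
      exact isFaceOf_coneOf_invert hF.subset
    rintro _ ⟨S, h, rfl⟩ _ ⟨S', h', rfl⟩
    exact ⟨key h h', inf_comm (coneOf (S' : Set (DualLattice N))) (coneOf (S : Set (DualLattice N))) ▸
      key h' h⟩

/-- A chart semigroup is determined by its cone, so `Γ` is well defined on the fan. The face
condition follows by applying this uniqueness to the localization of `Γ_σ` at the face. -/
theorem exists_triple (Y : ToricVariety k) :
    ∃ t : ToricTriple.{u}, Nonempty (GluingData t Y) := by
  obtain ⟨d, ⟨e⟩⟩ := Y.exists_torusIso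
  have hΓ (σ : (fanOf e).cones) : ∃ S c, IsChart e S c ∧ coneOf (S : Set (DualLattice _)) = σ.1 := by
    obtain ⟨_, S, ⟨c, hc⟩, rfl⟩ := σ
    exact ⟨S, c, hc, rfl⟩
  choose Γ c hc hσ using hΓ
  have hΓ_eq {S c'} (h : IsChart e S c') (σ : (fanOf e).cones)
      (h' : coneOf (S : Set (DualLattice _)) = σ.1) : Γ σ = S :=
    coneOf_injOn_chartMonoids ⟨_, hc σ⟩ ⟨_, h⟩ ((hσ σ).trans h'.symm)
  have hrange {S c'} (h : IsChart e S c') (σ : (fanOf e).cones)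
      (h' : coneOf (S : Set (DualLattice _)) = σ.1) : Set.range (c σ).left = Set.range c'.left := by
    obtain rfl := hΓ_eq h σ h'
    rw [(hc σ).eq h]
  let t : ToricTriple.{u} :=
    { N := ULift.{u} (Fin d) → ℤ
      fan := fanOf e
      Γ := Γ
      fg := fun σ => (hc σ).fg
      closure_eq_top := fun σ => (hc σ).closure_eq_top
      hull_eq_dualCone := fun σ => by rw [hull_realChar_eq_dualCone (hc σ).fg, hσ]
      face_eq := fun σ τ h => by
        rw [← hσ σ] at h
        obtain ⟨c', hc'⟩ := (hc σ).exists_isChart_invert (isFaceSubset_perp h.le)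
        exact hΓ_eq hc' τ (coneOf_invert_perp (hc σ).fg h) }
  refine ⟨t, ⟨{
    torusIso := e
    chart := c
    isOpenImmersion := fun σ => (hc σ).isOpenImmersion
    emb_eq := fun σ => ?_
    chart_face := fun σ τ h _ => (hc σ).inclusion_comp (hc τ) h
    cover := ?_
    inter := fun σ σ' τ h => ?_ }⟩⟩
  · exact (Category.assoc _ _ _).symm.trans (hc σ).torusMap_comp
  · refine top_le_iff.1 fun x _ => ?_
    obtain ⟨S, c', hc', hx⟩ := exists_isChart_of_point e x
    refine TopologicalSpace.Opens.mem_iSup.2 ⟨⟨_, S, ⟨c', hc'⟩, rfl⟩, ?_⟩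
    change x ∈ Set.range _
    rwa [hrange hc' _ rfl]
  · obtain ⟨c'', hc'', hr⟩ := (hc σ).exists_isChart_sup (hc σ')
    refine TopologicalSpace.Opens.ext ?_
    change Set.range _ ∩ Set.range _ = Set.range _
    rw [← hr, hrange hc'' τ (by rw [coneOf_sup, hσ, hσ, h])]

end FanOfCharts

/-! ### The functor and its equivalence properties. -/

section Equivalence

variable (k : Type u) [Field k]

/-- The toric variety of a triple. -/
def toricVarietyOf (t : ToricTriple.{u}) : ToricVariety k := (exists_gluingData k t).choose

/-- The charts of the toric variety of a triple. -/
def gluingDataOf (t : ToricTriple.{u}) : GluingData t (toricVarietyOf k t) :=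
  (exists_gluingData k t).choose_spec.some

variable {k}

theorem hom_ext_of_comp {Y' Y : ToricVariety k} {M : Type u} [AddCommGroup M]
    (e : Y.T ≅ diagGroup k M) {f g : Y' ⟶ Y} (h : f.torusHom ≫ e.hom = g.torusHom ≫ e.hom) :
    f = g :=
  ToricVariety.hom_ext ((cancel_mono e.hom).1 h)

variable (k)

/-- The functor that sends a triple to its toric variety. -/
def toricFunctor : ToricTriple.{u} ⥤ ToricVariety k where
  obj := toricVarietyOf k
  -- The chosen morphism is the only one with the prescribed torus homomorphism, so functoriality
  -- reduces to that of `diagGroupMap`.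
  map {t' t} φ := (exists_hom (gluingDataOf k t') (gluingDataOf k t) φ).choose
  map_id t := hom_ext_of_comp (gluingDataOf k t).torusIso <| by
    rw [(exists_hom (gluingDataOf k t) (gluingDataOf k t) (𝟙 t)).choose_spec]
    refine (congrArg (_ ≫ ·) (diagGroupMap_id (DualLattice t.N))).trans ?_
    exact (Category.comp_id _).trans (Category.id_comp _).symm
  map_comp {t₁ t₂ t₃} f g := hom_ext_of_comp (gluingDataOf k t₃).torusIso <| by
    have hf := (exists_hom (gluingDataOf k t₁) (gluingDataOf k t₂) f).choose_spec
    have hg := (exists_hom (gluingDataOf k t₂) (gluingDataOf k t₃) g).choose_spec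
    refine (exists_hom (gluingDataOf k t₁) (gluingDataOf k t₃) (f ≫ g)).choose_spec.trans ?_
    refine (congrArg (_ ≫ ·)
      (diagGroupMap_comp (dualMap g.toLinearMap) (dualMap f.toLinearMap))).trans ?_
    exact (Category.assoc _ _ _).symm.trans ((congrArg (· ≫ diagGroupMap k _) hf.symm).trans
      ((Category.assoc _ _ _).trans ((congrArg (_ ≫ ·) hg.symm).trans (Category.assoc _ _ _).symm)))

theorem toricFunctor_map {t' t : ToricTriple.{u}} (φ : t' ⟶ t) :
    ((toricFunctor k).map φ).torusHom ≫ (gluingDataOf k t).torusIso.hom =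
      (gluingDataOf k t').torusIso.hom ≫ diagGroupMap k (dualMap φ.toLinearMap) :=
  (exists_hom (gluingDataOf k t') (gluingDataOf k t) φ).choose_spec

instance : (toricFunctor k).Faithful where
  map_injective {t' t} f g h := by
    have h1 := (toricFunctor_map k f).symm.trans ((congrArg (fun x => ToricVariety.Hom.torusHom x ≫
      (gluingDataOf k t).torusIso.hom) h).trans (toricFunctor_map k g))
    exact ToricTriple.Hom.ext (dualMap_injective (diagGroupMap_injective ((cancel_epi _).1 h1)))

instance : (toricFunctor k).Full where
  map_surjective {t' t} h := by
    obtain ⟨φ, hφ⟩ := exists_preimage (gluingDataOf k t') (gluingDataOf k t) h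
    exact ⟨φ, hom_ext_of_comp (gluingDataOf k t).torusIso ((toricFunctor_map k φ).trans hφ.symm)⟩

theorem GluingData.comp_eq_id {t : ToricTriple.{u}} {Y Y' : ToricVariety k} {R : GluingData t Y}
    {R' : GluingData t Y'} {f : Y ⟶ Y'} {g : Y' ⟶ Y}
    (hf : f.torusHom ≫ R'.torusIso.hom =
      R.torusIso.hom ≫ diagGroupMap k (dualMap (𝟙 t : t ⟶ t).toLinearMap))
    (hg : g.torusHom ≫ R.torusIso.hom =
      R'.torusIso.hom ≫ diagGroupMap k (dualMap (𝟙 t : t ⟶ t).toLinearMap)) : f ≫ g = 𝟙 Y := by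
  have hid : diagGroupMap k (dualMap (𝟙 t : t ⟶ t).toLinearMap) = 𝟙 _ :=
    diagGroupMap_id (DualLattice t.N)
  rw [hid, Category.comp_id] at hf hg
  refine hom_ext_of_comp R.torusIso ?_
  change (f.torusHom ≫ g.torusHom) ≫ _ = 𝟙 _ ≫ _
  rw [Category.assoc, hg, hf, Category.id_comp]

/-- Both `Y` and the image of `t` carry gluing data for the same triple, so the identity of `t`
induces mutually inverse morphisms between them. -/
instance : (toricFunctor k).EssSurj where
  mem_essImage Y := by
    obtain ⟨t, ⟨R⟩⟩ := exists_triple Y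
    obtain ⟨f, hf⟩ := exists_hom (gluingDataOf k t) R (𝟙 t)
    obtain ⟨g, hg⟩ := exists_hom R (gluingDataOf k t) (𝟙 t)
    exact ⟨t, ⟨⟨f, g, GluingData.comp_eq_id k hf hg, GluingData.comp_eq_id k hg hf⟩⟩⟩

end Equivalence

end ToricGeometry

end

theorem mainTheorem6 (k : Type u) [Field k] :
    ∃ F : ToricGeometry.ToricTriple.{u} ⥤ ToricGeometry.ToricVariety k,
      F.IsEquivalence ∧
      ∃ R : ∀ t : ToricGeometry.ToricTriple.{u}, ToricGeometry.GluingData t (F.obj t),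
        ∀ {t' t : ToricGeometry.ToricTriple.{u}} (φ : t' ⟶ t),
          (F.map φ).torusHom ≫ (R t).torusIso.hom =
            (R t').torusIso.hom ≫
              ToricGeometry.diagGroupMap k (ToricGeometry.dualMap φ.toLinearMap) :=
  ⟨ToricGeometry.toricFunctor k, {}, ToricGeometry.gluingDataOf k,
    fun φ => ToricGeometry.toricFunctor_map k φ⟩
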